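/- Let $n\ge 2$. A convex body in $\mathbb{R}^n$ is a nonempty compact convex set; it has constant width $1$ if $h(K,u)+h(K,-u)=1$ for all unit vectors $u$, where $h(K,u)=\max_{y\in K}\langle y,u\rangle$. Let $\mathcal{W}^n_1$ be the space of convex bodies of constant width $1$ in $\mathbb{R}^n$ with the Hausdorff metric. Let $x$ be a smooth boundary point of $K\in\mathcal{W}^n_1$, that is, a boundary point with exactly one outer unit normal vector $u$, and let $t$ be a unit vector orthogonal to $u$. For a relative boundary point $z$ of the planar section $K\cap(x+\mathrm{lin}\{u,t\})$ with $\langle z-x,t\rangle>0$, let $r(z)$ be the radius of the circle through $x$ and $z$ with centre on the ray $\{x-\lambda u:\lambda\ge 0\}$ (with $r(z)=\infty$ if there is no such circle). If $\liminf_{z\to x}r(z)=\limsup_{z\to x}r(z)$, the common value in $[0,\infty]$ is called the radius of curvature of $K$ at $x$ in direction $t$. We say that all radii of curvature of $K$ at $x$ are equal to $\varrho$ if $x$ is a smooth boundary point of $K$ and, for every unit vector $t$ orthogonal to the outer unit normal vector at $x$, the radius of curvature of $K$ at $x$ in direction $t$ exists and is equal to $\varrho$. Theorem. There is a comeagre subset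 of $\mathcal{W}^n_1$ such that every $K$ in it has the following two properties. (1) For $\mathcal{H}^{n-1}$-almost all $x\in\mathrm{bd}\,K$, all radii of curvature of $K$ at $x$ are equal to $1$. (2) The set of the points $x\in\mathrm{bd}\,K$ at which all radii of curvature of $K$ are equal to $0$ is uncountable and dense in $\mathrm{bd}\,K$. -/

import Mathlib

open Filter Topology MeasureTheory
open scoped ENNReal NNReal

noncomputable section

namespace ConstantWidth

variable {V : Type*} [NormedAddCommGroup V] [InnerProductSpace ℝ V]

/-- The support function `h(K, u) = max {⟪y, u⟫ : y ∈ K}` of a convex body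
(the supremum is a maximum, since `K` is nonempty and compact). -/
def supportFn (K : ConvexBody V) (u : V) : ℝ :=
  sSup ((fun y : V => inner ℝ y u) '' (K : Set V))

/-- `K` is of constant width `d`: `h(K, u) + h(K, -u) = d` for all unit vectors `u`. -/
def HasConstantWidth (K : ConvexBody V) (d : ℝ) : Prop :=
  ∀ u : V, ‖u‖ = 1 → supportFn K u + supportFn K (-u) = d

variable (V) in
/-- The space of convex bodies of constant width `1`, with the Hausdorff metric inherited from
`ConvexBody V`. -/
abbrev ConstantWidthOne : Type _ := {K : ConvexBody V // HasConstantWidth K 1}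

/-- `u` is an outer unit normal vector of the set `K` at its point `x`. -/
def IsOuterUnitNormal (K : Set V) (x u : V) : Prop :=
  x ∈ K ∧ ‖u‖ = 1 ∧ ∀ y ∈ K, inner ℝ (y - x) u ≤ 0

/-- The radius of the circle with centre on the ray `{x - ρ u : ρ ≥ 0}` that passes through `x`
and `z` (for `z ≠ x` there is at most one such circle); it is `∞` if there is no such circle. -/
def circleRadius (x u z : V) : ℝ≥0∞ :=
  ⨅ (ρ : ℝ≥0) (_ : dist z (x - (ρ : ℝ) • u) = ρ), (ρ : ℝ≥0∞)

/-- The open half-plane `{x + l u + m t : m > 0}` of the plane `x + lin {u, t}`. -/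
def openHalfPlane (x u t : V) : Set V :=
  {z | ∃ l m : ℝ, 0 < m ∧ z = x + l • u + m • t}

/-- The filter `z → x`, where `z` is in the relative boundary of the planar convex set `S`
and in the open half-plane of points that lie in direction `t` from `x`. -/
def boundaryFilter (S : Set V) (x u t : V) : Filter V :=
  𝓝[openHalfPlane x u t ∩ intrinsicFrontier ℝ S] x

/-- The lower radius of curvature at `(x, u)` in direction `t` of a two-dimensional convex body `S`
that lies in the plane `x + lin {u, t}`. -/
def planarLowerRadius (S : Set V) (x u t : V) : ℝ≥0∞ :=
  liminf (circleRadius x u) (boundaryFilter S x u t)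

/-- The upper radius of curvature at `(x, u)` in direction `t` of a two-dimensional convex body `S`
that lies in the plane `x + lin {u, t}`. -/
def planarUpperRadius (S : Set V) (x u t : V) : ℝ≥0∞ :=
  limsup (circleRadius x u) (boundaryFilter S x u t)

/-- The section of `K` by the plane `x + lin {u, t}`. -/
def planeSection (K : Set V) (x u t : V) : Set V :=
  K ∩ (AffineSubspace.mk' x (Submodule.span ℝ {u, t}) : Set V)

/-- The (sectional) radius of curvature of `K` at the support element `(x, u)` in direction `t`
exists and is equal to `ρ`: the lower and the upper radius of curvature of the planar section
are both equal to `ρ`. -/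
def HasRadiusOfCurvature (K : Set V) (x u t : V) (ρ : ℝ≥0∞) : Prop :=
  planarLowerRadius (planeSection K x u t) x u t = ρ ∧
    planarUpperRadius (planeSection K x u t) x u t = ρ

/-- `x` is a smooth boundary point of `K` (there is exactly one outer unit normal vector `u` of `K`
at `x`), and for every unit vector `t` orthogonal to `u`, the radius of curvature of `K` at `x`
in direction `t` exists and is equal to `ρ`. -/
def AllRadiiOfCurvatureEq (K : Set V) (x : V) (ρ : ℝ≥0∞) : Prop :=
  x ∈ frontier K ∧ ∃ u : V, IsOuterUnitNormal K x u ∧ (∀ v : V, IsOuterUnitNormal K x v → v = u) ∧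
    ∀ t : V, ‖t‖ = 1 → inner ℝ t u = 0 → HasRadiusOfCurvature K x u t ρ

/-- Explicit value of the radius used in the definition of osculating circles. -/
theorem circleRadius_eq {x u z : V} (hu : ‖u‖ = 1) (hz : z ≠ x) :
    circleRadius x u z =
      ENNReal.ofReal (‖z - x‖ ^ 2) / ENNReal.ofReal (2 * inner ℝ (x - z) u) := by
  have hpos : 0 < ‖z - x‖ ^ 2 := by
    have := norm_pos_iff.2 (sub_ne_zero.2 hz)
    positivity
  have key : ∀ ρ : ℝ≥0, dist z (x - (ρ : ℝ) • u) = ρ ↔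
      ‖z - x‖ ^ 2 = ρ * (2 * inner ℝ (x - z) u) := by
    intro ρ
    have e : z - (x - (ρ : ℝ) • u) = (z - x) + (ρ : ℝ) • u := by abel
    have n : ‖(z - x) + (ρ : ℝ) • u‖ ^ 2 =
        ‖z - x‖ ^ 2 - ρ * (2 * inner ℝ (x - z) u) + (ρ : ℝ) ^ 2 := by
      rw [norm_add_sq_real, norm_smul, hu, inner_smul_right, ← neg_sub x z, inner_neg_left]
      simp
      ring
    rw [dist_eq_norm, e, ← sq_eq_sq₀ (norm_nonneg _) ρ.coe_nonneg, n]
    constructor <;> intro h <;> linarith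
  unfold circleRadius
  simp only [key]
  by_cases hc : 0 < 2 * inner ℝ (x - z) u
  · rw [← ENNReal.ofReal_div_of_pos hc]
    apply le_antisymm
    · refine iInf₂_le (Real.toNNReal (‖z - x‖ ^ 2 / (2 * inner ℝ (x - z) u))) ?_
      rw [Real.coe_toNNReal _ (by positivity)]
      rw [div_mul_cancel₀ _ hc.ne']
    · refine le_iInf₂ fun ρ h => ?_
      rw [h, mul_div_assoc, div_self hc.ne', mul_one, ENNReal.ofReal_coe_nnreal]
  · rw [ENNReal.ofReal_of_nonpos (not_lt.1 hc),
      ENNReal.div_zero (ENNReal.ofReal_pos.2 hpos).ne']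
    refine iInf₂_eq_top.2 fun ρ h => ?_
    have := mul_nonpos_of_nonneg_of_nonpos ρ.2 (not_lt.1 hc)
    exact absurd h (by change (ρ : ℝ) * _ ≤ 0 at this; linarith)

end ConstantWidth

end

/-!
The support function `h` of a body of constant width `1` satisfies `h u + h (-u) = ‖u‖`, so that in
a direction orthogonal to the unit vector `u` the principal radii of curvature at `u` and at `-u`
add up to `1`. At a typical body the second derivatives of the support function depend continuously,
in `L¹`, on the body, since they are limits of second differences, which are continuous. If at
`-u` a radius were positive while the product of the radii at `u` is positive too, then an
oscillating perturbation of `h` of small amplitude in the `C¹` sense and of non-vanishing amplitude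
in the `C²` sense would be possible, against this continuity. Hence for almost all `u` either the
product of the radii at `u` vanishes or the radii at `-u` vanish. By Sard's theorem, the support
points in the directions of the first kind form a null set in the boundary; so at almost all
boundary points the opposite radii vanish, and the radii themselves are `1`. All radii are `0` at
the points opposite to these, and there are uncountably many of them near every boundary point,
because neighbourhoods in the boundary have positive measure.
-/

noncomputable section

namespace ConstantWidth

variable {V : Type*} [NormedAddCommGroup V] [InnerProductSpace ℝ V]

/-! ### Sublinear functions and convex bodies -/

/-- Positive homogeneity of degree one. -/
def IsPosHomogeneous {E : Type*} [AddCommGroup E] [Module ℝ E] (f : E → ℝ) : Prop :=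
  ∀ c : ℝ, 0 < c → ∀ u, f (c • u) = c * f u

/-- Sublinear functions: positively homogeneous and subadditive. In finite dimension they are
exactly the support functions of convex bodies. -/
structure IsSublinear {E : Type*} [AddCommGroup E] [Module ℝ E] (h : E → ℝ) : Prop where
  smul : IsPosHomogeneous h
  add_le : ∀ u v, h (u + v) ≤ h u + h v

section Module

variable {E : Type*} [AddCommGroup E] [Module ℝ E] {h : E → ℝ}

theorem IsPosHomogeneous.map_zero (hh : IsPosHomogeneous h) : h 0 = 0 := by
  have := hh 2 two_pos 0
  rw [smul_zero] at this
  linarith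

theorem IsPosHomogeneous.smul_of_nonneg (hh : IsPosHomogeneous h) {c : ℝ} (hc : 0 ≤ c) (u : E) :
    h (c • u) = c * h u := by
  rcases hc.eq_or_lt with rfl | hc
  · rw [zero_smul, zero_mul, hh.map_zero]
  · exact hh c hc u

theorem IsSublinear.mul_le_smul (hh : IsSublinear h) (c : ℝ) (u : E) : c * h u ≤ h (c • u) := by
  rcases le_total 0 c with hc | hc
  · exact (hh.smul.smul_of_nonneg hc u).ge
  · have hneg := hh.smul.smul_of_nonneg (neg_nonneg.2 hc) u
    have hadd := hh.add_le (c • u) (-c • u)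
    rw [← add_smul, add_neg_cancel, zero_smul, hh.smul.map_zero, hneg] at hadd
    linarith

theorem IsSublinear.convexOn (hh : IsSublinear h) : ConvexOn ℝ Set.univ h := by
  refine ⟨convex_univ, fun x _ y _ a b ha hb _ => ?_⟩
  simpa [hh.smul.smul_of_nonneg ha, hh.smul.smul_of_nonneg hb] using hh.add_le (a • x) (b • y)

theorem IsSublinear.exists_linearMap_le (hh : IsSublinear h) (u : E) :
    ∃ g : E →ₗ[ℝ] ℝ, g u = h u ∧ ∀ w, g w ≤ h w := by
  have h_zero : ∀ c : ℝ, c • u = 0 → c • h u = 0 := by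
    intro c hc
    rcases smul_eq_zero.1 hc with rfl | rfl
    · exact zero_smul ℝ _
    · rw [hh.smul.map_zero, smul_zero]
  obtain ⟨g, hg_ext, hg_le⟩ := exists_extension_of_le_sublinear
    (LinearPMap.mkSpanSingleton' u (h u) h_zero) h hh.smul hh.add_le (by
      rintro ⟨x, hx⟩
      obtain ⟨c, rfl⟩ := Submodule.mem_span_singleton.1 hx
      rw [LinearPMap.mkSpanSingleton'_apply]
      exact hh.mul_le_smul c u)
  exact ⟨g, (hg_ext ⟨u, Submodule.mem_span_singleton_self u⟩).trans
    (LinearPMap.mkSpanSingleton'_apply_self u (h u) h_zero _), hg_le⟩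

end Module

theorem inner_le_supportFn (K : ConvexBody V) {y : V} (hy : y ∈ (K : Set V)) (u : V) :
    inner ℝ y u ≤ supportFn K u :=
  le_csSup (K.isCompact.image (by fun_prop)).bddAbove ⟨y, hy, rfl⟩

theorem exists_inner_eq_supportFn (K : ConvexBody V) (u : V) :
    ∃ y ∈ (K : Set V), inner ℝ y u = supportFn K u :=
  (K.isCompact.image (f := fun y : V => inner ℝ y u) (by fun_prop)).sSup_mem (K.nonempty.image _)

theorem supportFn_le (K : ConvexBody V) {u : V} {c : ℝ} (h : ∀ y ∈ (K : Set V), inner ℝ y u ≤ c) :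
    supportFn K u ≤ c := by
  obtain ⟨y, hy, e⟩ := exists_inner_eq_supportFn K u
  exact e ▸ h y hy

theorem supportFn_smul (K : ConvexBody V) : IsPosHomogeneous (supportFn K) := by
  intro c hc u
  apply le_antisymm
  · refine supportFn_le K fun y hy => ?_
    rw [inner_smul_right]
    exact mul_le_mul_of_nonneg_left (inner_le_supportFn K hy u) hc.le
  · obtain ⟨y, hy, e⟩ := exists_inner_eq_supportFn K u
    rw [← e, ← inner_smul_right]
    exact inner_le_supportFn K hy _

theorem supportFn_add_le (K : ConvexBody V) (u v : V) :
    supportFn K (u + v) ≤ supportFn K u + supportFn K v := by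
  refine supportFn_le K fun y hy => ?_
  rw [inner_add_right]
  exact add_le_add (inner_le_supportFn K hy u) (inner_le_supportFn K hy v)

theorem isSublinear_supportFn (K : ConvexBody V) : IsSublinear (supportFn K) :=
  ⟨supportFn_smul K, supportFn_add_le K⟩

theorem exists_dist_le_of_inner_le (K : ConvexBody V) {x : V} {r : ℝ} (hr : 0 ≤ r)
    (h : ∀ u, inner ℝ x u ≤ supportFn K u + r * ‖u‖) : ∃ y ∈ (K : Set V), dist x y ≤ r := by
  obtain ⟨y, hy, hmin⟩ := K.isCompact.exists_infDist_eq_dist K.nonempty x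
  have h_proj : ∀ w ∈ (K : Set V), inner ℝ (x - y) (w - y) ≤ 0 := by
    refine (norm_eq_iInf_iff_real_inner_le_zero K.convex hy).1 ?_
    rw [← dist_eq_norm, ← hmin, Metric.infDist_eq_iInf]
    simp only [dist_eq_norm]
  have h_supp : supportFn K (x - y) ≤ inner ℝ y (x - y) := by
    refine supportFn_le K fun w hw => ?_
    have := h_proj w hw
    rw [real_inner_comm, inner_sub_left] at this
    linarith
  have h_sq : ‖x - y‖ ^ 2 ≤ r * ‖x - y‖ := by
    rw [← real_inner_self_eq_norm_sq, inner_sub_left]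
    linarith [h (x - y)]
  refine ⟨y, hy, ?_⟩
  rw [dist_eq_norm]
  nlinarith [norm_nonneg (x - y)]

theorem mem_of_inner_le_supportFn (K : ConvexBody V) {x : V}
    (h : ∀ u, inner ℝ x u ≤ supportFn K u) : x ∈ (K : Set V) := by
  obtain ⟨y, hy, hxy⟩ := exists_dist_le_of_inner_le K le_rfl (x := x) (by simpa using h)
  rwa [dist_le_zero.1 hxy]

theorem supportFn_sub_le (K L : ConvexBody V) (u : V) :
    supportFn K u - supportFn L u ≤ dist K L * ‖u‖ := by
  rw [sub_le_iff_le_add]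
  refine supportFn_le K fun y hy => ?_
  obtain ⟨z, hz, h_near⟩ := L.isCompact.exists_infDist_eq_dist L.nonempty y
  have h_dist : dist y z ≤ dist K L := by
    rw [← h_near, ← ConvexBody.hausdorffDist_coe]
    exact Metric.infDist_le_hausdorffDist_of_mem hy ConvexBody.hausdorffEDist_ne_top
  calc inner ℝ y u = inner ℝ (y - z) u + inner ℝ z u := by rw [← inner_add_left, sub_add_cancel]
    _ ≤ dist K L * ‖u‖ + supportFn L u := by
      gcongr
      · refine (real_inner_le_norm _ _).trans ?_
        rw [← dist_eq_norm]
        gcongr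
      · exact inner_le_supportFn L hz u

theorem abs_supportFn_sub_le (K L : ConvexBody V) (u : V) :
    |supportFn K u - supportFn L u| ≤ dist K L * ‖u‖ :=
  abs_sub_le_iff.2 ⟨supportFn_sub_le K L u, dist_comm K L ▸ supportFn_sub_le L K u⟩

theorem dist_le_of_abs_supportFn_sub_le (K L : ConvexBody V) {r : ℝ} (hr : 0 ≤ r)
    (h : ∀ u, |supportFn K u - supportFn L u| ≤ r * ‖u‖) : dist K L ≤ r := by
  rw [← ConvexBody.hausdorffDist_coe]
  refine Metric.hausdorffDist_le_of_mem_dist hr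
    (fun x hx => exists_dist_le_of_inner_le L hr fun u => ?_)
    (fun x hx => exists_dist_le_of_inner_le K hr fun u => ?_)
  · linarith [inner_le_supportFn K hx u, (abs_le.1 (h u)).2]
  · linarith [inner_le_supportFn L hx u, (abs_le.1 (h u)).1]

theorem convex_setOf_inner_le (h : V → ℝ) : Convex ℝ {x : V | ∀ w, inner ℝ x w ≤ h w} := by
  simp only [Set.ofPred_forall]
  refine convex_iInter fun w => ?_
  exact convex_halfSpace_le (f := fun x : V => inner ℝ x w)
    ⟨fun x y => inner_add_left x y w, fun c x => real_inner_smul_left x w c⟩ (h w)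

section FiniteDimensional

variable [FiniteDimensional ℝ V] {h : V → ℝ}

theorem IsSublinear.continuous (hh : IsSublinear h) : Continuous h :=
  continuousOn_univ.1 (hh.convexOn.continuousOn isOpen_univ)

theorem IsSublinear.exists_inner_le (hh : IsSublinear h) (u : V) :
    ∃ x : V, inner ℝ x u = h u ∧ ∀ w, inner ℝ x w ≤ h w := by
  obtain ⟨g, hg_eq, hg_le⟩ := hh.exists_linearMap_le u
  refine ⟨(InnerProductSpace.toDual ℝ V).symm (LinearMap.toContinuousLinearMap g), ?_, fun w => ?_⟩
  · simpa using hg_eq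
  · simpa using hg_le w

theorem IsSublinear.isCompact_setOf_inner_le (hh : IsSublinear h) :
    IsCompact {x : V | ∀ w, inner ℝ x w ≤ h w} := by
  have h_closed : IsClosed {x : V | ∀ w, inner ℝ x w ≤ h w} := by
    simp only [Set.ofPred_forall]
    exact isClosed_iInter fun w => isClosed_le (by fun_prop) continuous_const
  obtain ⟨R, hR⟩ := ((isCompact_sphere (0 : V) 1).image hh.continuous).bddAbove
  refine Metric.isCompact_of_isClosed_isBounded h_closed
    ((Metric.isBounded_closedBall (x := (0 : V)) (r := max R 0)).subset fun x hx => ?_)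
  rw [mem_closedBall_zero_iff]
  rcases eq_or_ne x 0 with rfl | hx0
  · simp
  · have h_unit : ‖‖x‖⁻¹ • x‖ = 1 := norm_smul_inv_norm hx0
    have h_norm : inner ℝ x (‖x‖⁻¹ • x) = ‖x‖ := by
      have : ‖x‖ ≠ 0 := norm_ne_zero_iff.2 hx0
      rw [inner_smul_right, real_inner_self_eq_norm_sq]
      field_simp
    have h_le : h (‖x‖⁻¹ • x) ≤ R := hR ⟨_, by simpa using h_unit, rfl⟩
    exact le_max_of_le_left (h_norm.symm.trans_le ((hx _).trans h_le))

theorem IsSublinear.exists_supportFn_eq (hh : IsSublinear h) :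
    ∃ K : ConvexBody V, supportFn K = h := by
  obtain ⟨x₀, -, hx₀⟩ := hh.exists_inner_le 0
  let K : ConvexBody V :=
    ⟨{x | ∀ w, inner ℝ x w ≤ h w}, convex_setOf_inner_le h, hh.isCompact_setOf_inner_le, x₀, hx₀⟩
  refine ⟨K, funext fun u => le_antisymm (supportFn_le K fun y hy => hy u) ?_⟩
  obtain ⟨x, hx_eq, hx_le⟩ := hh.exists_inner_le u
  exact hx_eq ▸ inner_le_supportFn K hx_le u

theorem IsSublinear.exists_constantWidthOne (hh : IsSublinear h)
    (h_neg : ∀ u, h u + h (-u) = ‖u‖) : ∃ K : ConstantWidthOne V, supportFn K.1 = h := by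
  obtain ⟨K, hK⟩ := hh.exists_supportFn_eq
  exact ⟨⟨K, fun u hu => by rw [hK, h_neg, hu]⟩, hK⟩

end FiniteDimensional

/-! ### Support points of bodies of constant width -/

/-- A point of `K` in which the linear functional `⟪·, u⟫` attains its maximum. It is chosen
arbitrarily in general; for a body of constant width and `u ≠ 0` it is unique. -/
def supportPt (K : ConvexBody V) (u : V) : V := (exists_inner_eq_supportFn K u).choose

theorem supportPt_mem (K : ConvexBody V) (u : V) : supportPt K u ∈ (K : Set V) :=
  (exists_inner_eq_supportFn K u).choose_spec.1

theorem inner_supportPt (K : ConvexBody V) (u : V) : inner ℝ (supportPt K u) u = supportFn K u :=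
  (exists_inner_eq_supportFn K u).choose_spec.2

theorem inner_supportPt_sub_nonneg (K : ConvexBody V) (u : V) {z : V} (hz : z ∈ (K : Set V)) :
    0 ≤ inner ℝ (supportPt K u - z) u := by
  rw [inner_sub_left, inner_supportPt]
  linarith [inner_le_supportFn K hz u]

theorem ne_zero_of_norm_eq_one {E : Type*} [NormedAddCommGroup E] {u : E} (hu : ‖u‖ = 1) : u ≠ 0 :=
  norm_ne_zero_iff.1 (hu.trans_ne one_ne_zero)

theorem norm_normalize_sub_le {E : Type*} [NormedAddCommGroup E] [NormedSpace ℝ E] {u w : E}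
    (hu : u ≠ 0) (hw : w ≠ 0) : ‖‖u‖⁻¹ • u - ‖w‖⁻¹ • w‖ ≤ 2 * ‖u‖⁻¹ * ‖u - w‖ := by
  have hu_pos : 0 < ‖u‖ := norm_pos_iff.2 hu
  have hw_pos : 0 < ‖w‖ := norm_pos_iff.2 hw
  have h_split : ‖u‖⁻¹ • u - ‖w‖⁻¹ • w = ‖u‖⁻¹ • (u - w) + (‖u‖⁻¹ - ‖w‖⁻¹) • w := by module
  have h_radial : ‖(‖u‖⁻¹ - ‖w‖⁻¹) • w‖ = ‖u‖⁻¹ * |‖w‖ - ‖u‖| := by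
    rw [norm_smul, Real.norm_eq_abs, inv_sub_inv hu_pos.ne' hw_pos.ne', abs_div,
      abs_of_pos (mul_pos hu_pos hw_pos)]
    field_simp
  calc ‖‖u‖⁻¹ • u - ‖w‖⁻¹ • w‖ ≤ ‖‖u‖⁻¹ • (u - w)‖ + ‖(‖u‖⁻¹ - ‖w‖⁻¹) • w‖ :=
        h_split ▸ norm_add_le _ _
    _ = ‖u‖⁻¹ * ‖u - w‖ + ‖u‖⁻¹ * |‖w‖ - ‖u‖| := by
      rw [h_radial, norm_smul, norm_inv, norm_norm]
    _ ≤ ‖u‖⁻¹ * ‖u - w‖ + ‖u‖⁻¹ * ‖u - w‖ := by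
      gcongr
      exact norm_sub_rev u w ▸ abs_norm_sub_norm_le w u
    _ = 2 * ‖u‖⁻¹ * ‖u - w‖ := by ring

namespace HasConstantWidth

variable {K : ConvexBody V} {d : ℝ}

theorem supportFn_add_neg (hK : HasConstantWidth K d) (u : V) :
    supportFn K u + supportFn K (-u) = d * ‖u‖ := by
  rcases eq_or_ne u 0 with rfl | hu
  · simp [(supportFn_smul K).map_zero]
  · have : 0 < ‖u‖ := norm_pos_iff.2 hu
    have h_unit := hK (‖u‖⁻¹ • u) (norm_smul_inv_norm hu)
    rw [← smul_neg, supportFn_smul K _ (by positivity), supportFn_smul K _ (by positivity)]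
      at h_unit
    field_simp at h_unit
    linarith

theorem nonneg (hK : HasConstantWidth K d) {u : V} (hu : u ≠ 0) : 0 ≤ d := by
  have h_add := supportFn_add_le K u (-u)
  rw [add_neg_cancel, (supportFn_smul K).map_zero, hK.supportFn_add_neg] at h_add
  exact nonneg_of_mul_nonneg_left h_add (norm_pos_iff.2 hu)

theorem norm_sub_le (hK : HasConstantWidth K d) (hd : 0 ≤ d) {a b : V} (ha : a ∈ (K : Set V))
    (hb : b ∈ (K : Set V)) : ‖a - b‖ ≤ d := by
  have h_sq : ‖a - b‖ ^ 2 ≤ d * ‖a - b‖ := by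
    calc ‖a - b‖ ^ 2 = inner ℝ a (a - b) + inner ℝ b (-(a - b)) := by
          rw [← real_inner_self_eq_norm_sq, inner_sub_left, inner_neg_right, sub_eq_add_neg]
      _ ≤ d * ‖a - b‖ :=
        hK.supportFn_add_neg (a - b) ▸
          add_le_add (inner_le_supportFn K ha _) (inner_le_supportFn K hb _)
  nlinarith [norm_nonneg (a - b)]

theorem eq_supportPt_neg_add (hK : HasConstantWidth K d) {u y : V} (hu : u ≠ 0)
    (hy : y ∈ (K : Set V)) (h_max : inner ℝ y u = supportFn K u) :
    y = supportPt K (-u) + (d * ‖u‖⁻¹) • u := by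
  have hu_norm : ‖u‖ ≠ 0 := norm_ne_zero_iff.2 hu
  have h_diam : ‖y - supportPt K (-u)‖ ≤ d :=
    hK.norm_sub_le (hK.nonneg hu) hy (supportPt_mem K (-u))
  have h_inner : inner ℝ (y - supportPt K (-u)) u = d * ‖u‖ := by
    rw [inner_sub_left, h_max, ← hK.supportFn_add_neg u, ← inner_supportPt K (-u),
      inner_neg_right, sub_eq_add_neg]
  have h_dist : ‖(y - supportPt K (-u)) - (d * ‖u‖⁻¹) • u‖ ^ 2 ≤ 0 := by
    have h_norm : ‖(d * ‖u‖⁻¹) • u‖ ^ 2 = d ^ 2 := by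
      rw [norm_smul, norm_mul, norm_inv, norm_norm, inv_mul_cancel_right₀ hu_norm, Real.norm_eq_abs,
        sq_abs]
    have h_mul : d * ‖u‖⁻¹ * (d * ‖u‖) = d ^ 2 := by field_simp
    rw [norm_sub_sq_real, inner_smul_right, h_inner, h_norm, h_mul]
    nlinarith [norm_nonneg (y - supportPt K (-u))]
  rw [← sub_eq_zero, ← sub_sub, ← norm_eq_zero]
  exact pow_eq_zero_iff two_ne_zero |>.1 (h_dist.antisymm (sq_nonneg _))

theorem supportPt_eq_neg_add (hK : HasConstantWidth K d) {u : V} (hu : u ≠ 0) :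
    supportPt K u = supportPt K (-u) + (d * ‖u‖⁻¹) • u :=
  hK.eq_supportPt_neg_add hu (supportPt_mem _ _) (inner_supportPt _ _)

theorem supportPt_eq_neg_add_of_norm_eq_one (hK : HasConstantWidth K d) {u : V} (hu : ‖u‖ = 1) :
    supportPt K u = supportPt K (-u) + d • u := by
  simpa [hu] using hK.supportPt_eq_neg_add (ne_zero_of_norm_eq_one hu)

theorem eq_supportPt (hK : HasConstantWidth K d) {u y : V} (hu : u ≠ 0)
    (hy : y ∈ (K : Set V)) (h_max : inner ℝ y u = supportFn K u) : y = supportPt K u :=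
  (hK.eq_supportPt_neg_add hu hy h_max).trans (hK.supportPt_eq_neg_add hu).symm

theorem supportPt_smul (hK : HasConstantWidth K d) {u : V} (hu : u ≠ 0) {c : ℝ} (hc : 0 < c) :
    supportPt K (c • u) = supportPt K u := by
  refine hK.eq_supportPt hu (supportPt_mem _ _) (mul_left_cancel₀ hc.ne' ?_)
  rw [← inner_smul_right, inner_supportPt, supportFn_smul K c hc]

theorem inner_supportPt_sub_le (hK : HasConstantWidth K d) {u w : V} (hu : ‖u‖ = 1)
    (hw : ‖w‖ = 1) :
    inner ℝ (supportPt K u - supportPt K w) u ≤ d * (‖u - w‖ ^ 2 / 2) := by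
  have h_opp := inner_supportPt_sub_nonneg K (-u) (supportPt_mem K (-w))
  have h_split : supportPt K u - supportPt K w
      = (supportPt K (-u) - supportPt K (-w)) + d • (u - w) := by
    rw [hK.supportPt_eq_neg_add_of_norm_eq_one hu, hK.supportPt_eq_neg_add_of_norm_eq_one hw]
    module
  have h_chord : inner ℝ (u - w) u = ‖u - w‖ ^ 2 / 2 := by
    rw [norm_sub_sq_real, hu, hw, inner_sub_left, real_inner_self_eq_norm_sq, hu,
      real_inner_comm w u]
    ring
  rw [inner_neg_right] at h_opp
  rw [h_split, inner_add_left, real_inner_smul_left, h_chord]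
  linarith

theorem norm_supportPt_sub_le (hK : HasConstantWidth K d) {u w : V} (hu : ‖u‖ = 1)
    (hw : ‖w‖ = 1) : ‖supportPt K u - supportPt K w‖ ≤ d * ‖u - w‖ := by
  have hd : 0 ≤ d := hK.nonneg (ne_zero_of_norm_eq_one hu)
  have h_diam := hK.norm_sub_le hd (supportPt_mem K u) (supportPt_mem K (-w))
  have h_split : supportPt K u - supportPt K (-w) = (supportPt K u - supportPt K w) + d • w := by
    rw [hK.supportPt_eq_neg_add_of_norm_eq_one hw]
    module
  have h_sq : ‖(supportPt K u - supportPt K w) + d • w‖ ^ 2 ≤ d ^ 2 := by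
    rw [← h_split]
    gcongr
  rw [norm_add_sq_real, norm_smul, hw, mul_one, Real.norm_eq_abs, sq_abs, inner_smul_right] at h_sq
  have h_inner := hK.inner_supportPt_sub_le hw hu
  rw [← neg_sub, inner_neg_left, norm_sub_rev] at h_inner
  refine le_of_sq_le_sq ?_ (by positivity)
  nlinarith

theorem norm_supportPt_sub_le_of_ne_zero (hK : HasConstantWidth K d) {u w : V} (hu : u ≠ 0)
    (hw : w ≠ 0) : ‖supportPt K u - supportPt K w‖ ≤ d * (2 * ‖u‖⁻¹ * ‖u - w‖) := by
  have hd : 0 ≤ d := hK.nonneg hu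
  rw [← hK.supportPt_smul hu (inv_pos.2 (norm_pos_iff.2 hu)),
    ← hK.supportPt_smul hw (inv_pos.2 (norm_pos_iff.2 hw))]
  refine (hK.norm_supportPt_sub_le (norm_smul_inv_norm hu) (norm_smul_inv_norm hw)).trans ?_
  gcongr
  exact norm_normalize_sub_le hu hw

theorem lipschitzOnWith_supportPt (hK : HasConstantWidth K d) {r : ℝ} (hr : 0 < r) :
    LipschitzOnWith (d * (2 * r⁻¹)).toNNReal (supportPt K) {u | r < ‖u‖} := by
  refine LipschitzOnWith.of_dist_le_mul fun u hu w hw => ?_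
  rw [Set.mem_ofPred_eq] at hu hw
  have hu0 : u ≠ 0 := norm_pos_iff.1 (hr.trans hu)
  have hd : 0 ≤ d := hK.nonneg hu0
  rw [dist_eq_norm, dist_eq_norm, Real.coe_toNNReal _ (by positivity), mul_assoc]
  refine (hK.norm_supportPt_sub_le_of_ne_zero hu0 (norm_pos_iff.1 (hr.trans hw))).trans ?_
  gcongr

theorem continuousAt_supportPt (hK : HasConstantWidth K d) {u : V} (hu : u ≠ 0) :
    ContinuousAt (supportPt K) u := by
  have hu_pos : 0 < ‖u‖ := norm_pos_iff.2 hu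
  exact (hK.lipschitzOnWith_supportPt (half_pos hu_pos)).continuousOn.continuousAt
    ((isOpen_lt continuous_const continuous_norm).mem_nhds (half_lt_self hu_pos))

theorem hasFDerivAt_supportFn (hK : HasConstantWidth K d) {u : V} (hu : u ≠ 0) :
    HasFDerivAt (supportFn K) (innerSL ℝ (supportPt K u)) u := by
  have : 0 ≤ d := hK.nonneg hu
  rw [hasFDerivAt_iff_isLittleO]
  have h_bound : ∀ᶠ w in 𝓝 u, ‖supportFn K w - supportFn K u
      - innerSL ℝ (supportPt K u) (w - u)‖ ≤ d * (2 * ‖u‖⁻¹) * ‖‖w - u‖ ^ 2‖ := by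
    filter_upwards [isOpen_ne.mem_nhds hu] with w hw
    have h_remainder : supportFn K w - supportFn K u - innerSL ℝ (supportPt K u) (w - u)
        = inner ℝ (supportPt K w - supportPt K u) w := by
      rw [innerSL_apply_apply, inner_sub_right, inner_sub_left, inner_supportPt, inner_supportPt]
      ring
    have h_cauchy : inner ℝ (supportPt K w - supportPt K u) (w - u)
        ≤ d * (2 * ‖u‖⁻¹) * ‖w - u‖ ^ 2 :=
      calc _ ≤ ‖supportPt K w - supportPt K u‖ * ‖w - u‖ := real_inner_le_norm _ _
        _ ≤ d * (2 * ‖u‖⁻¹ * ‖w - u‖) * ‖w - u‖ := by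
          gcongr
          rw [norm_sub_rev, norm_sub_rev w]
          exact hK.norm_supportPt_sub_le_of_ne_zero hu hw
        _ = _ := by ring
    have h_nonneg := inner_supportPt_sub_nonneg K w (supportPt_mem K u)
    have h_opp := inner_supportPt_sub_nonneg K u (supportPt_mem K w)
    rw [h_remainder, Real.norm_of_nonneg h_nonneg, Real.norm_of_nonneg (by positivity)]
    rw [inner_sub_right] at h_cauchy
    rw [← neg_sub, inner_neg_left] at h_opp
    linarith
  exact (Asymptotics.IsBigO.of_bound _ h_bound).trans_isLittleO
    (Asymptotics.isLittleO_pow_sub_sub u one_lt_two)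

theorem fderiv_supportFn (hK : HasConstantWidth K d) {u : V} (hu : u ≠ 0) :
    fderiv ℝ (supportFn K) u = innerSL ℝ (supportPt K u) :=
  (hK.hasFDerivAt_supportFn hu).fderiv

end HasConstantWidth

/-! ### Boundary points and radii of curvature -/

/-- All boundary points of `K` are smooth: they have only one outer unit normal vector. -/
def IsSmooth (K : ConvexBody V) : Prop :=
  ∀ ⦃x u v : V⦄, IsOuterUnitNormal (K : Set V) x u → IsOuterUnitNormal (K : Set V) x v → u = v

/-- The support point of `K` in the direction opposite to `w` has, as a function of `w`, vanishing
derivative at `u`. For a body of constant width this derivative is the Hessian of the support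
function at `-u`, up to its sign. -/
def IsStationary (K : ConvexBody V) (u : V) : Prop :=
  HasFDerivAt (fun w => supportPt K (-w)) (0 : V →L[ℝ] V) u

theorem isOuterUnitNormal_iff (K : ConvexBody V) {x u : V} : IsOuterUnitNormal (K : Set V) x u ↔
    x ∈ (K : Set V) ∧ ‖u‖ = 1 ∧ inner ℝ x u = supportFn K u := by
  refine and_congr_right fun hx => and_congr_right fun _ => ⟨fun h => ?_, fun h y hy => ?_⟩
  · refine (inner_le_supportFn K hx u).antisymm (supportFn_le K fun y hy => ?_)
    simpa [inner_sub_left] using h y hy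
  · rw [inner_sub_left, h, sub_nonpos]
    exact inner_le_supportFn K hy u

theorem isOuterUnitNormal_supportPt (K : ConvexBody V) {u : V} (hu : ‖u‖ = 1) :
    IsOuterUnitNormal (K : Set V) (supportPt K u) u :=
  (isOuterUnitNormal_iff K).2 ⟨supportPt_mem K u, hu, inner_supportPt K u⟩

theorem supportPt_mem_frontier (K : ConvexBody V) {u : V} (hu : ‖u‖ = 1) :
    supportPt K u ∈ frontier (K : Set V) := by
  rw [frontier, K.isClosed.closure_eq]
  refine ⟨supportPt_mem _ _, fun h_int => ?_⟩
  obtain ⟨r, hr, h_ball⟩ := Metric.mem_nhds_iff.1 (mem_interior_iff_mem_nhds.1 h_int)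
  have h_mem : supportPt K u + (r / 2) • u ∈ (K : Set V) := by
    apply h_ball
    rw [Metric.mem_ball, dist_eq_norm, add_sub_cancel_left, norm_smul, hu,
      Real.norm_of_nonneg (by positivity)]
    linarith
  have h_inner := inner_supportPt_sub_nonneg K u h_mem
  rw [sub_add_cancel_left, inner_neg_left, real_inner_smul_left, real_inner_self_eq_norm_sq,
    hu] at h_inner
  linarith

theorem mem_interior_of_inner_lt [FiniteDimensional ℝ V] (K : ConvexBody V) {x : V}
    (h : ∀ u, ‖u‖ = 1 → inner ℝ x u < supportFn K u) : x ∈ interior (K : Set V) := by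
  obtain ⟨m, hm, h_gap⟩ : ∃ m : ℝ, 0 < m ∧
      ∀ u ∈ Metric.sphere (0 : V) 1, m ≤ supportFn K u - inner ℝ x u := by
    refine (isCompact_sphere (0 : V) 1).exists_forall_le' ?_ fun u hu => ?_
    · exact ((isSublinear_supportFn K).continuous.sub (by fun_prop)).continuousOn
    · exact sub_pos.2 (h u (mem_sphere_zero_iff_norm.1 hu))
  refine mem_interior_iff_mem_nhds.2 (mem_of_superset (Metric.ball_mem_nhds x hm) fun z hz => ?_)
  refine mem_of_inner_le_supportFn K fun u => ?_
  rcases eq_or_ne u 0 with rfl | hu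
  · rw [inner_zero_right, (supportFn_smul K).map_zero]
  · have h_unit : ‖‖u‖⁻¹ • u‖ = 1 := norm_smul_inv_norm hu
    have h_dist : inner ℝ (z - x) (‖u‖⁻¹ • u) ≤ m := by
      refine (real_inner_le_norm _ _).trans ?_
      rw [h_unit, mul_one, ← dist_eq_norm]
      exact (Metric.mem_ball.1 hz).le
    have h_inv : 0 < ‖u‖⁻¹ := inv_pos.2 (norm_pos_iff.2 hu)
    have h_gap_u := h_gap _ (mem_sphere_zero_iff_norm.2 h_unit)
    rw [inner_sub_left] at h_dist
    rw [supportFn_smul K _ h_inv] at h_gap_u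
    refine le_of_mul_le_mul_left ?_ h_inv
    rw [← inner_smul_right]
    linarith

namespace HasConstantWidth

variable {K : ConvexBody V} {d : ℝ}

theorem exists_eq_supportPt_of_mem_frontier [FiniteDimensional ℝ V] (hK : HasConstantWidth K d)
    {x : V} (hx : x ∈ frontier (K : Set V)) : ∃ u, ‖u‖ = 1 ∧ x = supportPt K u := by
  by_contra! h_ne
  have hxK : x ∈ (K : Set V) := K.isClosed.frontier_subset hx
  refine hx.2 (mem_interior_of_inner_lt K fun u hu => ?_)
  exact lt_of_le_of_ne (inner_le_supportFn K hxK u) fun h_eq =>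
    h_ne u hu (hK.eq_supportPt (ne_zero_of_norm_eq_one hu) hxK h_eq)

theorem supportPt_sub_half_mem_interior [FiniteDimensional ℝ V] (hK : HasConstantWidth K d)
    (hd : d ≠ 0) {u : V} (hu : ‖u‖ = 1) :
    supportPt K u - (d / 2) • u ∈ interior (K : Set V) := by
  refine mem_interior_of_inner_lt K fun w hw => ?_
  have h_opp := hK.supportPt_eq_neg_add_of_norm_eq_one hu
  have h_le := inner_le_supportFn K (supportPt_mem K u) w
  have h_le_opp := inner_le_supportFn K (supportPt_mem K (-u)) w
  have h_mid : inner ℝ (supportPt K u - (d / 2) • u) w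
      = (inner ℝ (supportPt K u) w + inner ℝ (supportPt K (-u)) w) / 2 := by
    rw [h_opp, inner_sub_left, inner_add_left, real_inner_smul_left, real_inner_smul_left]
    ring
  rw [h_mid]
  by_contra! h_ge
  have hw0 := ne_zero_of_norm_eq_one hw
  have h_eq := hK.eq_supportPt hw0 (supportPt_mem K u) (by linarith)
  have h_eq_opp := hK.eq_supportPt hw0 (supportPt_mem K (-u)) (by linarith)
  rw [h_eq, h_eq_opp] at h_opp
  exact smul_ne_zero hd (ne_zero_of_norm_eq_one hu) (left_eq_add.1 h_opp)

end HasConstantWidth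

section NormalLines

variable {S : Set V} {x u t : V} {c : ℝ}

theorem IsOuterUnitNormal.nonpos_of_mem (hxu : IsOuterUnitNormal S x u) {v : V}
    (hv : inner ℝ v u = 0) {l : ℝ} (hl : x + v + l • u ∈ S) : l ≤ 0 := by
  have h_inner := hxu.2.2 _ hl
  rw [add_assoc, add_sub_cancel_left, inner_add_left, hv, real_inner_smul_left,
    real_inner_self_eq_norm_sq, hxu.2.1] at h_inner
  linarith

theorem eventually_exists_isGreatest_normal_line (hS : Convex ℝ S) (hS_closed : IsClosed S)
    (hxu : IsOuterUnitNormal S x u) (hc : 0 < c) (h_int : x - c • u ∈ interior S) {ε : ℝ}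
    (hε : 0 < ε) : ∀ᶠ v in 𝓝 (0 : V), inner ℝ v u = 0 →
      ∃ l, IsGreatest {l : ℝ | x + v + l • u ∈ S} l ∧ ‖v + l • u‖ < ε := by
  obtain ⟨s, hs, h_int_s⟩ : ∃ s : ℝ, s ≤ ε / 2 ∧ x - s • u ∈ interior S := by
    set r := min 1 (ε / 2 / c)
    refine ⟨r * c, (le_div_iff₀ hc).1 (min_le_right _ _), ?_⟩
    convert hS.add_smul_sub_mem_interior hxu.1 h_int (t := r) ⟨by positivity, min_le_left _ _⟩
      using 1
    module
  have h_near : ∀ᶠ v in 𝓝 (0 : V), x - s • u + v ∈ S :=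
    (continuous_const.add continuous_id).tendsto' 0 (x - s • u) (add_zero _)
      |>.eventually (mem_interior_iff_mem_nhds.1 h_int_s)
  filter_upwards [h_near, Metric.ball_mem_nhds (0 : V) (half_pos hε)] with v hv hv_ball hv_orth
  set L := {l : ℝ | x + v + l • u ∈ S}
  have h_mem : -s ∈ L := by
    change x + v + (-s) • u ∈ S
    convert hv using 1
    module
  have h_bdd : BddAbove L := ⟨0, fun l hl => hxu.nonpos_of_mem hv_orth hl⟩
  have h_closed : IsClosed L := hS_closed.preimage (by fun_prop)
  have h_top := h_closed.isGreatest_csSup ⟨-s, h_mem⟩ h_bdd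
  refine ⟨sSup L, h_top, (norm_add_le _ _).trans_lt ?_⟩
  have h_abs : |sSup L| ≤ ε / 2 :=
    abs_le.2 ⟨by linarith [h_top.2 h_mem], by linarith [hxu.nonpos_of_mem hv_orth h_top.1]⟩
  rw [norm_smul, hxu.2.1, mul_one, Real.norm_eq_abs]
  linarith [mem_ball_zero_iff.1 hv_ball]

theorem mem_intrinsicFrontier_of_isGreatest {z : V} (hu : u ∈ (affineSpan ℝ S).direction)
    (hz : IsGreatest {l : ℝ | z + l • u ∈ S} 0) : z ∈ intrinsicFrontier ℝ S := by
  have hzS : z ∈ S := by simpa using hz.1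
  rw [← intrinsicClosure_sdiff_intrinsicInterior]
  refine ⟨subset_intrinsicClosure hzS, fun h_int => ?_⟩
  obtain ⟨y, hy, rfl⟩ := mem_intrinsicInterior.1 h_int
  let line : ℝ → affineSpan ℝ S := fun l =>
    ⟨l • u +ᵥ (y : V), AffineSubspace.vadd_mem_of_mem_direction (Submodule.smul_mem _ l hu) y.2⟩
  have h_cont : Continuous line := by fun_prop
  have h_near : ∀ᶠ l in 𝓝[>] (0 : ℝ), line l ∈ interior (Subtype.val ⁻¹' S) :=
    nhdsWithin_le_nhds <| h_cont.continuousAt.preimage_mem_nhds <|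
      isOpen_interior.mem_nhds (by simpa [line] using hy)
  obtain ⟨l, h_mem, hl⟩ := (h_near.and self_mem_nhdsWithin).exists
  refine (hz.2 ?_).not_gt hl
  change (y : V) + l • u ∈ S
  rw [add_comm]
  exact (interior_subset h_mem : line l ∈ Subtype.val ⁻¹' S)

theorem intrinsicFrontier_planeSection_subset (hS : IsClosed S) (x u t : V) :
    intrinsicFrontier ℝ (planeSection S x u t) ⊆ frontier S := by
  have h_closed : IsClosed (planeSection S x u t) := by
    have : FiniteDimensional ℝ (AffineSubspace.mk' x (Submodule.span ℝ {u, t})).direction := by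
      rw [AffineSubspace.direction_mk']
      exact FiniteDimensional.span_of_finite ℝ (Set.toFinite _)
    exact hS.inter (AffineSubspace.closed_of_finiteDimensional _)
  intro z hz
  have hz_mem : z ∈ planeSection S x u t :=
    h_closed.closure_eq ▸
      intrinsicClosure_subset_closure (intrinsicFrontier_subset_intrinsicClosure hz)
  rw [frontier, hS.closure_eq]
  refine ⟨hz_mem.1, fun h_int => ?_⟩
  have h_span : affineSpan ℝ (planeSection S x u t) ≤
      AffineSubspace.mk' x (Submodule.span ℝ {u, t}) :=
    affineSpan_le.2 Set.inter_subset_right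
  have h_intrinsic : z ∈ intrinsicInterior ℝ (planeSection S x u t) := by
    refine mem_intrinsicInterior.2 ⟨⟨z, subset_affineSpan ℝ _ hz_mem⟩, ?_, rfl⟩
    rw [mem_interior_iff_mem_nhds]
    filter_upwards [continuous_subtype_val.continuousAt.preimage_mem_nhds
      (isOpen_interior.mem_nhds h_int)] with p hp
    exact ⟨interior_subset hp, h_span p.2⟩
  rw [← intrinsicClosure_sdiff_intrinsicFrontier] at h_intrinsic
  exact h_intrinsic.2 hz

theorem add_smul_add_smul_mem_plane (x u t : V) (a b : ℝ) :
    x + a • t + b • u ∈ (AffineSubspace.mk' x (Submodule.span ℝ {u, t}) : Set V) := by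
  rw [SetLike.mem_coe, AffineSubspace.mem_mk', vsub_eq_sub]
  exact Submodule.mem_span_pair.2 ⟨b, a, by module⟩

theorem neBot_boundaryFilter (hS : Convex ℝ S) (hS_closed : IsClosed S)
    (hxu : IsOuterUnitNormal S x u) (hc : 0 < c) (h_int : x - c • u ∈ interior S)
    (htu : inner ℝ t u = 0) : (boundaryFilter (planeSection S x u t) x u t).NeBot := by
  rw [boundaryFilter, ← mem_closure_iff_nhdsWithin_neBot, Metric.mem_closure_iff]
  intro ε hε
  have h_tendsto : Tendsto (fun m : ℝ => m • t) (𝓝[>] 0) (𝓝 0) :=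
    ((continuous_id.smul continuous_const).tendsto' 0 0 (zero_smul ℝ t)).mono_left
      nhdsWithin_le_nhds
  obtain ⟨m, h_top, hm⟩ := ((h_tendsto.eventually (eventually_exists_isGreatest_normal_line hS
    hS_closed hxu hc h_int hε)).and self_mem_nhdsWithin).exists
  obtain ⟨l, h_greatest, h_norm⟩ := h_top (by rw [real_inner_smul_left, htu, mul_zero])
  have hu_dir : u ∈ (affineSpan ℝ (planeSection S x u t)).direction := by
    have hx_mem : x ∈ planeSection S x u t :=
      ⟨hxu.1, AffineSubspace.self_mem_mk' _ _⟩
    have hc_mem : x - c • u ∈ planeSection S x u t :=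
      ⟨interior_subset h_int, by
        simpa [sub_eq_add_neg] using add_smul_add_smul_mem_plane x u t 0 (-c)⟩
    have h_dir := AffineSubspace.vsub_mem_direction (subset_affineSpan ℝ _ hx_mem)
      (subset_affineSpan ℝ _ hc_mem)
    rw [vsub_eq_sub, sub_sub_cancel] at h_dir
    exact (Submodule.smul_mem_iff _ hc.ne').1 h_dir
  refine ⟨x + m • t + l • u, ⟨⟨l, m, hm, by abel⟩, ?_⟩, ?_⟩
  · refine mem_intrinsicFrontier_of_isGreatest hu_dir ⟨?_, fun a ha => ?_⟩
    · rw [Set.mem_ofPred_eq, zero_smul, add_zero]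
      exact ⟨h_greatest.1, add_smul_add_smul_mem_plane x u t m l⟩
    · have h_mem : x + m • t + (l + a) • u ∈ S := by
        rw [add_smul, ← add_assoc]
        exact ha.1
      linarith [h_greatest.2 h_mem]
  · rwa [dist_eq_norm, add_assoc, sub_add_cancel_left, norm_neg]

theorem boundaryFilter_planeSection_le (hS : IsClosed S) (ht : ‖t‖ = 1) (htu : inner ℝ t u = 0) :
    boundaryFilter (planeSection S x u t) x u t ≤ 𝓝[frontier S \ {x}] x := by
  refine nhdsWithin_mono _ ?_
  rintro z ⟨⟨l, m, hm, rfl⟩, hz⟩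
  refine ⟨intrinsicFrontier_planeSection_subset hS _ _ _ hz, fun h_eq => hm.ne' ?_⟩
  have h_zero : l • u + m • t = 0 := by
    rw [Set.mem_singleton_iff, add_assoc] at h_eq
    exact add_eq_left.1 h_eq
  simpa [inner_add_right, inner_smul_right, htu, ht] using congrArg (inner ℝ t) h_zero

end NormalLines

section CircleRadius

variable {x u z : V} {c : ℝ}

theorem ofReal_le_circleRadius (hu : ‖u‖ = 1) (hz : z ≠ x) (hc : 0 ≤ c)
    (h : c * (2 * inner ℝ (x - z) u) ≤ ‖z - x‖ ^ 2) : ENNReal.ofReal c ≤ circleRadius x u z := by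
  have h_pos : 0 < ‖z - x‖ := norm_pos_iff.2 (sub_ne_zero.2 hz)
  rw [circleRadius_eq hu hz, ENNReal.le_div_iff_mul_le
    (Or.inr (ENNReal.ofReal_pos.2 (by positivity)).ne') (Or.inr ENNReal.ofReal_ne_top),
    ← ENNReal.ofReal_mul hc]
  exact ENNReal.ofReal_le_ofReal h

theorem circleRadius_le_ofReal (hu : ‖u‖ = 1) (hz : z ≠ x) (hc : 0 ≤ c)
    (h : ‖z - x‖ ^ 2 ≤ c * (2 * inner ℝ (x - z) u)) : circleRadius x u z ≤ ENNReal.ofReal c := by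
  rw [circleRadius_eq hu hz]
  refine ENNReal.div_le_of_le_mul ?_
  rw [← ENNReal.ofReal_mul hc]
  exact ENNReal.ofReal_le_ofReal h

end CircleRadius

section ConstantWidth

variable {K : ConvexBody V} {d : ℝ} {u : V}

theorem HasConstantWidth.circleRadius_le (hK : HasConstantWidth K d) (hu : ‖u‖ = 1) {z : V}
    (hz : z ∈ (K : Set V)) (hz_ne : z ≠ supportPt K u) :
    circleRadius (supportPt K u) u z ≤ ENNReal.ofReal d := by
  have hd : 0 ≤ d := hK.nonneg (ne_zero_of_norm_eq_one hu)
  have h_diam : ‖(z - supportPt K u) + d • u‖ ^ 2 ≤ d ^ 2 := by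
    have h_eq : (z - supportPt K u) + d • u = z - supportPt K (-u) := by
      rw [hK.supportPt_eq_neg_add_of_norm_eq_one hu]
      module
    rw [h_eq]
    gcongr
    exact hK.norm_sub_le hd hz (supportPt_mem K (-u))
  refine circleRadius_le_ofReal hu hz_ne hd ?_
  rw [norm_add_sq_real, norm_smul, hu, mul_one, Real.norm_eq_abs, sq_abs, inner_smul_right]
    at h_diam
  rw [← neg_sub z, inner_neg_left]
  linarith

theorem HasConstantWidth.le_circleRadius (hK : HasConstantWidth K d) (hu : ‖u‖ = 1) {w : V}
    (hw : ‖w‖ = 1) (h_ne : supportPt K w ≠ supportPt K u) {c : ℝ} (hc : 0 ≤ c) (hcd : c ≤ d)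
    (h_err : ‖supportPt K (-w) - supportPt K (-u)‖ ≤ (d - c) / 2 * ‖w - u‖) :
    ENNReal.ofReal c ≤ circleRadius (supportPt K u) u (supportPt K w) := by
  refine ofReal_le_circleRadius hu h_ne hc ?_
  have h_lower : (d + c) / 2 * ‖w - u‖ ≤ ‖supportPt K w - supportPt K u‖ := by
    have h_eq : supportPt K w - supportPt K u
        = d • (w - u) + (supportPt K (-w) - supportPt K (-u)) := by
      rw [hK.supportPt_eq_neg_add_of_norm_eq_one hu, hK.supportPt_eq_neg_add_of_norm_eq_one hw]
      module
    have h_norm : ‖d • (w - u)‖ = d * ‖w - u‖ := by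
      rw [norm_smul, Real.norm_of_nonneg (hc.trans hcd)]
    have h_tri := norm_sub_le_norm_add (d • (w - u)) (supportPt K (-w) - supportPt K (-u))
    rw [h_eq]
    linarith
  have h_inner := hK.inner_supportPt_sub_le hu hw
  rw [norm_sub_rev] at h_inner
  calc c * (2 * inner ℝ (supportPt K u - supportPt K w) u)
      ≤ c * (2 * (d * (‖w - u‖ ^ 2 / 2))) := by gcongr
    _ ≤ ((d + c) / 2 * ‖w - u‖) ^ 2 := by
      nlinarith [mul_nonneg (sq_nonneg (d - c)) (sq_nonneg ‖w - u‖)]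
    _ ≤ ‖supportPt K w - supportPt K u‖ ^ 2 := by
      have hd : 0 ≤ d := hc.trans hcd
      gcongr

/-- The support inequality at `-w` for the perturbed direction `w = u + s p`, with `p` the
direction from `z` to the support point at `-u`, forces `z` to move away from the supporting
hyperplane at `-u` at a rate quadratic in its distance to the support point. -/
theorem circleRadius_le_of_norm_supportPt_sub_le (hu : ‖u‖ = 1) {z : V} (hz : z ∈ (K : Set V))
    (h_ne : z ≠ supportPt K (-u)) {c r : ℝ} (hc : 0 < c)
    (h_err : ∀ w, ‖w - u‖ < r → ‖supportPt K (-w) - supportPt K (-u)‖ ≤ c / 2 * ‖w - u‖)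
    (h_near : ‖supportPt K (-u) - z‖ < c * r) :
    circleRadius (supportPt K (-u)) (-u) z ≤ ENNReal.ofReal c := by
  refine circleRadius_le_ofReal (by rwa [norm_neg]) h_ne hc.le ?_
  set y := supportPt K (-u)
  have h_pos : 0 < ‖y - z‖ := norm_pos_iff.2 (sub_ne_zero.2 h_ne.symm)
  set s : ℝ := ‖y - z‖ / c with hs
  have hs_pos : 0 < s := div_pos h_pos hc
  have hs_mul : ‖y - z‖ = c * s := by rw [hs]; field_simp
  set p : V := ‖y - z‖⁻¹ • (y - z) with hp
  set w : V := u + s • p with hw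
  have hwu : ‖w - u‖ = s := by
    have hp_norm : ‖p‖ = 1 := norm_smul_inv_norm (norm_pos_iff.1 h_pos)
    rw [hw, add_sub_cancel_left, norm_smul, hp_norm, mul_one, Real.norm_of_nonneg hs_pos.le]
  have h_dist : ‖supportPt K (-w) - y‖ ≤ c / 2 * s :=
    hwu ▸ h_err w (by rw [hwu, hs, div_lt_iff₀ hc]; linarith)
  have h_supp_w := inner_supportPt_sub_nonneg K (-w) hz
  have h_supp_u : 0 ≤ inner ℝ (y - supportPt K (-w)) (-u) :=
    inner_supportPt_sub_nonneg K (-u) (supportPt_mem K (-w))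
  rw [inner_neg_right] at h_supp_w h_supp_u
  have h_cross : inner ℝ (y - supportPt K (-w)) (w - u) ≤ c / 2 * s * s := by
    refine (real_inner_le_norm _ _).trans ?_
    rw [norm_sub_rev, hwu]
    gcongr
  have h_split : inner ℝ (y - z) w = inner ℝ (y - supportPt K (-w)) (w - u)
      + inner ℝ (y - supportPt K (-w)) u + inner ℝ (supportPt K (-w) - z) w := by
    rw [← inner_add_right, sub_add_cancel, ← inner_add_left, sub_add_sub_cancel]
  have h_dir : inner ℝ (y - z) w = inner ℝ (y - z) u + s * ‖y - z‖ := by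
    rw [hw, inner_add_right, inner_smul_right, hp, inner_smul_right, real_inner_self_eq_norm_sq]
    field_simp
  rw [hs_mul] at h_dir
  rw [inner_neg_right, norm_sub_rev z y, hs_mul, mul_pow]
  nlinarith

theorem IsStationary.eventually_norm_sub_le (h : IsStationary K u) {η : ℝ} (hη : 0 < η) :
    ∀ᶠ w in 𝓝 u, ‖supportPt K (-w) - supportPt K (-u)‖ ≤ η * ‖w - u‖ := by
  simpa using (hasFDerivAt_iff_isLittleO.1 h).def hη

variable [FiniteDimensional ℝ V]

theorem IsSmooth.allRadiiOfCurvatureEq_of_tendsto (hK_smooth : IsSmooth K)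
    (hK : HasConstantWidth K d) (hd : 0 < d) (hu : ‖u‖ = 1) {ρ : ℝ≥0∞}
    (h : Tendsto (circleRadius (supportPt K u) u)
      (𝓝[frontier (K : Set V) \ {supportPt K u}] (supportPt K u)) (𝓝 ρ)) :
    AllRadiiOfCurvatureEq (K : Set V) (supportPt K u) ρ := by
  have hu_normal := isOuterUnitNormal_supportPt K hu
  refine ⟨supportPt_mem_frontier K hu, u, hu_normal, fun v hv => hK_smooth hv hu_normal,
    fun t ht htu => ?_⟩
  have := neBot_boundaryFilter K.convex K.isClosed hu_normal (half_pos hd)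
    (hK.supportPt_sub_half_mem_interior hd.ne' hu) htu
  have h_section := h.mono_left (boundaryFilter_planeSection_le K.isClosed ht htu)
  exact ⟨h_section.liminf_eq, h_section.limsup_eq⟩

theorem IsSmooth.eventually_normal_mem (hK_smooth : IsSmooth K) (hK : HasConstantWidth K d)
    (hu : ‖u‖ = 1) {N : Set V} (hN : N ∈ 𝓝 u) :
    ∀ᶠ z in 𝓝 (supportPt K u), ∀ w, ‖w‖ = 1 → z = supportPt K w → w ∈ N := by
  have h_cont : ContinuousOn (supportPt K) (Metric.sphere 0 1 \ interior N) := fun w hw =>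
    (hK.continuousAt_supportPt
      (ne_zero_of_norm_eq_one (mem_sphere_zero_iff_norm.1 hw.1))).continuousWithinAt
  have h_compact : IsCompact (supportPt K '' (Metric.sphere 0 1 \ interior N)) :=
    ((isCompact_sphere (0 : V) 1).diff isOpen_interior).image_of_continuousOn h_cont
  have h_notMem : supportPt K u ∈ (supportPt K '' (Metric.sphere 0 1 \ interior N))ᶜ := by
    rintro ⟨w, ⟨hw, hw_notMem⟩, h_eq⟩
    have hw_normal := isOuterUnitNormal_supportPt K (mem_sphere_zero_iff_norm.1 hw)
    rw [h_eq] at hw_normal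
    have hwu : w = u := hK_smooth hw_normal (isOuterUnitNormal_supportPt K hu)
    exact hw_notMem (hwu ▸ mem_interior_iff_mem_nhds.2 hN)
  filter_upwards [h_compact.isClosed.isOpen_compl.mem_nhds h_notMem] with z hz w hw h_eq
  by_contra hwN
  exact hz ⟨w, ⟨mem_sphere_zero_iff_norm.2 hw, fun h_int => hwN (interior_subset h_int)⟩, h_eq.symm⟩

theorem IsStationary.allRadiiOfCurvatureEq_width (hu_stat : IsStationary K u)
    (hK : HasConstantWidth K d) (hd : 0 < d) (hK_smooth : IsSmooth K) (hu : ‖u‖ = 1) :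
    AllRadiiOfCurvatureEq (K : Set V) (supportPt K u) (ENNReal.ofReal d) := by
  refine hK_smooth.allRadiiOfCurvatureEq_of_tendsto hK hd hu (tendsto_order.2 ⟨?_, ?_⟩)
  · intro a ha
    obtain ⟨c, hac, hcd⟩ := ENNReal.lt_iff_exists_nnreal_btwn.1 ha
    have hcd : (c : ℝ) < d := by
      rw [← ENNReal.ofReal_coe_nnreal] at hcd
      exact (ENNReal.ofReal_lt_ofReal_iff hd).1 hcd
    have h_err := hu_stat.eventually_norm_sub_le (half_pos (sub_pos.2 hcd))
    filter_upwards [nhdsWithin_le_nhds (hK_smooth.eventually_normal_mem hK hu h_err),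
      self_mem_nhdsWithin] with z hz ⟨hz_frontier, hz_ne⟩
    obtain ⟨w, hw, rfl⟩ := hK.exists_eq_supportPt_of_mem_frontier hz_frontier
    refine hac.trans_le ?_
    rw [← ENNReal.ofReal_coe_nnreal]
    exact hK.le_circleRadius hu hw hz_ne c.2 hcd.le (hz w hw rfl)
  · intro a ha
    filter_upwards [self_mem_nhdsWithin] with z ⟨hz_frontier, hz_ne⟩
    exact (hK.circleRadius_le hu (K.isClosed.frontier_subset hz_frontier) hz_ne).trans_lt ha

theorem IsStationary.allRadiiOfCurvatureEq_zero (hu_stat : IsStationary K u)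
    (hK : HasConstantWidth K d) (hd : 0 < d) (hK_smooth : IsSmooth K) (hu : ‖u‖ = 1) :
    AllRadiiOfCurvatureEq (K : Set V) (supportPt K (-u)) 0 := by
  refine hK_smooth.allRadiiOfCurvatureEq_of_tendsto hK hd (by rwa [norm_neg]) ?_
  rw [ENNReal.tendsto_nhds_zero]
  intro a ha
  obtain ⟨c, hc, hca⟩ := ENNReal.lt_iff_exists_nnreal_btwn.1 ha
  have hc : (0 : ℝ) < c := by exact_mod_cast hc
  obtain ⟨r, hr, h_err⟩ := Metric.eventually_nhds_iff.1
    (hu_stat.eventually_norm_sub_le (half_pos hc))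
  filter_upwards [nhdsWithin_le_nhds (Metric.ball_mem_nhds _ (mul_pos hc hr)),
    self_mem_nhdsWithin] with z hz ⟨hz_frontier, hz_ne⟩
  rw [mem_ball_iff_norm'] at hz
  refine le_trans ?_ hca.le
  rw [← ENNReal.ofReal_coe_nnreal]
  exact circleRadius_le_of_norm_supportPt_sub_le hu (K.isClosed.frontier_subset hz_frontier) hz_ne
    hc (fun w hw => h_err (by rwa [dist_eq_norm])) hz

end ConstantWidth

/-! ### Typical bodies are smooth -/

theorem exists_lipschitzWith_supportFn (K : ConvexBody V) :
    ∃ R : ℝ≥0, LipschitzWith R (supportFn K) := by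
  obtain ⟨R, hR_pos, hR⟩ := K.isCompact.isBounded.exists_pos_norm_le
  refine ⟨⟨R, hR_pos.le⟩, LipschitzWith.of_le_add_mul _ fun u v => ?_⟩
  have h_bound : supportFn K (u - v) ≤ R * dist u v := supportFn_le K fun y hy => by
    rw [dist_eq_norm]
    exact (real_inner_le_norm y _).trans (by gcongr; exact hR y hy)
  have h_add := supportFn_add_le K v (u - v)
  rw [add_sub_cancel] at h_add
  exact h_add.trans (add_le_add_right h_bound _)

theorem exists_abs_supportFn_le (K : ConvexBody V) :
    ∃ R : ℝ≥0, ∀ u, |supportFn K u| ≤ R * ‖u‖ := by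
  obtain ⟨R, hR⟩ := exists_lipschitzWith_supportFn K
  refine ⟨R, fun u => ?_⟩
  simpa [(supportFn_smul K).map_zero] using hR.dist_le_mul u 0

theorem IsSmooth.of_supportFn_add_lt {K : ConvexBody V}
    (h : ∀ u v : V, ‖u‖ = 1 → ‖v‖ = 1 → u ≠ v →
      supportFn K (u + v) < supportFn K u + supportFn K v) : IsSmooth K := by
  intro x u v hu hv
  obtain ⟨hx, hu_norm, hxu⟩ := (isOuterUnitNormal_iff K).1 hu
  obtain ⟨-, hv_norm, hxv⟩ := (isOuterUnitNormal_iff K).1 hv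
  by_contra h_ne
  refine (h u v hu_norm hv_norm h_ne).not_ge ?_
  rw [← hxu, ← hxv, ← inner_add_right]
  exact inner_le_supportFn K hx (u + v)

section FiniteDimensional

variable [FiniteDimensional ℝ V]

theorem exists_mix_ball (K : ConstantWidthOne V) {δ : ℝ} (hδ : δ ∈ Set.Icc 0 1) :
    ∃ L : ConstantWidthOne V,
      supportFn L.1 = fun u => (1 - δ) * supportFn K.1 u + δ / 2 * ‖u‖ := by
  refine IsSublinear.exists_constantWidthOne ⟨fun c hc u => ?_, fun u v => ?_⟩ fun u => ?_
  · rw [supportFn_smul K.1 c hc, norm_smul, Real.norm_of_nonneg hc.le]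
    ring
  · have h_add := mul_le_mul_of_nonneg_left (supportFn_add_le K.1 u v) (sub_nonneg.2 hδ.2)
    have h_norm_add := mul_le_mul_of_nonneg_left (norm_add_le u v) (div_nonneg hδ.1 zero_le_two)
    linarith
  · have h_width := K.2.supportFn_add_neg u
    rw [norm_neg]
    linear_combination (1 - δ) * h_width

theorem exists_mix_ball_dist_lt (K : ConstantWidthOne V) {ε : ℝ} (hε : 0 < ε) :
    ∃ δ ∈ Set.Ioo (0 : ℝ) 1, ∃ L : ConstantWidthOne V, dist L K < ε ∧
      supportFn L.1 = fun u => (1 - δ) * supportFn K.1 u + δ / 2 * ‖u‖ := by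
  obtain ⟨R, hR⟩ := exists_abs_supportFn_le K.1
  have h_tendsto : Tendsto (fun δ : ℝ => δ * (1 / 2 + R)) (𝓝[>] 0) (𝓝 0) :=
    ((continuous_id.mul continuous_const).tendsto' 0 0 (zero_mul _)).mono_left nhdsWithin_le_nhds
  obtain ⟨δ, hδε, hδ⟩ := ((h_tendsto.eventually_lt_const hε).and
    (Ioo_mem_nhdsGT one_pos)).exists
  obtain ⟨L, hL⟩ := exists_mix_ball K (Set.Ioo_subset_Icc_self hδ)
  refine ⟨δ, hδ, L, ?_, hL⟩
  have hδ_pos := hδ.1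
  refine lt_of_le_of_lt (dist_le_of_abs_supportFn_sub_le _ _ (by positivity) fun u => ?_) hδε
  calc |supportFn L.1 u - supportFn K.1 u| = δ * |‖u‖ / 2 - supportFn K.1 u| := by
        have h_sub : supportFn L.1 u - supportFn K.1 u = δ * (‖u‖ / 2 - supportFn K.1 u) := by
          rw [hL]
          ring
        rw [h_sub, abs_mul, abs_of_pos hδ_pos]
    _ ≤ δ * (‖u‖ / 2 + R * ‖u‖) := by
      gcongr
      refine (abs_sub _ _).trans (add_le_add ?_ (hR u))
      exact (abs_of_nonneg (by positivity)).le
    _ = δ * (1 / 2 + R) * ‖u‖ := by ring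

theorem isOpen_setOf_supportFn_add_lt (r : ℝ) :
    IsOpen {K : ConstantWidthOne V | ∀ u v : V, ‖u‖ = 1 → ‖v‖ = 1 → r ≤ ‖u - v‖ →
      supportFn K.1 (u + v) < supportFn K.1 u + supportFn K.1 v} := by
  rw [Metric.isOpen_iff]
  intro K hK
  let C : Set (V × V) := (Metric.sphere 0 1 ×ˢ Metric.sphere 0 1) ∩ {p | r ≤ ‖p.1 - p.2‖}
  have hC_mem : ∀ p ∈ C, ‖p.1‖ = 1 ∧ ‖p.2‖ = 1 ∧ r ≤ ‖p.1 - p.2‖ := fun p hp =>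
    ⟨mem_sphere_zero_iff_norm.1 hp.1.1, mem_sphere_zero_iff_norm.1 hp.1.2, hp.2⟩
  have hC_compact : IsCompact C := ((isCompact_sphere 0 1).prod (isCompact_sphere 0 1)).inter_right
    (isClosed_le continuous_const (by fun_prop))
  have h_cont := (isSublinear_supportFn K.1).continuous
  obtain ⟨m, hm, h_gap⟩ : ∃ m : ℝ, 0 < m ∧ ∀ p ∈ C,
      m ≤ supportFn K.1 p.1 + supportFn K.1 p.2 - supportFn K.1 (p.1 + p.2) := by
    refine hC_compact.exists_forall_le' (by fun_prop) fun p hp => sub_pos.2 ?_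
    obtain ⟨h1, h2, h3⟩ := hC_mem p hp
    exact hK p.1 p.2 h1 h2 h3
  refine ⟨m / 4, by positivity, fun L hL u v hu hv huv => ?_⟩
  have h_gap_uv := h_gap (u, v)
    ⟨⟨mem_sphere_zero_iff_norm.2 hu, mem_sphere_zero_iff_norm.2 hv⟩, huv⟩
  rw [Metric.mem_ball, Subtype.dist_eq] at hL
  have h_u := (abs_le.1 (abs_supportFn_sub_le L.1 K.1 u)).1
  have h_v := (abs_le.1 (abs_supportFn_sub_le L.1 K.1 v)).1
  have h_uv := (abs_le.1 (abs_supportFn_sub_le L.1 K.1 (u + v))).2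
  have h_norm : dist L.1 K.1 * ‖u + v‖ ≤ dist L.1 K.1 * (1 + 1) := by
    gcongr
    exact (norm_add_le u v).trans_eq (by rw [hu, hv])
  rw [hu] at h_u
  rw [hv] at h_v
  linarith

theorem eventually_residual_isSmooth :
    ∀ᶠ K : ConstantWidthOne V in residual _, IsSmooth K.1 := by
  have h_separated : ∀ k : ℕ, ∀ᶠ K in residual (ConstantWidthOne V),
      ∀ u v : V, ‖u‖ = 1 → ‖v‖ = 1 → 1 / ((k : ℝ) + 1) ≤ ‖u - v‖ →
      supportFn K.1 (u + v) < supportFn K.1 u + supportFn K.1 v := by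
    intro k
    refine residual_of_dense_open (isOpen_setOf_supportFn_add_lt _) (Metric.dense_iff.2 ?_)
    intro K r hr
    obtain ⟨δ, hδ, L, hLK, hL⟩ := exists_mix_ball_dist_lt K hr
    refine ⟨L, hLK, fun u v hu hv huv => ?_⟩
    have h_ne : u ≠ v := sub_ne_zero.1 (norm_pos_iff.1 ((by positivity : (0 : ℝ) < _).trans_le huv))
    have h_strict : ‖u + v‖ < ‖u‖ + ‖v‖ :=
      norm_add_lt_of_not_sameRay ((not_sameRay_iff_of_norm_eq (hu.trans hv.symm)).2 h_ne)
    have h_add := mul_le_mul_of_nonneg_left (supportFn_add_le K.1 u v) (sub_nonneg.2 hδ.2.le)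
    rw [hL]
    linarith [mul_lt_mul_of_pos_left h_strict (half_pos hδ.1)]
  filter_upwards [eventually_countable_forall.2 h_separated] with K hK
  refine IsSmooth.of_supportFn_add_lt fun u v hu hv h_ne => ?_
  obtain ⟨k, hk⟩ := exists_nat_one_div_lt (norm_pos_iff.2 (sub_ne_zero.2 h_ne))
  exact hK k u v hu hv hk.le

end FiniteDimensional

/-! ### Second differences and second derivatives -/

/-- Osgood's argument: the closed sets of points at which all the late differences are small cover
the space, and a typical point is in none of their boundaries. -/
theorem eventually_residual_of_cauchy {X : Type*} [TopologicalSpace X] {d : ℕ → ℕ → X → ℝ}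
    (hd : ∀ k l, Continuous (d k l)) (h : ∀ x, ∀ ε > 0, ∃ m, ∀ k ≥ m, ∀ l ≥ m, d k l x ≤ ε) :
    ∀ᶠ x in residual X, ∀ ε > 0, ∃ m, ∀ᶠ y in 𝓝 x, ∀ k ≥ m, ∀ l ≥ m, d k l y ≤ ε := by
  let C : ℕ → ℕ → Set X := fun j m => {x | ∀ k ≥ m, ∀ l ≥ m, d k l x ≤ 1 / ((j : ℝ) + 1)}
  have hC_closed : ∀ j m, IsClosed (C j m) := fun j m => by
    simp only [C, Set.ofPred_forall]
    exact isClosed_iInter fun k => isClosed_iInter fun _ => isClosed_iInter fun l =>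
      isClosed_iInter fun _ => isClosed_le (hd k l) continuous_const
  have h_frontier : ∀ j m, ∀ᶠ x in residual X, x ∈ (frontier (C j m))ᶜ := fun j m =>
    residual_of_dense_open isClosed_frontier.isOpen_compl
      (interior_eq_empty_iff_dense_compl.1 (interior_frontier (hC_closed j m)))
  filter_upwards [eventually_countable_forall.2 fun j =>
    eventually_countable_forall.2 (h_frontier j)] with x hx ε hε
  obtain ⟨j, hj⟩ := exists_nat_one_div_lt hε
  obtain ⟨m, hm⟩ := h x (1 / ((j : ℝ) + 1)) (by positivity)
  have h_int : x ∈ interior (C j m) := by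
    by_contra h_notMem
    exact hx j m ⟨subset_closure hm, h_notMem⟩
  refine ⟨m, ?_⟩
  filter_upwards [mem_interior_iff_mem_nhds.1 h_int] with y hy k hk l hl
  exact (hy k hk l hl).trans hj.le

/-- The second derivative of `f` as a bilinear form. -/
def hess {E : Type*} [NormedAddCommGroup E] [NormedSpace ℝ E] (f : E → ℝ) (u : E) :
    E →L[ℝ] E →L[ℝ] ℝ :=
  fderiv ℝ (fderiv ℝ f) u

/-- Normalized second differences of `f` in direction `t`, with step `1 / (k + 1)`. -/
def secondDiff {E : Type*} [AddCommGroup E] [Module ℝ E] (f : E → ℝ) (t : E) (k : ℕ) (u : E) : ℝ :=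
  ((k : ℝ) + 1) ^ 2 * (f (u + ((k : ℝ) + 1)⁻¹ • t) + f (u - ((k : ℝ) + 1)⁻¹ • t) - 2 * f u)

section Taylor

variable {E : Type*} [NormedAddCommGroup E] [NormedSpace ℝ E] {f : E → ℝ} {u : E}

theorem isLittleO_taylor_two (hf : ∀ᶠ w in 𝓝 u, DifferentiableAt ℝ f w)
    (hf' : DifferentiableAt ℝ (fderiv ℝ f) u) (t : E) :
    (fun s : ℝ => f (u + s • t) - f u - s * fderiv ℝ f u t - s ^ 2 / 2 * hess f u t t)
      =o[𝓝[>] 0] fun s => s ^ 2 := by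
  obtain ⟨r, hr, h_diff⟩ := Metric.eventually_nhds_iff_ball.1 hf
  set c : ℝ := r / (‖t‖ + 1)
  have hc : 0 < c := by positivity
  have hct : u + 0 + c • t ∈ interior (Metric.ball u r) := by
    rw [Metric.isOpen_ball.interior_eq, add_zero, mem_ball_iff_norm, add_sub_cancel_left,
      norm_smul, Real.norm_of_nonneg hc.le, div_mul_eq_mul_div, div_lt_iff₀ (by positivity)]
    linarith
  have h_scaled := (convex_ball u r).taylor_approx_two_segment (f' := fderiv ℝ f)
    (fun w hw => (h_diff w (interior_subset hw)).hasFDerivAt) (Metric.mem_ball_self hr)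
    hf'.hasFDerivAt.hasFDerivWithinAt (v := 0)
    (by rw [add_zero, Metric.isOpen_ball.interior_eq]; exact Metric.mem_ball_self hr) hct
  have h_tendsto : Tendsto (fun s : ℝ => s * c⁻¹) (𝓝[>] 0) (𝓝[>] 0) :=
    tendsto_nhdsWithin_iff.2 ⟨((continuous_id.mul continuous_const).tendsto' 0 0
      (zero_mul _)).mono_left nhdsWithin_le_nhds, by
        filter_upwards [self_mem_nhdsWithin] with s hs using mul_pos hs (inv_pos.2 hc)⟩
  refine ((h_scaled.comp_tendsto h_tendsto).congr_left fun s => ?_).trans_isBigO ?_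
  · have hc0 : c ≠ 0 := hc.ne'
    simp only [Function.comp_apply, smul_zero, add_zero, smul_smul, inv_mul_cancel_right₀ hc0,
      map_smul, map_zero, smul_apply, zero_apply, smul_eq_mul, hess]
    field_simp
    ring
  · simp only [Function.comp_def, mul_pow, mul_comm _ (c⁻¹ ^ 2)]
    exact Asymptotics.isBigO_const_mul_self (c⁻¹ ^ 2) (fun s : ℝ => s ^ 2) _

theorem tendsto_secondDiff (hf : ∀ᶠ w in 𝓝 u, DifferentiableAt ℝ f w)
    (hf' : DifferentiableAt ℝ (fderiv ℝ f) u) (t : E) :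
    Tendsto (fun k => secondDiff f t k u) atTop (𝓝 (hess f u t t)) := by
  have h_step : Tendsto (fun k : ℕ => ((k : ℝ) + 1)⁻¹) atTop (𝓝[>] 0) :=
    tendsto_nhdsWithin_iff.2 ⟨by simpa using tendsto_one_div_add_atTop_nhds_zero_nat (𝕜 := ℝ),
      Eventually.of_forall fun k => by simp only [Set.mem_Ioi]; positivity⟩
  have h_sum := ((isLittleO_taylor_two hf hf' t).add
    (isLittleO_taylor_two hf hf' (-t))).tendsto_div_nhds_zero.comp h_step
  rw [← tendsto_sub_nhds_zero_iff]
  refine h_sum.congr fun k => ?_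
  simp only [Function.comp_apply, secondDiff, smul_neg, map_neg, neg_apply, neg_neg,
    ← sub_eq_add_neg]
  field_simp
  ring

end Taylor

theorem norm_add_add_norm_sub_le (u v : V) (hu : u ≠ 0) :
    ‖u + v‖ + ‖u - v‖ ≤ 2 * ‖u‖ + ‖v‖ ^ 2 / ‖u‖ := by
  have : 0 < ‖u‖ := norm_pos_iff.2 hu
  refine le_of_sq_le_sq ?_ (by positivity)
  calc (‖u + v‖ + ‖u - v‖) ^ 2 ≤ 4 * ‖u‖ ^ 2 + 4 * ‖v‖ ^ 2 := by
        linarith [parallelogram_law_with_norm ℝ u v, sq_nonneg (‖u + v‖ - ‖u - v‖)]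
    _ ≤ 4 * ‖u‖ ^ 2 + 4 * ‖v‖ ^ 2 + (‖v‖ ^ 2 / ‖u‖) ^ 2 := le_add_of_nonneg_right (sq_nonneg _)
    _ = (2 * ‖u‖ + ‖v‖ ^ 2 / ‖u‖) ^ 2 := by
      field_simp
      ring

theorem IsSublinear.secondDiff_nonneg {h : V → ℝ} (hh : IsSublinear h) (t : V) (k : ℕ) (u : V) :
    0 ≤ secondDiff h t k u := by
  refine mul_nonneg (by positivity) ?_
  have h_add := hh.add_le (u + ((k : ℝ) + 1)⁻¹ • t) (u - ((k : ℝ) + 1)⁻¹ • t)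
  rw [add_add_sub_cancel, ← two_smul ℝ u, hh.smul 2 two_pos] at h_add
  linarith

namespace HasConstantWidth

variable {K : ConvexBody V} {d : ℝ}

theorem secondDiff_supportFn_le (hK : HasConstantWidth K d) (t : V) (k : ℕ) {u : V} (hu : u ≠ 0) :
    secondDiff (supportFn K) t k u ≤ d * (‖t‖ ^ 2 / ‖u‖) := by
  have h_opp := (isSublinear_supportFn K).secondDiff_nonneg t k (-u)
  set s : V := ((k : ℝ) + 1)⁻¹ • t with hs
  have h_add := hK.supportFn_add_neg (u + s)
  have h_sub := hK.supportFn_add_neg (u - s)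
  have h_mid := hK.supportFn_add_neg u
  rw [neg_add, ← sub_eq_add_neg] at h_add
  rw [neg_sub', sub_neg_eq_add] at h_sub
  calc secondDiff (supportFn K) t k u
      ≤ secondDiff (supportFn K) t k u + secondDiff (supportFn K) t k (-u) :=
        le_add_of_nonneg_right h_opp
    _ = d * (((k : ℝ) + 1) ^ 2 * (‖u + s‖ + ‖u - s‖ - 2 * ‖u‖)) := by
      rw [secondDiff, secondDiff, ← hs]
      linear_combination ((k : ℝ) + 1) ^ 2 * (h_add + h_sub - 2 * h_mid)
    _ ≤ d * (((k : ℝ) + 1) ^ 2 * (‖s‖ ^ 2 / ‖u‖)) := by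
      have := hK.nonneg hu
      gcongr
      linarith [norm_add_add_norm_sub_le u s hu]
    _ = d * (‖t‖ ^ 2 / ‖u‖) := by
      rw [hs, norm_smul, Real.norm_of_nonneg (by positivity)]
      field_simp

theorem eventually_differentiableAt_supportFn (hK : HasConstantWidth K d) {u : V} (hu : u ≠ 0) :
    ∀ᶠ w in 𝓝 u, DifferentiableAt ℝ (supportFn K) w := by
  filter_upwards [isOpen_ne.mem_nhds hu] with w hw
  exact (hK.hasFDerivAt_supportFn hw).differentiableAt

theorem hasFDerivAt_fderiv_supportFn (hK : HasConstantWidth K d) {u : V} (hu : u ≠ 0)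
    {A : V →L[ℝ] V} (hA : HasFDerivAt (supportPt K) A u) :
    HasFDerivAt (fderiv ℝ (supportFn K)) ((innerSL ℝ).comp A) u := by
  refine ((innerSL ℝ).hasFDerivAt.comp u hA).congr_of_eventuallyEq ?_
  filter_upwards [isOpen_ne.mem_nhds hu] with w hw
  exact hK.fderiv_supportFn hw

theorem hess_supportFn (hK : HasConstantWidth K d) {u : V} (hu : u ≠ 0) {A : V →L[ℝ] V}
    (hA : HasFDerivAt (supportPt K) A u) (s t : V) :
    hess (supportFn K) u s t = inner ℝ (A s) t := by
  rw [hess, (hK.hasFDerivAt_fderiv_supportFn hu hA).fderiv]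
  rfl

end HasConstantWidth

/-- The closed annulus of radii `1` and `2`. Integration over directions is replaced by integration
over this set, which spares us the surface measure of the sphere. -/
def annulus (V : Type*) [NormedAddCommGroup V] : Set V := {u | 1 ≤ ‖u‖ ∧ ‖u‖ ≤ 2}

section Annulus

variable {E : Type*} [NormedAddCommGroup E]

theorem ne_zero_of_mem_annulus {u : E} (hu : u ∈ annulus E) : u ≠ 0 :=
  norm_pos_iff.1 (one_pos.trans_le hu.1)

theorem mem_annulus_of_norm_eq_one {u : E} (hu : ‖u‖ = 1) : u ∈ annulus E :=
  ⟨hu.ge, hu.le.trans one_le_two⟩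

theorem neg_mem_annulus {u : E} : -u ∈ annulus E ↔ u ∈ annulus E := by
  simp only [annulus, Set.mem_ofPred_eq, norm_neg]

theorem isClosed_annulus : IsClosed (annulus E) :=
  (isClosed_le continuous_const continuous_norm).inter
    (isClosed_le continuous_norm continuous_const)

theorem isCompact_annulus [ProperSpace E] : IsCompact (annulus E) :=
  (isCompact_closedBall (0 : E) 2).of_isClosed_subset isClosed_annulus fun _ hu =>
    mem_closedBall_zero_iff.2 hu.2

variable [MeasurableSpace E] [BorelSpace E] (μ : Measure E)

instance isFiniteMeasure_restrict_annulus [ProperSpace E] [IsFiniteMeasureOnCompacts μ] :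
    IsFiniteMeasure (μ.restrict (annulus E)) :=
  isFiniteMeasure_restrict.2 isCompact_annulus.measure_lt_top.ne

theorem ae_restrict_annulus_mem : ∀ᵐ u ∂μ.restrict (annulus E), u ∈ annulus E :=
  ae_restrict_mem isClosed_annulus.measurableSet

end Annulus

theorem abs_secondDiff_supportFn_le (K : ConstantWidthOne V) (t : V) (k : ℕ) {u : V}
    (hu : u ∈ annulus V) : |secondDiff (supportFn K.1) t k u| ≤ ‖t‖ ^ 2 := by
  rw [abs_of_nonneg ((isSublinear_supportFn K.1).secondDiff_nonneg t k u)]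
  refine (K.2.secondDiff_supportFn_le t k (ne_zero_of_mem_annulus hu)).trans ?_
  rw [one_mul]
  exact div_le_self (by positivity) hu.1

theorem continuous_supportFn_body (u : V) : Continuous fun K : ConvexBody V => supportFn K u :=
  (LipschitzWith.of_dist_le_mul (K := ‖u‖₊) fun K L =>
    (abs_supportFn_sub_le K L u).trans_eq (mul_comm _ _)).continuous

theorem continuous_secondDiff_body (t : V) (k : ℕ) (u : V) :
    Continuous fun K : ConvexBody V => secondDiff (supportFn K) t k u :=
  continuous_const.mul (((continuous_supportFn_body _).add (continuous_supportFn_body _)).sub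
    (continuous_const.mul (continuous_supportFn_body _)))

theorem integral_abs_sub_le_add {α : Type*} [MeasurableSpace α] {μ : Measure α} {f g h : α → ℝ}
    (hf : Integrable f μ) (hg : Integrable g μ) (hh : Integrable h μ) :
    ∫ x, |f x - h x| ∂μ ≤ (∫ x, |f x - g x| ∂μ) + ∫ x, |g x - h x| ∂μ := by
  refine le_of_le_of_eq ?_ (integral_add (hf.sub hg).abs (hg.sub hh).abs)
  exact integral_mono (hf.sub hh).abs ((hf.sub hg).abs.add (hg.sub hh).abs) fun x =>
    abs_sub_le (f x) (g x) (h x)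

section Measure

variable [FiniteDimensional ℝ V] [MeasurableSpace V] [BorelSpace V]

theorem ae_differentiableAt_supportPt (K : ConstantWidthOne V) :
    ∀ᵐ u ∂(volume : Measure V).restrict (annulus V), DifferentiableAt ℝ (supportPt K.1) u := by
  filter_upwards [ae_restrict_of_ae
    (K.2.lipschitzOnWith_supportPt one_half_pos).ae_differentiableWithinAt_of_mem,
    ae_restrict_annulus_mem volume] with u hu hu_mem
  have hu_half : (1 / 2 : ℝ) < ‖u‖ := one_half_lt_one.trans_le hu_mem.1
  exact (hu hu_half).differentiableAt
    ((isOpen_lt continuous_const continuous_norm).mem_nhds hu_half)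

theorem ae_differentiableAt_fderiv_supportFn (K : ConstantWidthOne V) :
    ∀ᵐ u ∂(volume : Measure V).restrict (annulus V),
      DifferentiableAt ℝ (fderiv ℝ (supportFn K.1)) u := by
  filter_upwards [ae_differentiableAt_supportPt K, ae_restrict_annulus_mem volume] with u hu hu_mem
  exact (K.2.hasFDerivAt_fderiv_supportFn (ne_zero_of_mem_annulus hu_mem)
    hu.hasFDerivAt).differentiableAt

theorem ae_tendsto_secondDiff (K : ConstantWidthOne V) (t : V) :
    ∀ᵐ u ∂(volume : Measure V).restrict (annulus V),
      Tendsto (fun k => secondDiff (supportFn K.1) t k u) atTop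
        (𝓝 (hess (supportFn K.1) u t t)) := by
  filter_upwards [ae_differentiableAt_fderiv_supportFn K, ae_restrict_annulus_mem volume]
    with u hu hu_mem
  exact tendsto_secondDiff
    (K.2.eventually_differentiableAt_supportFn (ne_zero_of_mem_annulus hu_mem)) hu t

theorem integrable_secondDiff (K : ConvexBody V) (t : V) (k : ℕ) :
    Integrable (secondDiff (supportFn K) t k) (volume.restrict (annulus V)) := by
  have h_cont := (isSublinear_supportFn K).continuous
  refine ContinuousOn.integrableOn_compact isCompact_annulus (Continuous.continuousOn ?_)
  unfold secondDiff
  fun_prop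

theorem integrable_hess (K : ConstantWidthOne V) (t : V) :
    Integrable (fun u => hess (supportFn K.1) u t t) (volume.restrict (annulus V)) := by
  refine Integrable.of_bound (C := ‖t‖ ^ 2) (aestronglyMeasurable_of_tendsto_ae atTop
    (fun k => (integrable_secondDiff K.1 t k).aestronglyMeasurable) (ae_tendsto_secondDiff K t)) ?_
  filter_upwards [ae_tendsto_secondDiff K t, ae_restrict_annulus_mem volume] with u hu hu_mem
  exact le_of_tendsto hu.norm
    (Eventually.of_forall fun k => abs_secondDiff_supportFn_le K t k hu_mem)

theorem tendsto_integral_abs_sub_secondDiff (K : ConstantWidthOne V) (t : V) {g : V → ℝ}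
    (hg : Integrable g (volume.restrict (annulus V))) :
    Tendsto (fun k => ∫ u in annulus V, |g u - secondDiff (supportFn K.1) t k u|) atTop
      (𝓝 (∫ u in annulus V, |g u - hess (supportFn K.1) u t t|)) := by
  refine tendsto_integral_of_dominated_convergence (fun u => |g u| + ‖t‖ ^ 2)
    (fun k => (hg.sub (integrable_secondDiff K.1 t k)).abs.aestronglyMeasurable)
    (hg.abs.add (integrable_const _)) (fun k => ?_) ?_
  · filter_upwards [ae_restrict_annulus_mem volume] with u hu
    rw [Real.norm_eq_abs, abs_abs]
    exact (abs_sub _ _).trans (add_le_add_right (abs_secondDiff_supportFn_le K t k hu) _)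
  · filter_upwards [ae_tendsto_secondDiff K t] with u hu
    exact (hu.const_sub (g u)).abs

theorem continuous_integral_abs_secondDiff_sub (t : V) (k l : ℕ) :
    Continuous fun p : ConstantWidthOne V × ConstantWidthOne V => ∫ u in annulus V,
      |secondDiff (supportFn p.1.1) t k u - secondDiff (supportFn p.2.1) t l u| := by
  refine continuous_of_dominated (bound := fun _ => ‖t‖ ^ 2 + ‖t‖ ^ 2)
    (fun p => ((integrable_secondDiff p.1.1 t k).sub
      (integrable_secondDiff p.2.1 t l)).abs.aestronglyMeasurable)
    (fun p => ?_) (integrable_const _) (Eventually.of_forall fun u => ?_)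
  · filter_upwards [ae_restrict_annulus_mem volume] with u hu
    rw [Real.norm_eq_abs, abs_abs]
    exact (abs_sub _ _).trans (add_le_add (abs_secondDiff_supportFn_le p.1 t k hu)
      (abs_secondDiff_supportFn_le p.2 t l hu))
  · exact (((continuous_secondDiff_body t k u).comp continuous_subtype_val).fst'.sub
      ((continuous_secondDiff_body t l u).comp continuous_subtype_val).snd').abs

theorem exists_forall_ge_integral_abs_secondDiff_sub_le (K : ConstantWidthOne V) (t : V) {ε : ℝ}
    (hε : 0 < ε) : ∃ m, ∀ k ≥ m, ∀ l ≥ m, ∫ u in annulus V,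
      |secondDiff (supportFn K.1) t k u - secondDiff (supportFn K.1) t l u| ≤ ε := by
  have h_tendsto := tendsto_integral_abs_sub_secondDiff K t (integrable_hess K t)
  simp only [sub_self, abs_zero, integral_zero] at h_tendsto
  obtain ⟨m, hm⟩ := eventually_atTop.1 (h_tendsto.eventually_lt_const (half_pos hε))
  refine ⟨m, fun k hk l hl => (integral_abs_sub_le_add (integrable_secondDiff K.1 t k)
    (integrable_hess K t) (integrable_secondDiff K.1 t l)).trans ?_⟩
  have h_k := hm k hk
  simp only [abs_sub_comm (hess _ _ _ _)] at h_k
  linarith [hm l hl]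

/-- The second derivative is the pointwise limit of the second differences, which depend
continuously on the body. -/
theorem eventually_residual_continuousAt_hess (t : V) :
    ∀ᶠ K in residual (ConstantWidthOne V), ∀ ε > 0, ∀ᶠ L in 𝓝 K,
      ∫ u in annulus V, |hess (supportFn L.1) u t t - hess (supportFn K.1) u t t| ≤ ε := by
  let D : ℕ → ℕ → ConstantWidthOne V × ConstantWidthOne V → ℝ := fun k l p => ∫ u in annulus V,
    |secondDiff (supportFn p.1.1) t k u - secondDiff (supportFn p.2.1) t l u|
  have hD : ∀ k l, Continuous (D k l) := continuous_integral_abs_secondDiff_sub t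
  filter_upwards [eventually_residual_of_cauchy (d := fun k l K => D k l (K, K))
    (fun k l => (hD k l).comp (continuous_id.prodMk continuous_id))
    fun K ε hε => exists_forall_ge_integral_abs_secondDiff_sub_le K t hε] with K hK ε hε
  obtain ⟨m, hm⟩ := hK (ε / 3) (by positivity)
  have h_hess : ∀ᶠ L : ConstantWidthOne V in 𝓝 K, ∫ u in annulus V,
      |secondDiff (supportFn L.1) t m u - hess (supportFn L.1) u t t| ≤ ε / 3 := by
    filter_upwards [hm] with L hL
    exact le_of_tendsto (tendsto_integral_abs_sub_secondDiff L t (integrable_secondDiff L.1 t m))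
      (eventually_atTop.2 ⟨m, fun l hl => hL m le_rfl l hl⟩)
  have h_diff : ∀ᶠ L : ConstantWidthOne V in 𝓝 K, ∫ u in annulus V,
      |secondDiff (supportFn L.1) t m u - secondDiff (supportFn K.1) t m u| < ε / 3 := by
    have h_zero : D m m (K, K) = 0 := by simp [D]
    exact ((hD m m).comp (continuous_id.prodMk continuous_const)).continuousAt.eventually_lt
      continuousAt_const (h_zero.trans_lt (by positivity))
  filter_upwards [h_hess, h_diff] with L hL_hess hL_diff
  have hL_sd := integral_abs_sub_le_add (integrable_hess L t) (integrable_secondDiff L.1 t m)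
    (integrable_hess K t)
  have hK_sd := integral_abs_sub_le_add (integrable_secondDiff L.1 t m)
    (integrable_secondDiff K.1 t m) (integrable_hess K t)
  simp only [abs_sub_comm (secondDiff _ _ _ _) (hess (supportFn L.1) _ _ _)] at hL_hess hL_sd hK_sd
  linarith [h_hess.self_of_nhds]

end Measure

/-! ### Smoothing support functions -/

section Smoothing

open scoped ContDiff

variable [FiniteDimensional ℝ V] [MeasurableSpace V] [BorelSpace V]

/-- Smooth rotationally symmetric probability densities that vanish outside the ball of radius
`η` around the origin. -/
structure IsRadialMollifier (φ : V → ℝ) (η : ℝ) : Prop where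
  contDiff : ContDiff ℝ ∞ φ
  hasCompactSupport : HasCompactSupport φ
  nonneg : ∀ z, 0 ≤ φ z
  eq_zero : ∀ z, η < ‖z‖ → φ z = 0
  eq_of_norm_eq : ∀ z w, ‖z‖ = ‖w‖ → φ z = φ w
  integral_eq_one : ∫ z, φ z = 1

theorem exists_isRadialMollifier {η : ℝ} (hη : 0 < η) : ∃ φ : V → ℝ, IsRadialMollifier φ η := by
  set g : V → ℝ := fun z => expNegInvGlue (η ^ 2 - ‖z‖ ^ 2) with hg
  have hg_smooth : ContDiff ℝ ∞ g :=
    expNegInvGlue.contDiff.comp (contDiff_const.sub (contDiff_norm_sq ℝ))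
  have hg_nonneg : ∀ z, 0 ≤ g z := fun z => expNegInvGlue.nonneg _
  have hg_zero : ∀ z, η < ‖z‖ → g z = 0 := fun z hz =>
    expNegInvGlue.zero_of_nonpos (sub_nonpos.2 (pow_le_pow_left₀ hη.le hz.le 2))
  have hg_supp : HasCompactSupport g := HasCompactSupport.intro (isCompact_closedBall (0 : V) η)
    fun z hz => hg_zero z (by simpa using hz)
  have hg_int : 0 < ∫ z, g z := by
    refine hg_smooth.continuous.integral_pos_of_hasCompactSupport_nonneg_nonzero hg_supp
      hg_nonneg (x := 0) (expNegInvGlue.pos_of_pos ?_).ne'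
    rw [norm_zero]
    nlinarith
  refine ⟨fun z => g z * (∫ z, g z)⁻¹, hg_smooth.mul contDiff_const, hg_supp.mul_right,
    fun z => mul_nonneg (hg_nonneg z) (inv_nonneg.2 hg_int.le), fun z hz => ?_,
    fun z w hzw => ?_, ?_⟩
  · rw [hg_zero z hz, zero_mul]
  · simp only [hg, hzw]
  · rw [integral_mul_const, mul_inv_cancel₀ hg_int.ne']

/-- The average of `h` over a small ball around `u` whose radius is proportional to `‖u‖`, so that
homogeneity is preserved. -/
def radialMean (φ h : V → ℝ) (u : V) : ℝ := ∫ z, h (u + ‖u‖ • z) * φ z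

namespace IsRadialMollifier

variable {φ : V → ℝ} {η : ℝ} {f g h : V → ℝ}

theorem neg_apply (hφ : IsRadialMollifier φ η) (z : V) : φ (-z) = φ z :=
  hφ.eq_of_norm_eq _ _ (norm_neg z)

theorem integrable_mul (hφ : IsRadialMollifier φ η) (hf : Continuous f) :
    Integrable fun z => f z * φ z :=
  (hf.mul hφ.contDiff.continuous).integrable_of_hasCompactSupport hφ.hasCompactSupport.mul_left

theorem integral_mul_mono (hφ : IsRadialMollifier φ η) (hf : Continuous f) (hg : Continuous g)
    (hfg : ∀ z, ‖z‖ ≤ η → f z ≤ g z) : ∫ z, f z * φ z ≤ ∫ z, g z * φ z := by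
  refine integral_mono (hφ.integrable_mul hf) (hφ.integrable_mul hg) fun z => ?_
  rcases le_or_gt ‖z‖ η with hz | hz
  · exact mul_le_mul_of_nonneg_right (hfg z hz) (hφ.nonneg z)
  · simp only [hφ.eq_zero z hz, mul_zero, le_refl]

theorem integral_add_mul (hφ : IsRadialMollifier φ η) (hf : Continuous f) (hg : Continuous g) :
    ∫ z, (f z + g z) * φ z = (∫ z, f z * φ z) + ∫ z, g z * φ z := by
  simp only [add_mul]
  exact integral_add (hφ.integrable_mul hf) (hφ.integrable_mul hg)

theorem integral_neg_mul (hφ : IsRadialMollifier φ η) (f : V → ℝ) :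
    ∫ z, f (-z) * φ z = ∫ z, f z * φ z := by
  rw [← integral_neg_eq_self]
  simp only [neg_neg, hφ.neg_apply]

/-- As a function of `s ∈ ℝ`, the integral is convex and even. -/
theorem integral_comp_add_smul_mono (hφ : IsRadialMollifier φ η) (hf : ConvexOn ℝ Set.univ f)
    (hf_cont : Continuous f) (w : V) {s t : ℝ} (hs : 0 ≤ s) (hst : s ≤ t) :
    ∫ z, f (w + s • z) * φ z ≤ ∫ z, f (w + t • z) * φ z := by
  set G : ℝ → ℝ := fun s => ∫ z, f (w + s • z) * φ z with hG
  have hG_convex : ConvexOn ℝ Set.univ G := by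
    refine ⟨convex_univ, fun x _ y _ a b ha hb hab => ?_⟩
    calc G (a • x + b • y) ≤ ∫ z, (a * f (w + x • z) + b * f (w + y • z)) * φ z := by
          refine hφ.integral_mul_mono (by fun_prop) (by fun_prop) fun z _ => ?_
          refine le_of_eq_of_le (congrArg f ?_)
            (hf.2 (Set.mem_univ (w + x • z)) (Set.mem_univ (w + y • z)) ha hb hab)
          calc w + (a • x + b • y) • z = (1 : ℝ) • w + (a • x + b • y) • z := by rw [one_smul]
            _ = a • (w + x • z) + b • (w + y • z) := by rw [← hab]; module
      _ = a • G x + b • G y := by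
        rw [hφ.integral_add_mul (by fun_prop) (by fun_prop)]
        simp only [mul_assoc, integral_const_mul, hG, smul_eq_mul]
  have hG_even : G (-t) = G t := by
    simpa only [hG, smul_neg, neg_smul] using hφ.integral_neg_mul fun z => f (w + t • z)
  have h_le := hG_convex.le_max_of_mem_Icc (Set.mem_univ (-t)) (Set.mem_univ t)
    (show s ∈ Set.Icc (-t) t from ⟨by linarith, hst⟩)
  rwa [hG_even, max_self] at h_le

theorem isSublinear_radialMean (hφ : IsRadialMollifier φ η) (hh : IsSublinear h) :
    IsSublinear (radialMean φ h) := by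
  have h_cont := hh.continuous
  refine ⟨fun c hc u => ?_, fun u v => ?_⟩
  · simp only [radialMean, norm_smul, Real.norm_of_nonneg hc.le, mul_smul, ← smul_add,
      hh.smul c hc, mul_assoc, integral_const_mul]
  · calc radialMean φ h (u + v) ≤ ∫ z, h (u + v + (‖u‖ + ‖v‖) • z) * φ z :=
          hφ.integral_comp_add_smul_mono hh.convexOn h_cont _ (norm_nonneg _) (norm_add_le u v)
      _ ≤ ∫ z, (h (u + ‖u‖ • z) + h (v + ‖v‖ • z)) * φ z := by
        refine hφ.integral_mul_mono (by fun_prop) (by fun_prop) fun z _ => ?_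
        refine le_of_eq_of_le (congrArg h ?_) (hh.add_le _ _)
        module
      _ = radialMean φ h u + radialMean φ h v :=
        hφ.integral_add_mul (by fun_prop) (by fun_prop)

theorem radialMean_add_neg (hφ : IsRadialMollifier φ η) (hh : Continuous h) (u : V) :
    radialMean φ h u + radialMean φ h (-u) = radialMean φ (fun v => h v + h (-v)) u := by
  have h_neg : radialMean φ h (-u) = ∫ z, h (-(u + ‖u‖ • z)) * φ z := by
    rw [radialMean, ← hφ.integral_neg_mul]
    simp only [norm_neg, smul_neg, neg_add]
  rw [h_neg, radialMean, radialMean, hφ.integral_add_mul (by fun_prop) (by fun_prop)]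

theorem radialMean_norm (hφ : IsRadialMollifier φ η) {e : V} (he : ‖e‖ = 1) (u : V) :
    radialMean φ norm u = radialMean φ norm e * ‖u‖ := by
  have h_unit : ∀ v : V, ‖v‖ = 1 → radialMean φ norm v = radialMean φ norm e := by
    intro v hv
    set ρ := (ℝ ∙ (e - v))ᗮ.reflection
    have hρ : ρ e = v := Submodule.reflection_sub (he.trans hv.symm)
    rw [radialMean, ← ρ.measurePreserving.integral_comp ρ.toHomeomorph.measurableEmbedding,
      radialMean]
    refine integral_congr_ae (Eventually.of_forall fun z => ?_)
    simp only [← hρ, ρ.norm_map, ← map_smul, ← map_add, hφ.eq_of_norm_eq (ρ z) z (ρ.norm_map z)]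
  rcases eq_or_ne u 0 with rfl | hu
  · simp [radialMean]
  · have hu_norm := norm_ne_zero_iff.2 hu
    have h_smul := (hφ.isSublinear_radialMean (h := norm) ⟨fun c hc v => by
      rw [norm_smul, Real.norm_of_nonneg hc.le], norm_add_le⟩).smul ‖u‖ (norm_pos_iff.2 hu)
      (‖u‖⁻¹ • u)
    rw [smul_smul, mul_inv_cancel₀ hu_norm, one_smul,
      h_unit (‖u‖⁻¹ • u) (norm_smul_inv_norm hu)] at h_smul
    rw [h_smul, mul_comm]

theorem abs_radialMean_sub_le (hφ : IsRadialMollifier φ η) {R : ℝ≥0} (hh : LipschitzWith R h)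
    (u : V) : |radialMean φ h u - h u| ≤ R * η * ‖u‖ := by
  have h_cont := hh.continuous
  have h_near : ∀ z : V, ‖z‖ ≤ η → |h (u + ‖u‖ • z) - h u| ≤ R * η * ‖u‖ := fun z hz => by
    refine (hh.dist_le_mul (u + ‖u‖ • z) u).trans ?_
    rw [dist_self_add_left, norm_smul, norm_norm, mul_assoc, mul_comm η]
    gcongr
  have h_const : ∀ c : ℝ, ∫ z, c * φ z = c := fun c => by
    rw [integral_const_mul, hφ.integral_eq_one, mul_one]
  have h_upper : radialMean φ h u ≤ h u + R * η * ‖u‖ := by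
    rw [← h_const (h u + R * η * ‖u‖)]
    exact hφ.integral_mul_mono (by fun_prop) continuous_const fun z hz => by
      linarith [(abs_le.1 (h_near z hz)).2]
  have h_lower : h u - R * η * ‖u‖ ≤ radialMean φ h u := by
    rw [← h_const (h u - R * η * ‖u‖)]
    exact hφ.integral_mul_mono continuous_const (by fun_prop) fun z hz => by
      linarith [(abs_le.1 (h_near z hz)).1]
  exact abs_sub_le_iff.2 ⟨by linarith, by linarith⟩

theorem contDiffOn_radialMean (hφ : IsRadialMollifier φ η) (hh : IsSublinear h) :
    ContDiffOn ℝ ∞ (radialMean φ h) {0}ᶜ := by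
  have h_conv : ContDiff ℝ ∞ (convolution φ h (ContinuousLinearMap.lsmul ℝ ℝ) volume) :=
    hφ.hasCompactSupport.contDiff_convolution_left _ hφ.contDiff hh.continuous.locallyIntegrable
  have h_norm : ContDiffOn ℝ ∞ (fun u : V => ‖u‖) {0}ᶜ := fun u hu =>
    (contDiffAt_norm ℝ hu).contDiffWithinAt
  have h_normalize : ContDiffOn ℝ ∞ (fun u : V => ‖u‖⁻¹ • u) {0}ᶜ :=
    (h_norm.inv fun u hu => norm_ne_zero_iff.2 hu).smul contDiffOn_id
  refine (h_norm.mul (h_conv.comp_contDiffOn h_normalize)).congr fun u hu => ?_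
  have hu_pos : 0 < ‖u‖ := norm_pos_iff.2 hu
  rw [Function.comp_apply, convolution_def, radialMean, ← hφ.integral_neg_mul,
    ← integral_const_mul]
  refine integral_congr_ae (Eventually.of_forall fun z => ?_)
  simp only [ContinuousLinearMap.lsmul_apply, smul_eq_mul]
  rw [mul_left_comm, mul_comm (φ z), ← hh.smul _ hu_pos, smul_sub, smul_smul,
    mul_inv_cancel₀ hu_pos.ne', one_smul, smul_neg, sub_eq_add_neg]

end IsRadialMollifier

theorem exists_contDiffOn_dist_lt [Nontrivial V] (K : ConstantWidthOne V) {ε : ℝ} (hε : 0 < ε) :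
    ∃ L : ConstantWidthOne V, dist L K < ε ∧ ContDiffOn ℝ ∞ (supportFn L.1) {0}ᶜ := by
  obtain ⟨R, hR⟩ := exists_lipschitzWith_supportFn K.1
  have h_tendsto : Tendsto (fun η : ℝ => 4 * R * η) (𝓝[>] 0) (𝓝 0) :=
    ((continuous_const.mul continuous_id).tendsto' 0 0 (mul_zero _)).mono_left nhdsWithin_le_nhds
  obtain ⟨η, hηε, hη_pos, hη_half⟩ := ((h_tendsto.eventually_lt_const hε).and
    (Ioo_mem_nhdsGT one_half_pos)).exists
  obtain ⟨φ, hφ⟩ := exists_isRadialMollifier (V := V) hη_pos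
  obtain ⟨e, he⟩ := exists_norm_eq V (zero_le_one (α := ℝ))
  set c : ℝ := radialMean φ norm e
  have hc_near : |c - 1| ≤ η := by
    simpa [he] using hφ.abs_radialMean_sub_le lipschitzWith_one_norm e
  have hc_half : 1 / 2 ≤ c := by linarith [(abs_le.1 hc_near).1]
  have hc_pos : 0 < c := one_half_pos.trans_le hc_half
  have h_mean := hφ.isSublinear_radialMean (isSublinear_supportFn K.1)
  obtain ⟨L, hL⟩ := IsSublinear.exists_constantWidthOne
    (h := fun u => radialMean φ (supportFn K.1) u / c)
    ⟨fun a ha u => by rw [h_mean.smul a ha, mul_div_assoc],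
      fun u v => by rw [← add_div]; exact div_le_div_of_nonneg_right (h_mean.add_le u v) hc_pos.le⟩
    fun u => by
      simp only [← add_div, hφ.radialMean_add_neg hR.continuous, K.2.supportFn_add_neg, one_mul]
      rw [hφ.radialMean_norm he, mul_div_cancel_left₀ _ hc_pos.ne']
  refine ⟨L, lt_of_le_of_lt
    (dist_le_of_abs_supportFn_sub_le _ _ (by positivity) fun u => ?_) hηε, ?_⟩
  · have h_abs : |supportFn K.1 u| ≤ R * ‖u‖ := by
      simpa [(supportFn_smul K.1).map_zero] using hR.dist_le_mul u 0
    have h_split : supportFn L.1 u - supportFn K.1 u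
        = ((radialMean φ (supportFn K.1) u - supportFn K.1 u) - (c - 1) * supportFn K.1 u) / c := by
      rw [hL]
      field_simp
      ring
    rw [h_split, abs_div, abs_of_pos hc_pos, div_le_iff₀ hc_pos]
    calc _ ≤ R * η * ‖u‖ + η * (R * ‖u‖) := by
          refine (abs_sub _ _).trans (add_le_add (hφ.abs_radialMean_sub_le hR u) ?_)
          rw [abs_mul]
          gcongr
      _ = 4 * R * η * ‖u‖ * (1 / 2) := by ring
      _ ≤ 4 * R * η * ‖u‖ * c := by gcongr
  · rw [hL]
    exact (hφ.contDiffOn_radialMean (isSublinear_supportFn K.1)).div_const c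

end Smoothing

/-! ### Calculus of second derivatives -/

section Hess

open scoped ContDiff

variable {E : Type*} [NormedAddCommGroup E] [NormedSpace ℝ E] {f g : E → ℝ} {u w : E}

theorem hess_symm (hf : ∀ᶠ v in 𝓝 u, DifferentiableAt ℝ f v)
    (hf' : DifferentiableAt ℝ (fderiv ℝ f) u) (v w : E) : hess f u v w = hess f u w v :=
  second_derivative_symmetric_of_eventually_of_real
    (hf.mono fun _ hv => hv.hasFDerivAt) hf'.hasFDerivAt v w

theorem eventually_differentiableAt (hf : ContDiffAt ℝ 2 f u) :
    ∀ᶠ v in 𝓝 u, DifferentiableAt ℝ f v :=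
  (hf.eventually (by simp)).mono fun _ hv => hv.differentiableAt two_ne_zero

theorem differentiableAt_fderiv (hf : ContDiffAt ℝ 2 f u) : DifferentiableAt ℝ (fderiv ℝ f) u :=
  (hf.fderiv_right (m := 1) le_rfl).differentiableAt one_ne_zero

theorem hess_add (hf : ContDiffAt ℝ 2 f u) (hg : ContDiffAt ℝ 2 g u) :
    hess (fun v => f v + g v) u = hess f u + hess g u := by
  have h_fderiv : fderiv ℝ (fun v => f v + g v) =ᶠ[𝓝 u] fun v => fderiv ℝ f v + fderiv ℝ g v := by
    filter_upwards [eventually_differentiableAt hf, eventually_differentiableAt hg] with v hfv hgv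
    exact fderiv_fun_add hfv hgv
  rw [hess, h_fderiv.fderiv_eq,
    fderiv_fun_add (differentiableAt_fderiv hf) (differentiableAt_fderiv hg)]
  rfl

theorem fderiv_comp_neg_eq {F : Type*} [NormedAddCommGroup F] [NormedSpace ℝ F] (f : E → F)
    (u : E) : fderiv ℝ (fun v => f (-v)) u = -fderiv ℝ f (-u) := by
  simpa only [neg_smul, one_smul] using fderiv_comp_smul (f := f) (x := u) (-1 : ℝ)

theorem hess_comp_neg (f : E → ℝ) (u : E) : hess (fun v => f (-v)) u = hess f (-u) := by
  have h_fderiv : fderiv ℝ (fun v => f (-v)) = fun v => -fderiv ℝ f (-v) :=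
    funext (fderiv_comp_neg_eq f)
  rw [hess, h_fderiv, fderiv_fun_neg, fderiv_comp_neg_eq, neg_neg, hess]

theorem hess_neg (f : E → ℝ) (u : E) : hess (fun v => -f v) u = -hess f u := by
  have h_fderiv : fderiv ℝ (fun v => -f v) = fun v => -fderiv ℝ f v :=
    funext fun v => fderiv_fun_neg
  rw [hess, h_fderiv, fderiv_fun_neg, hess]

theorem hasDerivAt_comp_add_smul {F : Type*} [NormedAddCommGroup F] [NormedSpace ℝ F] {f : E → F}
    {s : ℝ} (hf : DifferentiableAt ℝ f (u + s • w)) :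
    HasDerivAt (fun σ : ℝ => f (u + σ • w)) (fderiv ℝ f (u + s • w) w) s :=
  hf.hasFDerivAt.comp_hasDerivAt s (by simpa using ((hasDerivAt_id s).smul_const w).const_add u)

theorem hasDerivAt_fderiv_comp_add_smul {s : ℝ}
    (hf : DifferentiableAt ℝ (fderiv ℝ f) (u + s • w)) :
    HasDerivAt (fun σ : ℝ => fderiv ℝ f (u + σ • w) w) (hess f (u + s • w) w w) s :=
  (ContinuousLinearMap.apply ℝ ℝ w).hasFDerivAt.comp_hasDerivAt s (hasDerivAt_comp_add_smul hf)

theorem eventually_hasDerivAt_comp_add_smul (hf : ContDiffAt ℝ 2 f u) (w : E) :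
    ∀ᶠ s in 𝓝 (0 : ℝ),
      HasDerivAt (fun σ : ℝ => f (u + σ • w)) (fderiv ℝ f (u + s • w) w) s := by
  have h_line : Tendsto (fun s : ℝ => u + s • w) (𝓝 0) (𝓝 u) :=
    (show Continuous fun s : ℝ => u + s • w by fun_prop).tendsto' 0 u (by simp)
  exact (h_line.eventually (eventually_differentiableAt hf)).mono fun s hs =>
    hasDerivAt_comp_add_smul hs

theorem hasDerivAt_fderiv_comp_add_smul_zero (hf : ContDiffAt ℝ 2 f u) (w : E) :
    HasDerivAt (fun σ : ℝ => fderiv ℝ f (u + σ • w) w) (hess f u w w) 0 := by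
  have h_eq : u + (0 : ℝ) • w = u := by rw [zero_smul, add_zero]
  have h_deriv := hasDerivAt_fderiv_comp_add_smul (f := f) (u := u) (w := w) (s := 0)
    (h_eq.symm ▸ differentiableAt_fderiv hf)
  rwa [h_eq] at h_deriv

theorem hess_eq_of_hasDerivAt (hf : ContDiffAt ℝ 2 f u) {p : ℝ → ℝ} {c : ℝ}
    (hp : ∀ᶠ s in 𝓝 (0 : ℝ), HasDerivAt (fun σ : ℝ => f (u + σ • w)) (p s) s)
    (hc : HasDerivAt p c 0) : hess f u w w = c := by
  refine (hasDerivAt_fderiv_comp_add_smul_zero hf w).unique (hc.congr_of_eventuallyEq ?_)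
  filter_upwards [hp, eventually_hasDerivAt_comp_add_smul hf w] with s hps hfs
  exact hfs.unique hps

theorem hess_oscillation {ψ Φ : E → ℝ} (hψ : ContDiffAt ℝ 2 ψ u) (hΦ : ContDiffAt ℝ 2 Φ u)
    {N : ℝ} (hN : 0 < N) (θ : ℝ) (w : E) :
    hess (fun v => (N ^ 2)⁻¹ * (ψ v * Real.cos (N * Φ v + θ))) u w w
      = -(ψ u * (fderiv ℝ Φ u w) ^ 2 * Real.cos (N * Φ u + θ))
        + ((N ^ 2)⁻¹ * (hess ψ u w w * Real.cos (N * Φ u + θ))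
          - N⁻¹ * ((2 * (fderiv ℝ ψ u w * fderiv ℝ Φ u w) + ψ u * hess Φ u w w)
            * Real.sin (N * Φ u + θ))) := by
  have hψ_deriv := eventually_hasDerivAt_comp_add_smul hψ w
  have hΦ_deriv := eventually_hasDerivAt_comp_add_smul hΦ w
  refine hess_eq_of_hasDerivAt
    (contDiffAt_const.mul (hψ.mul ((contDiffAt_const.mul hΦ).add contDiffAt_const).cos))
    (p := fun s => (N ^ 2)⁻¹ *
      (fderiv ℝ ψ (u + s • w) w * Real.cos (N * Φ (u + s • w) + θ) + ψ (u + s • w) *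
        (-Real.sin (N * Φ (u + s • w) + θ) * (N * fderiv ℝ Φ (u + s • w) w)))) ?_ ?_
  · filter_upwards [hψ_deriv, hΦ_deriv] with s hψs hΦs
    exact (hψs.mul ((hΦs.const_mul N).add_const θ).cos).const_mul _
  · have h_phase := (hΦ_deriv.self_of_nhds.const_mul N).add_const θ
    have h_deriv := (((hasDerivAt_fderiv_comp_add_smul_zero hψ w).mul h_phase.cos).add
      (hψ_deriv.self_of_nhds.mul (h_phase.sin.neg.mul
        ((hasDerivAt_fderiv_comp_add_smul_zero hΦ w).const_mul N)))).const_mul (N ^ 2)⁻¹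
    refine h_deriv.congr_deriv ?_
    simp only [Pi.mul_apply, Pi.neg_apply, zero_smul, add_zero]
    field_simp
    ring

namespace IsPosHomogeneous

theorem fderiv_smul (hf : IsPosHomogeneous f) {c : ℝ} (hc : 0 < c) (u : E) :
    fderiv ℝ f (c • u) = fderiv ℝ f u := by
  have h_fderiv : fderiv ℝ (fun v => f (c • v)) u = c • fderiv ℝ f (c • u) := fderiv_comp_smul c
  rw [show (fun v => f (c • v)) = c • f from funext (hf c hc), fderiv_const_smul_field]
    at h_fderiv
  exact (smul_right_injective _ hc.ne' h_fderiv).symm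

theorem hess_smul (hf : IsPosHomogeneous f) {c : ℝ} (hc : 0 < c) (u : E) :
    c • hess f (c • u) = hess f u := by
  have h_hess : fderiv ℝ (fun v => fderiv ℝ f (c • v)) u = c • hess f (c • u) := fderiv_comp_smul c
  rw [← h_hess, show (fun v => fderiv ℝ f (c • v)) = fderiv ℝ f from funext (hf.fderiv_smul hc),
    hess]

theorem hess_apply_self (hf : IsPosHomogeneous f) (hf' : DifferentiableAt ℝ (fderiv ℝ f) u) :
    hess f u u = 0 := by
  have h_deriv : HasDerivAt (fun s : ℝ => fderiv ℝ f (s • u)) (hess f u u) 1 := by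
    have h_fderiv : HasFDerivAt (fderiv ℝ f) (hess f u) ((1 : ℝ) • u) := by
      rw [one_smul]
      exact hf'.hasFDerivAt
    exact h_fderiv.comp_hasDerivAt 1 (by simpa using (hasDerivAt_id (1 : ℝ)).smul_const u)
  have h_const : (fun s : ℝ => fderiv ℝ f (s • u)) =ᶠ[𝓝 1] fun _ => fderiv ℝ f u :=
    (lt_mem_nhds one_pos).mono fun s hs => hf.fderiv_smul hs u
  exact h_deriv.unique ((hasDerivAt_const (1 : ℝ) (fderiv ℝ f u)).congr_of_eventuallyEq h_const)

theorem add_le_of_zero_mem_segment (hf : IsPosHomogeneous f) (hf_neg : ∀ u, 0 ≤ f u + f (-u))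
    {a b : E} (h_zero : (0 : E) ∈ segment ℝ a b) : f (a + b) ≤ f a + f b := by
  rw [mem_segment_iff_sameRay, zero_sub, sub_zero] at h_zero
  obtain ⟨p, q, hp, hq, -, ha, hb⟩ := h_zero.exists_eq_smul_add
  set e := -a + b
  rw [neg_eq_iff_eq_neg, ← smul_neg] at ha
  have h_sum := hf_neg e
  rw [ha, hb, hf.smul_of_nonneg hp, hf.smul_of_nonneg hq]
  rcases le_total p q with hpq | hpq
  · rw [show p • -e + q • e = (q - p) • e by module, hf.smul_of_nonneg (sub_nonneg.2 hpq)]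
    nlinarith
  · rw [show p • -e + q • e = (p - q) • -e by module, hf.smul_of_nonneg (sub_nonneg.2 hpq)]
    nlinarith

theorem add_le_of_zero_notMem_segment (hf : IsPosHomogeneous f) (hf_smooth : ContDiffOn ℝ 2 f {0}ᶜ)
    (hf_hess : ∀ u w, u ≠ 0 → 0 ≤ hess f u w w) {a b : E} (h_zero : (0 : E) ∉ segment ℝ a b) :
    f (a + b) ≤ f a + f b := by
  have h_smooth : ∀ u : E, u ≠ 0 → ContDiffAt ℝ 2 f u := fun u hu =>
    hf_smooth.contDiffAt (isOpen_compl_singleton.mem_nhds hu)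
  have h_ne : ∀ s ∈ Set.Icc (0 : ℝ) 1, a + s • (b - a) ≠ 0 := fun s hs h_eq =>
    h_zero ⟨1 - s, s, sub_nonneg.2 hs.2, hs.1, sub_add_cancel 1 s, by rw [← h_eq]; module⟩
  have h_deriv : ∀ s ∈ Set.Icc (0 : ℝ) 1, HasDerivAt (fun s => f (a + s • (b - a)))
      (fderiv ℝ f (a + s • (b - a)) (b - a)) s := fun s hs =>
    hasDerivAt_comp_add_smul ((h_smooth _ (h_ne s hs)).differentiableAt two_ne_zero)
  have h_convex : ConvexOn ℝ (Set.Icc (0 : ℝ) 1) fun s => f (a + s • (b - a)) :=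
    convexOn_of_hasDerivWithinAt2_nonneg (convex_Icc 0 1)
      (fun s hs => (h_deriv s hs).continuousAt.continuousWithinAt)
      (fun s hs => (h_deriv s (interior_subset hs)).hasDerivWithinAt)
      (fun s hs => (hasDerivAt_fderiv_comp_add_smul
        (differentiableAt_fderiv (h_smooth _ (h_ne s (interior_subset hs))))).hasDerivWithinAt)
      fun s hs => hf_hess _ _ (h_ne s (interior_subset hs))
  have h_mid := h_convex.2 (Set.left_mem_Icc.2 zero_le_one) (Set.right_mem_Icc.2 zero_le_one)
    one_half_pos.le one_half_pos.le (add_halves 1)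
  simp only [smul_eq_mul, mul_zero, mul_one, zero_add, zero_smul, add_zero, one_smul,
    add_sub_cancel] at h_mid
  rw [show a + (1 / 2 : ℝ) • (b - a) = (1 / 2 : ℝ) • (a + b) by module,
    hf _ one_half_pos] at h_mid
  linarith

end IsPosHomogeneous

theorem IsPosHomogeneous.hess_nonneg {f : V → ℝ} (hf : IsPosHomogeneous f)
    (hf_smooth : ContDiffOn ℝ 2 f {0}ᶜ)
    (hf_hess : ∀ u w, ‖u‖ = 1 → inner ℝ w u = 0 → 0 ≤ hess f u w w) (u w : V) (hu : u ≠ 0) :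
    0 ≤ hess f u w w := by
  have hu_pos : 0 < ‖u‖ := norm_pos_iff.2 hu
  set v := ‖u‖⁻¹ • u with hv
  have hv_norm : ‖v‖ = 1 := norm_smul_inv_norm hu
  have hv_smooth : ContDiffAt ℝ 2 f v :=
    hf_smooth.contDiffAt (isOpen_compl_singleton.mem_nhds (ne_zero_of_norm_eq_one hv_norm))
  have h_scale : ‖u‖ * hess f u w w = hess f v w w := by
    rw [← hf.hess_smul hu_pos v, hv, smul_inv_smul₀ hu_pos.ne']
    rfl
  have h_radial := hf.hess_apply_self (differentiableAt_fderiv hv_smooth)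
  have h_radial_right : ∀ z, hess f v z v = 0 := fun z => by
    rw [hess_symm (eventually_differentiableAt hv_smooth) (differentiableAt_fderiv hv_smooth),
      h_radial]
    rfl
  have h_tangential := hf_hess v (w - inner ℝ w v • v) hv_norm (by
    rw [inner_sub_left, real_inner_smul_left, real_inner_self_eq_norm_sq, hv_norm]
    ring)
  simp only [map_sub, map_smul, h_radial, h_radial_right, smul_zero, sub_zero] at h_tangential
  exact nonneg_of_mul_nonneg_right (h_scale ▸ h_tangential) hu_pos

theorem IsPosHomogeneous.isSublinear_of_hess_nonneg {f : V → ℝ} (hf : IsPosHomogeneous f)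
    (hf_smooth : ContDiffOn ℝ 2 f {0}ᶜ) (hf_neg : ∀ u, 0 ≤ f u + f (-u))
    (hf_hess : ∀ u w, ‖u‖ = 1 → inner ℝ w u = 0 → 0 ≤ hess f u w w) : IsSublinear f := by
  refine ⟨hf, fun a b => ?_⟩
  by_cases h_zero : (0 : V) ∈ segment ℝ a b
  · exact hf.add_le_of_zero_mem_segment hf_neg h_zero
  · exact hf.add_le_of_zero_notMem_segment hf_smooth (hf.hess_nonneg hf_smooth hf_hess) h_zero

end Hess

/-! ### The product of the radii of curvature -/

section SecondDerivative

theorem IsSublinear.hess_nonneg {h : V → ℝ} (hh : IsSublinear h) {u : V}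
    (hu : ∀ᶠ v in 𝓝 u, DifferentiableAt ℝ h v) (hu' : DifferentiableAt ℝ (fderiv ℝ h) u) (w : V) :
    0 ≤ hess h u w w :=
  ge_of_tendsto' (tendsto_secondDiff hu hu' w) fun k => hh.secondDiff_nonneg w k u

namespace HasConstantWidth

variable {K : ConvexBody V} {d : ℝ} {u : V}

theorem hess_supportFn_nonneg (hK : HasConstantWidth K d) (hu : u ≠ 0)
    (hu' : DifferentiableAt ℝ (fderiv ℝ (supportFn K)) u) (w : V) : 0 ≤ hess (supportFn K) u w w :=
  (isSublinear_supportFn K).hess_nonneg (hK.eventually_differentiableAt_supportFn hu) hu' w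

theorem hess_supportFn_le (hK : HasConstantWidth K d) (hu : u ≠ 0)
    (hu' : DifferentiableAt ℝ (fderiv ℝ (supportFn K)) u) (w : V) :
    hess (supportFn K) u w w ≤ d * (‖w‖ ^ 2 / ‖u‖) :=
  le_of_tendsto' (tendsto_secondDiff (hK.eventually_differentiableAt_supportFn hu) hu' w)
    fun k => hK.secondDiff_supportFn_le w k hu

theorem hess_supportFn_symm (hK : HasConstantWidth K d) (hu : u ≠ 0)
    (hu' : DifferentiableAt ℝ (fderiv ℝ (supportFn K)) u) (v w : V) :
    hess (supportFn K) u v w = hess (supportFn K) u w v :=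
  hess_symm (hK.eventually_differentiableAt_supportFn hu) hu' v w

theorem hess_supportFn_sq_le (hK : HasConstantWidth K d) (hu : u ≠ 0)
    (hu' : DifferentiableAt ℝ (fderiv ℝ (supportFn K)) u) (v w : V) :
    hess (supportFn K) u v w ^ 2 ≤ hess (supportFn K) u v v * hess (supportFn K) u w w :=
  LinearMap.BilinForm.apply_sq_le_of_symm (hess (supportFn K) u).toLinearMap₁₂
    (hK.hess_supportFn_nonneg hu hu') ⟨hK.hess_supportFn_symm hu hu'⟩ v w

end HasConstantWidth

end SecondDerivative

section Determinant

open scoped ContDiff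

theorem contDiffOn_norm_compl_zero : ContDiffOn ℝ ∞ (fun u : V => ‖u‖) {0}ᶜ := fun _ hu =>
  (contDiffAt_norm ℝ hu).contDiffWithinAt

variable [FiniteDimensional ℝ V]

theorem det_bounds_of_inner_apply_self_mem_Icc {T : V →ₗ[ℝ] V} (hT : T.IsSymmetric)
    (hT_nonneg : ∀ w, 0 ≤ inner ℝ (T w) w) (hT_le : ∀ w, inner ℝ (T w) w ≤ ‖w‖ ^ 2) :
    0 ≤ LinearMap.det T ∧ LinearMap.det T ≤ 1 ∧
      ∀ w, LinearMap.det T * ‖w‖ ^ 2 ≤ inner ℝ (T w) w := by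
  set μ := hT.eigenvalues rfl
  set v := hT.eigenvectorBasis rfl
  have h_eigen : ∀ i, T (v i) = μ i • v i := hT.apply_eigenvectorBasis rfl
  have h_inner : ∀ i, inner ℝ (T (v i)) (v i) = μ i := fun i => by
    rw [h_eigen, real_inner_smul_left, real_inner_self_eq_norm_sq, v.norm_eq_one, one_pow, mul_one]
  have hμ_nonneg : ∀ i, 0 ≤ μ i := fun i => h_inner i ▸ hT_nonneg (v i)
  have hμ_le : ∀ i, μ i ≤ 1 := fun i => by
    simpa only [h_inner, v.norm_eq_one, one_pow] using hT_le (v i)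
  have h_det : LinearMap.det T = ∏ i, μ i := by simpa using hT.det_eq_prod_eigenvalues rfl
  have h_det_le : ∀ i, LinearMap.det T ≤ μ i := fun i => by
    rw [h_det, ← Finset.mul_prod_erase _ _ (Finset.mem_univ i)]
    exact mul_le_of_le_one_right (hμ_nonneg i)
      (Finset.prod_le_one (fun j _ => hμ_nonneg j) fun j _ => hμ_le j)
  refine ⟨h_det ▸ Finset.prod_nonneg fun i _ => hμ_nonneg i,
    h_det ▸ Finset.prod_le_one (fun i _ => hμ_nonneg i) fun i _ => hμ_le i, fun w => ?_⟩
  calc LinearMap.det T * ‖w‖ ^ 2 = ∑ i, LinearMap.det T * inner ℝ w (v i) ^ 2 := by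
        rw [← v.sum_sq_inner_left, Finset.mul_sum]
    _ ≤ ∑ i, μ i * inner ℝ w (v i) ^ 2 :=
        Finset.sum_le_sum fun i _ => mul_le_mul_of_nonneg_right (h_det_le i) (sq_nonneg _)
    _ = inner ℝ (T w) w := by
        rw [← v.sum_inner_mul_inner (T w) w]
        refine Finset.sum_congr rfl fun i _ => ?_
        rw [hT w (v i), h_eigen, inner_smul_right, real_inner_comm w (v i)]
        ring

/-- The operator associated with the bilinear form `‖u‖ A`, extended by the identity in the
direction of `u`. -/
def curvatureOp (A : V →L[ℝ] V →L[ℝ] ℝ) (u : V) : V →ₗ[ℝ] V where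
  toFun w := ‖u‖ • (InnerProductSpace.toDual ℝ V).symm (A w) + ((‖u‖ ^ 2)⁻¹ * inner ℝ u w) • u
  map_add' v w := by
    simp only [map_add, inner_add_right]
    module
  map_smul' c w := by
    simp only [map_smulₛₗ, inner_smul_right, RingHom.id_apply, conj_trivial]
    module

theorem inner_curvatureOp (A : V →L[ℝ] V →L[ℝ] ℝ) (u v w : V) :
    inner ℝ (curvatureOp A u v) w = ‖u‖ * A v w + (‖u‖ ^ 2)⁻¹ * inner ℝ u v * inner ℝ u w := by
  change inner ℝ (_ • _ + _ • _) w = _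
  rw [inner_add_left, real_inner_smul_left, real_inner_smul_left,
    InnerProductSpace.toDual_symm_apply]

theorem curvatureOp_smul_right (A : V →L[ℝ] V →L[ℝ] ℝ) {c : ℝ} (hc : 0 < c) (u : V) :
    curvatureOp A (c • u) = curvatureOp (c • A) u := by
  refine LinearMap.ext fun v => ext_inner_right ℝ fun w => ?_
  rw [inner_curvatureOp, inner_curvatureOp, norm_smul, Real.norm_of_nonneg hc.le,
    real_inner_smul_left, real_inner_smul_left]
  simp only [smul_apply, smul_eq_mul]
  field_simp

theorem inner_curvatureOp_le {A : V →L[ℝ] V →L[ℝ] ℝ} {u : V} (hu : u ≠ 0)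
    (hA_symm : ∀ v w, A v w = A w v) (hA_radial : A u = 0) (hA_le : ∀ w, A w w ≤ ‖w‖ ^ 2 / ‖u‖)
    (w : V) : inner ℝ (curvatureOp A u w) w ≤ ‖w‖ ^ 2 := by
  have hu_pos : 0 < ‖u‖ := norm_pos_iff.2 hu
  set w' := w - ((‖u‖ ^ 2)⁻¹ * inner ℝ u w) • u with hw'
  have hw'_apply : A w' w' = A w w := by
    simp only [hw', map_sub, map_smul, hA_radial, hA_symm _ u, smul_zero, sub_zero, zero_apply]
  have hw'_norm : ‖w‖ ^ 2 = ‖w'‖ ^ 2 + (‖u‖ ^ 2)⁻¹ * inner ℝ u w * inner ℝ u w := by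
    rw [hw', norm_sub_sq_real, inner_smul_right, real_inner_comm u w, norm_smul, mul_pow,
      Real.norm_eq_abs, sq_abs]
    field_simp
    ring
  have h_le := hA_le w'
  rw [hw'_apply, le_div_iff₀' hu_pos] at h_le
  rw [inner_curvatureOp, hw'_norm]
  linarith

/-- The determinant of the second derivative of `f` on the orthogonal complement of `u`, multiplied
by `‖u‖` in each direction. For a support function `f` it is the product of the principal radii of
curvature. -/
def curvatureDet (f : V → ℝ) (u : V) : ℝ := LinearMap.det (curvatureOp (hess f u) u)

theorem curvatureDet_eq_det_matrix {ι : Type*} [Fintype ι] [DecidableEq ι]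
    (b : OrthonormalBasis ι ℝ V) (f : V → ℝ) (u : V) :
    curvatureDet f u = (Matrix.of fun i j =>
      ‖u‖ * hess f u (b j) (b i) + (‖u‖ ^ 2)⁻¹ * inner ℝ u (b j) * inner ℝ u (b i)).det := by
  rw [curvatureDet, ← LinearMap.det_toMatrix b.toBasis]
  congr 1
  ext i j
  rw [LinearMap.toMatrix_apply, OrthonormalBasis.coe_toBasis,
    OrthonormalBasis.coe_toBasis_repr_apply, OrthonormalBasis.repr_apply_apply, real_inner_comm,
    inner_curvatureOp]
  rfl

theorem tendsto_curvatureDet {ι κ : Type*} [Fintype ι] (b : OrthonormalBasis ι ℝ V)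
    {l : Filter κ} {f : κ → V → ℝ} {g : V → ℝ} {u : V} (h_tendsto : ∀ i j,
      Tendsto (fun k => hess (f k) u (b i) (b j)) l (𝓝 (hess g u (b i) (b j)))) :
    Tendsto (fun k => curvatureDet (f k) u) l (𝓝 (curvatureDet g u)) := by
  classical
  simp only [curvatureDet_eq_det_matrix b, Matrix.det_apply, Matrix.of_apply]
  exact tendsto_finsetSum _ fun σ _ => (tendsto_finsetProd _ fun i _ =>
    ((h_tendsto _ _).const_mul _).add_const _).const_smul _

theorem IsPosHomogeneous.curvatureDet_smul {f : V → ℝ} (hf : IsPosHomogeneous f) {c : ℝ}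
    (hc : 0 < c) (u : V) : curvatureDet f (c • u) = curvatureDet f u := by
  rw [curvatureDet, curvatureOp_smul_right _ hc, hf.hess_smul hc, curvatureDet]

theorem contDiffOn_curvatureDet {f : V → ℝ} (hf : ContDiffOn ℝ ∞ f {0}ᶜ) :
    ContDiffOn ℝ ∞ (curvatureDet f) {0}ᶜ := by
  have h_fderiv : ContDiffOn ℝ ∞ (fderiv ℝ f) {0}ᶜ :=
    hf.fderiv_of_isOpen isOpen_compl_singleton (by simp)
  have h_hess : ContDiffOn ℝ ∞ (hess f) {0}ᶜ :=
    h_fderiv.fderiv_of_isOpen isOpen_compl_singleton (by simp)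
  have h_inner : ∀ b : V, ContDiffOn ℝ ∞ (fun u : V => inner ℝ u b) {0}ᶜ := fun b =>
    (contDiff_id.inner ℝ contDiff_const).contDiffOn
  have h_inv : ContDiffOn ℝ ∞ (fun u : V => (‖u‖ ^ 2)⁻¹) {0}ᶜ :=
    (contDiffOn_norm_compl_zero.pow 2).inv fun u hu =>
      pow_ne_zero 2 (norm_ne_zero_iff.2 (Set.mem_compl_singleton_iff.1 hu))
  have h_entry : ∀ a b : V, ContDiffOn ℝ ∞ (fun u =>
      ‖u‖ * hess f u a b + (‖u‖ ^ 2)⁻¹ * inner ℝ u a * inner ℝ u b) {0}ᶜ := fun a b =>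
    (contDiffOn_norm_compl_zero.mul
      ((h_hess.clm_apply contDiffOn_const).clm_apply contDiffOn_const)).add
      ((h_inv.mul (h_inner a)).mul (h_inner b))
  refine ContDiffOn.congr ?_ fun u _ => curvatureDet_eq_det_matrix (stdOrthonormalBasis ℝ V) f u
  simp only [Matrix.det_apply, Matrix.of_apply]
  exact ContDiffOn.sum fun σ _ => (contDiffOn_prod fun i _ => h_entry _ _).const_smul _

theorem curvatureDet_supportFn_bounds (K : ConstantWidthOne V) {u : V} (hu : u ≠ 0)
    (hu' : DifferentiableAt ℝ (fderiv ℝ (supportFn K.1)) u) :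
    0 ≤ curvatureDet (supportFn K.1) u ∧ curvatureDet (supportFn K.1) u ≤ 1 ∧
      ∀ w, inner ℝ u w = 0 →
        curvatureDet (supportFn K.1) u * ‖w‖ ^ 2 ≤ ‖u‖ * hess (supportFn K.1) u w w := by
  set A := hess (supportFn K.1) u
  have hA_symm : ∀ v w, A v w = A w v := K.2.hess_supportFn_symm hu hu'
  have h_bounds := det_bounds_of_inner_apply_self_mem_Icc (T := curvatureOp A u)
    (fun v w => by
      rw [inner_curvatureOp, real_inner_comm (curvatureOp A u w), inner_curvatureOp, hA_symm v w]
      ring)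
    (fun w => by
      rw [inner_curvatureOp, mul_assoc]
      have := K.2.hess_supportFn_nonneg hu hu' w
      have := mul_self_nonneg (inner ℝ u w)
      positivity)
    (inner_curvatureOp_le hu hA_symm ((supportFn_smul K.1).hess_apply_self hu') fun w => by
      simpa only [one_mul] using K.2.hess_supportFn_le hu hu' w)
  refine ⟨h_bounds.1, h_bounds.2.1, fun w hw => ?_⟩
  simpa only [curvatureDet, A, inner_curvatureOp, hw, mul_zero, add_zero] using h_bounds.2.2 w

end Determinant

/-! ### Oscillating perturbations -/

section NormedSpace

variable {E : Type*} [NormedAddCommGroup E] [NormedSpace ℝ E]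

theorem hess_const_mul (c : ℝ) (f : E → ℝ) (u : E) : hess (fun v => c * f v) u = c • hess f u := by
  have h_fderiv : fderiv ℝ (fun v => c * f v) = c • fderiv ℝ f :=
    fderiv_const_smul_field (f := f) c
  rw [hess, h_fderiv]
  exact congrFun (fderiv_const_smul_field (f := fderiv ℝ f) c) u

end NormedSpace

open scoped ContDiff

theorem contDiffAt_two_of_contDiffOn {f : V → ℝ} (hf : ContDiffOn ℝ ∞ f {0}ᶜ) {u : V}
    (hu : u ≠ 0) : ContDiffAt ℝ 2 f u :=
  (hf.contDiffAt (isOpen_compl_singleton.mem_nhds hu)).of_le (by norm_cast)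

theorem differentiableAt_fderiv_of_contDiffOn {f : V → ℝ} (hf : ContDiffOn ℝ ∞ f {0}ᶜ) {u : V}
    (hu : u ≠ 0) : DifferentiableAt ℝ (fderiv ℝ f) u :=
  differentiableAt_fderiv (contDiffAt_two_of_contDiffOn hf hu)

theorem hess_norm {u w : V} (hu : u ≠ 0) (hw : inner ℝ w u = 0) :
    hess (fun v : V => ‖v‖) u w w = ‖w‖ ^ 2 / ‖u‖ := by
  have : 0 < ‖u‖ := norm_pos_iff.2 hu
  have h_inner : ∀ s : ℝ, inner ℝ (u + s • w) w = s * ‖w‖ ^ 2 := fun s => by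
    rw [inner_add_left, real_inner_comm, hw, real_inner_smul_left, real_inner_self_eq_norm_sq,
      zero_add]
  have h_norm_sq : ∀ s : ℝ, ‖u + s • w‖ ^ 2 = ‖u‖ ^ 2 + s ^ 2 * ‖w‖ ^ 2 := fun s => by
    rw [norm_add_sq_real, inner_smul_right, real_inner_comm, hw, norm_smul, mul_pow,
      Real.norm_eq_abs, sq_abs]
    ring
  have h_deriv : ∀ s : ℝ,
      HasDerivAt (fun σ : ℝ => ‖u + σ • w‖) (s * ‖w‖ ^ 2 / ‖u + s • w‖) s := fun s => by
    have h_line : HasDerivAt (fun σ : ℝ => u + σ • w) w s := by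
      simpa only [id_eq, one_smul] using ((hasDerivAt_id s).smul_const w).const_add u
    have h_ne : ‖u + s • w‖ ^ 2 ≠ 0 := by
      rw [h_norm_sq]
      positivity
    have h_sqrt := h_line.norm_sq.sqrt h_ne
    simp only [Real.sqrt_sq (norm_nonneg _), h_inner] at h_sqrt
    exact h_sqrt.congr_deriv (mul_div_mul_left _ _ two_ne_zero)
  refine hess_eq_of_hasDerivAt (contDiffAt_norm ℝ hu) (.of_forall h_deriv) ?_
  have h_zero : u + (0 : ℝ) • w = u := by rw [zero_smul, add_zero]
  refine (((hasDerivAt_id (0 : ℝ)).mul_const (‖w‖ ^ 2)).div (h_deriv 0)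
    (by rwa [h_zero, norm_ne_zero_iff])).congr_deriv ?_
  simp only [h_zero, id_eq]
  field_simp
  ring

/-- The second derivative of `f` is at least `δ` in the tangential directions at unit vectors. For
a support function this is a lower bound for the radii of curvature. -/
def TangentiallyStronglyConvex (f : V → ℝ) (δ : ℝ) : Prop :=
  ∀ u w : V, ‖u‖ = 1 → inner ℝ w u = 0 → δ * ‖w‖ ^ 2 ≤ hess f u w w

theorem tangentiallyStronglyConvex_add_norm {f : V → ℝ} (hf : IsSublinear f)
    (hf_smooth : ContDiffOn ℝ ∞ f {0}ᶜ) {a : ℝ} (ha : 0 ≤ a) (b : ℝ) :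
    TangentiallyStronglyConvex (fun u => a * f u + b * ‖u‖) b := fun u w hu hw => by
  have hu_ne := ne_zero_of_norm_eq_one hu
  have hf_at := contDiffAt_two_of_contDiffOn hf_smooth hu_ne
  have hf_hess : 0 ≤ hess f u w w :=
    hf.hess_nonneg (eventually_differentiableAt hf_at) (differentiableAt_fderiv hf_at) w
  rw [hess_add (contDiffAt_const.mul hf_at) (contDiffAt_const.mul (contDiffAt_norm ℝ hu_ne)),
    hess_const_mul, hess_const_mul]
  simp only [add_apply, smul_apply, smul_eq_mul, hess_norm hu_ne hw, hu, div_one]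
  exact le_add_of_nonneg_left (mul_nonneg ha hf_hess)

theorem exists_stronglyConvex_dist_lt [FiniteDimensional ℝ V] [MeasurableSpace V] [BorelSpace V]
    [Nontrivial V] (K : ConstantWidthOne V) {ε : ℝ} (hε : 0 < ε) :
    ∃ L : ConstantWidthOne V, dist L K < ε ∧ ContDiffOn ℝ ∞ (supportFn L.1) {0}ᶜ ∧
      ∃ δ > 0, TangentiallyStronglyConvex (supportFn L.1) δ := by
  obtain ⟨K', hK'_dist, hK'_smooth⟩ := exists_contDiffOn_dist_lt K (half_pos hε)
  obtain ⟨δ, hδ, L, hL_dist, hL⟩ := exists_mix_ball_dist_lt K' (half_pos hε)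
  refine ⟨L, by linarith [dist_triangle L K' K], ?_, δ / 2, half_pos hδ.1, ?_⟩
  · rw [hL]
    exact (contDiffOn_const.mul hK'_smooth).add (contDiffOn_const.mul contDiffOn_norm_compl_zero)
  · rw [hL]
    exact tangentiallyStronglyConvex_add_norm (isSublinear_supportFn K'.1) hK'_smooth
      (sub_nonneg.2 hδ.2.le) _

theorem abs_hess_oscillation_add_le {ψ Φ : V → ℝ} {u : V} (hψ : ContDiffAt ℝ 2 ψ u)
    (hΦ : ContDiffAt ℝ 2 Φ u) {a b : ℝ} (ha : |ψ u| ≤ a) (ha' : ‖fderiv ℝ ψ u‖ ≤ a)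
    (ha'' : ‖hess ψ u‖ ≤ a) (hb' : ‖fderiv ℝ Φ u‖ ≤ b) (hb'' : ‖hess Φ u‖ ≤ b) {N : ℝ}
    (hN : 1 ≤ N) (θ : ℝ) (w : V) :
    |hess (fun v => (N ^ 2)⁻¹ * (ψ v * Real.cos (N * Φ v + θ))) u w w
      + ψ u * (fderiv ℝ Φ u w) ^ 2 * Real.cos (N * Φ u + θ)| 
        ≤ N⁻¹ * ((a + 3 * (a * b)) * ‖w‖ ^ 2) := by
  have hN_pos : 0 < N := one_pos.trans_le hN
  have ha_nonneg : 0 ≤ a := (abs_nonneg _).trans ha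
  have : 0 ≤ b := (norm_nonneg _).trans hb'
  have h_le : ∀ (l : V →L[ℝ] ℝ) (x : ℝ), ‖l‖ ≤ x → |l w| ≤ x * ‖w‖ := fun l x hl =>
    l.le_of_opNorm_le hl w
  have h_le₂ : ∀ (B : V →L[ℝ] V →L[ℝ] ℝ) (x : ℝ), ‖B‖ ≤ x → |B w w| ≤ x * ‖w‖ ^ 2 :=
    fun B x hB => by
      rw [sq, ← mul_assoc]
      exact h_le _ _ (B.le_of_opNorm_le hB w)
  have h_cos_term : |(N ^ 2)⁻¹ * (hess ψ u w w * Real.cos (N * Φ u + θ))|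
      ≤ N⁻¹ * (a * ‖w‖ ^ 2) := by
    rw [abs_mul, abs_mul, abs_of_pos (by positivity : 0 < (N ^ 2)⁻¹)]
    have : (N ^ 2)⁻¹ ≤ N⁻¹ := inv_anti₀ hN_pos (by nlinarith)
    refine mul_le_mul this ?_ (by positivity) (by positivity)
    exact (mul_le_of_le_one_right (abs_nonneg _) (Real.abs_cos_le_one _)).trans (h_le₂ _ _ ha'')
  have h_sin_term : |N⁻¹ * ((2 * (fderiv ℝ ψ u w * fderiv ℝ Φ u w) + ψ u * hess Φ u w w)
      * Real.sin (N * Φ u + θ))| ≤ N⁻¹ * (3 * (a * b) * ‖w‖ ^ 2) := by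
    rw [abs_mul, abs_mul, abs_of_pos (by positivity : 0 < N⁻¹)]
    refine mul_le_mul_of_nonneg_left ?_ (by positivity)
    refine (mul_le_of_le_one_right (abs_nonneg _) (Real.abs_sin_le_one _)).trans ?_
    calc |2 * (fderiv ℝ ψ u w * fderiv ℝ Φ u w) + ψ u * hess Φ u w w|
        ≤ 2 * (|fderiv ℝ ψ u w| * |fderiv ℝ Φ u w|) + |ψ u| * |hess Φ u w w| := by
          refine (abs_add_le _ _).trans_eq ?_
          rw [abs_mul, abs_mul, abs_mul, abs_two]
      _ ≤ 2 * (a * ‖w‖ * (b * ‖w‖)) + a * (b * ‖w‖ ^ 2) := by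
          gcongr <;> [exact h_le _ _ ha'; exact h_le _ _ hb'; exact h_le₂ _ _ hb'']
      _ = 3 * (a * b) * ‖w‖ ^ 2 := by ring
  rw [hess_oscillation hψ hΦ hN_pos θ w, neg_add_eq_sub, sub_add_cancel]
  refine (abs_sub _ _).trans ((add_le_add h_cos_term h_sin_term).trans_eq ?_)
  ring

theorem exists_forall_annulus_bound [FiniteDimensional ℝ V] {f : V → ℝ}
    (hf : ContDiffOn ℝ ∞ f {0}ᶜ) :
    ∃ C, ∀ u ∈ annulus V, |f u| ≤ C ∧ ‖fderiv ℝ f u‖ ≤ C ∧ ‖hess f u‖ ≤ C := by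
  have h_subset : annulus V ⊆ {0}ᶜ := fun u hu => ne_zero_of_mem_annulus hu
  have hf' : ContDiffOn ℝ ∞ (fderiv ℝ f) {0}ᶜ :=
    hf.fderiv_of_isOpen isOpen_compl_singleton (by simp)
  have hf'' : ContDiffOn ℝ ∞ (hess f) {0}ᶜ :=
    hf'.fderiv_of_isOpen isOpen_compl_singleton (by simp)
  obtain ⟨a, ha⟩ := isCompact_annulus.exists_bound_of_continuousOn (hf.continuousOn.mono h_subset)
  obtain ⟨b, hb⟩ := isCompact_annulus.exists_bound_of_continuousOn (hf'.continuousOn.mono h_subset)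
  obtain ⟨c, hc⟩ := isCompact_annulus.exists_bound_of_continuousOn (E := V →L[ℝ] V →L[ℝ] ℝ)
    (hf''.continuousOn.mono h_subset)
  exact ⟨max a (max b c), fun u hu => ⟨(ha u hu).trans (le_max_left _ _),
    (hb u hu).trans (le_max_of_le_right (le_max_left _ _)),
    (hc u hu).trans (le_max_of_le_right (le_max_right _ _))⟩⟩

section Perturbation

open scoped ContDiff

section Phase

theorem contDiffOn_comp_neg {f : V → ℝ} (hf : ContDiffOn ℝ ∞ f {0}ᶜ) :
    ContDiffOn ℝ ∞ (fun v => f (-v)) {0}ᶜ :=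
  hf.comp contDiff_neg.contDiffOn fun _ hv => neg_ne_zero.2 hv

/-- The phase of the oscillation: the derivative in direction `t` of the reflection of `f`. -/
def phase (f : V → ℝ) (t v : V) : ℝ := fderiv ℝ (fun x => f (-x)) v t

theorem contDiffOn_phase {f : V → ℝ} (hf : ContDiffOn ℝ ∞ f {0}ᶜ) (t : V) :
    ContDiffOn ℝ ∞ (phase f t) {0}ᶜ :=
  ((contDiffOn_comp_neg hf).fderiv_of_isOpen isOpen_compl_singleton (by simp)).clm_apply
    contDiffOn_const

theorem fderiv_phase {f : V → ℝ} (hf : ContDiffOn ℝ ∞ f {0}ᶜ) (t : V) {u : V} (hu : u ≠ 0)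
    (w : V) : fderiv ℝ (phase f t) u w = hess f (-u) w t := by
  have h_fderiv : HasFDerivAt (phase f t) _ u :=
    (ContinuousLinearMap.apply ℝ ℝ t).hasFDerivAt.comp u
      (differentiableAt_fderiv_of_contDiffOn (contDiffOn_comp_neg hf) hu).hasFDerivAt
  rw [h_fderiv.fderiv, ← hess_comp_neg]
  rfl

theorem IsPosHomogeneous.phase_smul {f : V → ℝ} (hf : IsPosHomogeneous f) (t : V) {c : ℝ}
    (hc : 0 < c) (u : V) : phase f t (c • u) = phase f t u := by
  have hf_neg : IsPosHomogeneous fun v => f (-v) := fun c hc v =>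
    (congrArg f (smul_neg c v).symm).trans (hf c hc (-v))
  rw [phase, hf_neg.fderiv_smul hc, phase]

end Phase

variable [FiniteDimensional ℝ V]

/-- The amplitude of the oscillation. It vanishes outside the half-space of directions with positive
inner product with `e`, so that an oscillation and its reflection do not interfere, and the factor
`curvatureDet f` keeps the oscillation below the second derivative of `f`. -/
def amplitude (f : V → ℝ) (e u : V) : ℝ :=
  1 / 4 * (Real.smoothTransition (inner ℝ u e / ‖u‖) * (‖u‖ * curvatureDet f u))

theorem contDiffOn_amplitude {f : V → ℝ} (hf : ContDiffOn ℝ ∞ f {0}ᶜ) (e : V) :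
    ContDiffOn ℝ ∞ (amplitude f e) {0}ᶜ := by
  have h_div : ContDiffOn ℝ ∞ (fun u : V => inner ℝ u e / ‖u‖) {0}ᶜ :=
    (contDiff_id.inner ℝ contDiff_const).contDiffOn.div contDiffOn_norm_compl_zero
      fun _ hu => norm_ne_zero_iff.2 hu
  exact contDiffOn_const.mul ((Real.smoothTransition.contDiff.comp_contDiffOn h_div).mul
    (contDiffOn_norm_compl_zero.mul (contDiffOn_curvatureDet hf)))

theorem isPosHomogeneous_amplitude {f : V → ℝ} (hf : IsPosHomogeneous f) (e : V) :
    IsPosHomogeneous (amplitude f e) := fun c hc u => by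
  rw [amplitude, amplitude, hf.curvatureDet_smul hc, norm_smul, Real.norm_of_nonneg hc.le,
    real_inner_smul_left, mul_div_mul_left _ _ hc.ne']
  ring

theorem amplitude_eq_zero (f : V → ℝ) {e u : V} (hu : inner ℝ u e ≤ 0) : amplitude f e u = 0 := by
  rw [amplitude, Real.smoothTransition.zero_of_nonpos
    (div_nonpos_of_nonpos_of_nonneg hu (norm_nonneg u)), zero_mul, mul_zero]

/-- The oscillation of frequency `N` whose odd part is added to the support function `f`. -/
def oscillation (f : V → ℝ) (e t : V) (N θ : ℝ) (v : V) : ℝ :=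
  (N ^ 2)⁻¹ * (amplitude f e v * Real.cos (N * phase f t v + θ))

theorem contDiffOn_oscillation {f : V → ℝ} (hf : ContDiffOn ℝ ∞ f {0}ᶜ) (e t : V) (N θ : ℝ) :
    ContDiffOn ℝ ∞ (oscillation f e t N θ) {0}ᶜ :=
  contDiffOn_const.mul ((contDiffOn_amplitude hf e).mul
    ((contDiffOn_const.mul (contDiffOn_phase hf t)).add contDiffOn_const).cos)

theorem isPosHomogeneous_oscillation {f : V → ℝ} (hf : IsPosHomogeneous f) (e t : V)
    (N θ : ℝ) : IsPosHomogeneous (oscillation f e t N θ) := fun c hc u => by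
  rw [oscillation, oscillation, isPosHomogeneous_amplitude hf e c hc, hf.phase_smul t hc]
  ring

/-- For every shift of the phase, the second derivative of the oscillation is, up to `c`, given by
the term in which the cosine is differentiated twice. -/
def HessOscillationApprox (f : V → ℝ) (e t : V) (N c : ℝ) : Prop :=
  ∀ θ : ℝ, ∀ u ∈ annulus V, ∀ w : V,
    |hess (oscillation f e t N θ) u w w
      + amplitude f e u * hess f (-u) w t ^ 2 * Real.cos (N * phase f t u + θ)| ≤ c * ‖w‖ ^ 2

theorem eventually_hessOscillationApprox {f : V → ℝ} (hf : ContDiffOn ℝ ∞ f {0}ᶜ) (e t : V) {c : ℝ}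
    (hc : 0 < c) : ∀ᶠ N in atTop, HessOscillationApprox f e t N c := by
  obtain ⟨a, ha⟩ := exists_forall_annulus_bound (contDiffOn_amplitude hf e)
  obtain ⟨b, hb⟩ := exists_forall_annulus_bound (contDiffOn_phase hf t)
  have h_tendsto : Tendsto (fun N : ℝ => N⁻¹ * (a + 3 * (a * b))) atTop (𝓝 0) := by
    simpa only [zero_mul] using tendsto_inv_atTop_zero.mul_const (a + 3 * (a * b))
  filter_upwards [h_tendsto.eventually_le_const hc, eventually_ge_atTop 1] with N hNc hN θ u hu w
  have hu_ne := ne_zero_of_mem_annulus hu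
  have h_le := abs_hess_oscillation_add_le
    (contDiffAt_two_of_contDiffOn (contDiffOn_amplitude hf e) hu_ne)
    (contDiffAt_two_of_contDiffOn (contDiffOn_phase hf t) hu_ne) (ha u hu).1 (ha u hu).2.1
    (ha u hu).2.2 (hb u hu).2.1 (hb u hu).2.2 hN θ w
  rw [fderiv_phase hf t hu_ne, ← mul_assoc] at h_le
  exact h_le.trans (mul_le_mul_of_nonneg_right hNc (sq_nonneg _))

section Body

variable (K : ConstantWidthOne V)

theorem amplitude_supportFn_nonneg (hK : ContDiffOn ℝ ∞ (supportFn K.1) {0}ᶜ) (e u : V) :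
    0 ≤ amplitude (supportFn K.1) e u := by
  rcases eq_or_ne u 0 with rfl | hu
  · rw [amplitude_eq_zero _ (inner_zero_left e).le]
  have := (curvatureDet_supportFn_bounds K hu (differentiableAt_fderiv_of_contDiffOn hK hu)).1
  have := Real.smoothTransition.nonneg (inner ℝ u e / ‖u‖)
  unfold amplitude
  positivity

theorem amplitude_supportFn_le {u : V} (hu : u ≠ 0)
    (hu' : DifferentiableAt ℝ (fderiv ℝ (supportFn K.1)) u) (e : V) :
    amplitude (supportFn K.1) e u ≤ 1 / 4 * (‖u‖ * curvatureDet (supportFn K.1) u) := by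
  have := (curvatureDet_supportFn_bounds K hu hu').1
  refine mul_le_mul_of_nonneg_left ?_ (by norm_num)
  exact mul_le_of_le_one_left (by positivity) (Real.smoothTransition.le_one _)

theorem abs_oscillation_supportFn_le (hK : ContDiffOn ℝ ∞ (supportFn K.1) {0}ᶜ) (e t : V) {N : ℝ}
    (hN : 1 ≤ N) (θ : ℝ) (u : V) :
    |oscillation (supportFn K.1) e t N θ u| ≤ N⁻¹ * (1 / 4 * ‖u‖) := by
  have h_nonneg := amplitude_supportFn_nonneg K hK e u
  have h_le : amplitude (supportFn K.1) e u ≤ 1 / 4 * ‖u‖ := by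
    rcases eq_or_ne u 0 with rfl | hu
    · rw [amplitude_eq_zero _ (inner_zero_left e).le, norm_zero, mul_zero]
    have hu' := differentiableAt_fderiv_of_contDiffOn hK hu
    refine (amplitude_supportFn_le K hu hu' e).trans ?_
    gcongr
    exact mul_le_of_le_one_right (norm_nonneg u) (curvatureDet_supportFn_bounds K hu hu').2.1
  have h_inv : (N ^ 2)⁻¹ ≤ N⁻¹ := inv_anti₀ (one_pos.trans_le hN) (by nlinarith)
  rw [oscillation, abs_mul, abs_mul, abs_of_nonneg h_nonneg, abs_of_nonneg (by positivity)]
  refine mul_le_mul h_inv ?_ (by positivity) (by positivity)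
  exact (mul_le_of_le_one_right h_nonneg (Real.abs_cos_le_one _)).trans h_le

theorem amplitude_supportFn_mul_sq_le (hK : ContDiffOn ℝ ∞ (supportFn K.1) {0}ᶜ) (e : V)
    {t u w : V} (ht : ‖t‖ = 1) (hu : ‖u‖ = 1) (hw : inner ℝ u w = 0) :
    amplitude (supportFn K.1) e u * hess (supportFn K.1) (-u) w t ^ 2
        ≤ 1 / 4 * hess (supportFn K.1) u w w ∧
      amplitude (supportFn K.1) e u * hess (supportFn K.1) (-u) w t ^ 2
        ≤ 1 / 4 * hess (supportFn K.1) (-u) w w := by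
  have hu_ne := ne_zero_of_norm_eq_one hu
  have hu_neg_ne := neg_ne_zero.2 hu_ne
  have hu' := differentiableAt_fderiv_of_contDiffOn hK hu_ne
  have hu_neg' := differentiableAt_fderiv_of_contDiffOn hK hu_neg_ne
  have ht_le := K.2.hess_supportFn_le hu_neg_ne hu_neg' t
  have hw_le := K.2.hess_supportFn_le hu_neg_ne hu_neg' w
  rw [norm_neg, hu, div_one, one_mul] at ht_le hw_le
  rw [ht, one_pow] at ht_le
  have h_sq : hess (supportFn K.1) (-u) w t ^ 2 ≤ hess (supportFn K.1) (-u) w w :=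
    (K.2.hess_supportFn_sq_le hu_neg_ne hu_neg' w t).trans
      (mul_le_of_le_one_right (K.2.hess_supportFn_nonneg hu_neg_ne hu_neg' w) ht_le)
  obtain ⟨h_det_nonneg, h_det_le, h_det_mul_le⟩ := curvatureDet_supportFn_bounds K hu_ne hu'
  have h_amplitude := amplitude_supportFn_le K hu_ne hu' e
  have h_det_mul_le := h_det_mul_le w hw
  rw [hu, one_mul] at h_amplitude h_det_mul_le
  constructor
  · calc amplitude (supportFn K.1) e u * hess (supportFn K.1) (-u) w t ^ 2
        ≤ 1 / 4 * curvatureDet (supportFn K.1) u * ‖w‖ ^ 2 :=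
          mul_le_mul h_amplitude (h_sq.trans hw_le) (sq_nonneg _) (by positivity)
      _ ≤ 1 / 4 * hess (supportFn K.1) u w w := by
          rw [mul_assoc]
          gcongr
  · exact mul_le_mul (h_amplitude.trans (by linarith)) h_sq (sq_nonneg _) (by norm_num)

theorem HessOscillationApprox.abs_hess_le {e t u w : V} {N c : ℝ}
    (h_approx : HessOscillationApprox (supportFn K.1) e t N c)
    (hK : ContDiffOn ℝ ∞ (supportFn K.1) {0}ᶜ) (θ : ℝ) (hu : u ∈ annulus V) :
    |hess (oscillation (supportFn K.1) e t N θ) u w w|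
      ≤ amplitude (supportFn K.1) e u * hess (supportFn K.1) (-u) w t ^ 2 + c * ‖w‖ ^ 2 := by
  set W := amplitude (supportFn K.1) e u * hess (supportFn K.1) (-u) w t ^ 2
  have hW : 0 ≤ W := mul_nonneg (amplitude_supportFn_nonneg K hK e u) (sq_nonneg _)
  set x := Real.cos (N * phase (supportFn K.1) t u + θ)
  have h_cos : |W * x| ≤ W := by
    rw [abs_mul, abs_of_nonneg hW]
    exact mul_le_of_le_one_right hW (Real.abs_cos_le_one _)
  calc |hess (oscillation (supportFn K.1) e t N θ) u w w|
      = |hess (oscillation (supportFn K.1) e t N θ) u w w + W * x - W * x| := by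
        rw [add_sub_cancel_right]
    _ ≤ c * ‖w‖ ^ 2 + W := (abs_sub _ _).trans (add_le_add (h_approx θ u hu w) h_cos)
    _ = W + c * ‖w‖ ^ 2 := add_comm _ _

end Body

end Perturbation

section PerturbedBody

open scoped ContDiff

variable {K : ConstantWidthOne V}

theorem hess_add_odd {f G : V → ℝ} {u : V} (hf : ContDiffOn ℝ ∞ f {0}ᶜ)
    (hG : ContDiffOn ℝ ∞ G {0}ᶜ) (hu : u ≠ 0) :
    hess (fun v => f v + (G v + -G (-v))) u = hess f u + (hess G u + -hess G (-u)) := by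
  have hG_neg : ContDiffOn ℝ ∞ (fun v => -G (-v)) {0}ᶜ := (contDiffOn_comp_neg hG).neg
  have hG_at := contDiffAt_two_of_contDiffOn hG hu
  have hG_neg_at := contDiffAt_two_of_contDiffOn hG_neg hu
  rw [hess_add (contDiffAt_two_of_contDiffOn hf hu) (hG_at.add hG_neg_at),
    hess_add hG_at hG_neg_at, hess_neg, hess_comp_neg]

variable [FiniteDimensional ℝ V]

theorem exists_supportFn_eq_add_odd (hK : ContDiffOn ℝ ∞ (supportFn K.1) {0}ᶜ) {G : V → ℝ}
    (hG : IsPosHomogeneous G) (hG_smooth : ContDiffOn ℝ ∞ G {0}ᶜ)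
    (hG_hess : ∀ u w, ‖u‖ = 1 → inner ℝ w u = 0 →
      |hess G u w w| + |hess G (-u) w w| ≤ hess (supportFn K.1) u w w) :
    ∃ L : ConstantWidthOne V, supportFn L.1 = fun v => supportFn K.1 v + (G v + -G (-v)) := by
  set f : V → ℝ := fun v => supportFn K.1 v + (G v + -G (-v)) with hf
  have hf_neg : ∀ u, f u + f (-u) = ‖u‖ := fun u => by
    have := K.2.supportFn_add_neg u
    simp only [hf, neg_neg]
    linarith
  have hf_hom : IsPosHomogeneous f := fun c hc u => by
    simp only [hf]
    rw [← smul_neg, supportFn_smul K.1 c hc, hG c hc, hG c hc]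
    ring
  have hf_smooth : ContDiffOn ℝ ∞ f {0}ᶜ :=
    hK.add (hG_smooth.add (contDiffOn_comp_neg hG_smooth).neg)
  refine IsSublinear.exists_constantWidthOne (hf_hom.isSublinear_of_hess_nonneg
    (hf_smooth.of_le (by norm_cast)) (fun u => (norm_nonneg u).trans_eq (hf_neg u).symm)
    fun u w hu hw => ?_) hf_neg
  rw [hess_add_odd hK hG_smooth (ne_zero_of_norm_eq_one hu)]
  simp only [add_apply, neg_apply]
  have := hG_hess u w hu hw
  have := neg_abs_le (hess G u w w)
  have := le_abs_self (hess G (-u) w w)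
  linarith

theorem exists_perturbed_body (hK : ContDiffOn ℝ ∞ (supportFn K.1) {0}ᶜ) {e t : V} (ht : ‖t‖ = 1)
    {δ c N : ℝ} (hδ : TangentiallyStronglyConvex (supportFn K.1) δ) (hc : 4 * c ≤ δ) (hN : 1 ≤ N)
    (h_approx : HessOscillationApprox (supportFn K.1) e t N c) (θ : ℝ) :
    ∃ L : ConstantWidthOne V, dist L K ≤ N⁻¹ ∧ ∀ u ≠ 0, hess (supportFn L.1) u =
      hess (supportFn K.1) u + (hess (oscillation (supportFn K.1) e t N θ) u
        + -hess (oscillation (supportFn K.1) e t N θ) (-u)) := by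
  set G := oscillation (supportFn K.1) e t N θ
  have hG_smooth : ContDiffOn ℝ ∞ G {0}ᶜ := contDiffOn_oscillation hK e t N θ
  have hG_hess : ∀ u w, ‖u‖ = 1 → inner ℝ w u = 0 →
      |hess G u w w| + |hess G (-u) w w| ≤ hess (supportFn K.1) u w w := fun u w hu hw => by
    have hu_neg : ‖-u‖ = 1 := (norm_neg u).trans hu
    have hw_neg : inner ℝ (-u) w = 0 := by rw [inner_neg_left, real_inner_comm, hw, neg_zero]
    have h_amplitude :=
      (amplitude_supportFn_mul_sq_le K hK e ht hu ((real_inner_comm w u).trans hw)).1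
    have h_amplitude_neg := (amplitude_supportFn_mul_sq_le K hK e ht hu_neg hw_neg).2
    have h_osc := h_approx.abs_hess_le K hK θ (mem_annulus_of_norm_eq_one hu) (w := w)
    have h_osc_neg := h_approx.abs_hess_le K hK θ (mem_annulus_of_norm_eq_one hu_neg) (w := w)
    rw [neg_neg] at h_amplitude_neg h_osc_neg
    have hc_mul := mul_le_mul_of_nonneg_right hc (sq_nonneg ‖w‖)
    have := hδ u w hu hw
    linarith
  obtain ⟨L, hL⟩ := exists_supportFn_eq_add_odd hK
    (isPosHomogeneous_oscillation (supportFn_smul K.1) e t N θ) hG_smooth hG_hess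
  refine ⟨L, ?_, fun u hu => by rw [hL, hess_add_odd hK hG_smooth hu]⟩
  refine dist_le_of_abs_supportFn_sub_le _ _ (by positivity) fun u => ?_
  have hG := abs_oscillation_supportFn_le K hK e t hN θ u
  have hG_neg := abs_oscillation_supportFn_le K hK e t hN θ (-u)
  have : 0 ≤ N⁻¹ * ‖u‖ := by positivity
  rw [norm_neg] at hG_neg
  rw [hL]
  calc |supportFn K.1 u + (G u + -G (-u)) - supportFn K.1 u| = |G u + -G (-u)| := by
        rw [add_sub_cancel_left]
    _ ≤ |G u| + |G (-u)| := by
        rw [← abs_neg (G (-u))]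
        exact abs_add_le _ _
    _ ≤ N⁻¹ * ‖u‖ := by linarith

theorem amplitude_mul_sq_mul_abs_cos_le (hK : ContDiffOn ℝ ∞ (supportFn K.1) {0}ᶜ) {e t : V}
    (ht : ‖t‖ = 1) {N c θ : ℝ} (h_approx : HessOscillationApprox (supportFn K.1) e t N c)
    {L : ConstantWidthOne V} {u : V} (hu : u ∈ annulus V)
    (hL : hess (supportFn L.1) u =
      hess (supportFn K.1) u + (hess (oscillation (supportFn K.1) e t N θ) u
        + -hess (oscillation (supportFn K.1) e t N θ) (-u))) :
    amplitude (supportFn K.1) e u * hess (supportFn K.1) (-u) t t ^ 2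
        * |Real.cos (N * phase (supportFn K.1) t u + θ)|
      ≤ |hess (supportFn L.1) u t t - hess (supportFn K.1) u t t| + 2 * c := by
  have h_osc := h_approx θ u hu t
  have h_osc_neg := h_approx θ (-u) (neg_mem_annulus.2 hu) t
  rw [ht, one_pow, mul_one] at h_osc h_osc_neg
  rcases le_or_gt (inner ℝ u e) 0 with h_inner | h_inner
  · rw [amplitude_eq_zero _ h_inner, zero_mul, zero_mul]
    have := (abs_nonneg _).trans h_osc
    positivity
  rw [amplitude_eq_zero _ (by rw [inner_neg_left]; linarith), zero_mul, zero_mul, add_zero]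
    at h_osc_neg
  set W := amplitude (supportFn K.1) e u * hess (supportFn K.1) (-u) t t ^ 2
  have hW : 0 ≤ W := mul_nonneg (amplitude_supportFn_nonneg K hK e u) (sq_nonneg _)
  set G := oscillation (supportFn K.1) e t N θ
  set x := Real.cos (N * phase (supportFn K.1) t u + θ)
  have h_diff : hess (supportFn L.1) u t t - hess (supportFn K.1) u t t
      = hess G u t t - hess G (-u) t t := by
    rw [hL]
    simp only [add_apply, neg_apply]
    ring
  calc W * |x| = |hess G u t t + W * x - hess G (-u) t t
        - (hess (supportFn L.1) u t t - hess (supportFn K.1) u t t)| := by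
        rw [h_diff, ← abs_of_nonneg hW, ← abs_mul, abs_of_nonneg hW]
        congr 1
        ring
    _ ≤ |hess G u t t + W * x| + |hess G (-u) t t|
        + |hess (supportFn L.1) u t t - hess (supportFn K.1) u t t| :=
        (abs_sub _ _).trans (add_le_add_left (abs_sub _ _) _)
    _ ≤ |hess (supportFn L.1) u t t - hess (supportFn K.1) u t t| + 2 * c := by linarith

theorem one_le_abs_cos_add_abs_sin (x : ℝ) : 1 ≤ |Real.cos x| + |Real.sin x| := by
  have := Real.sin_sq_add_cos_sq x
  nlinarith [abs_nonneg (Real.cos x), abs_nonneg (Real.sin x), sq_abs (Real.cos x),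
    sq_abs (Real.sin x)]

/-- The phases `0` and `π / 2` are used because the cosine and the sine do not vanish
simultaneously. -/
theorem amplitude_mul_sq_le_abs_hess_sub_add (hK : ContDiffOn ℝ ∞ (supportFn K.1) {0}ᶜ)
    {e t : V} (ht : ‖t‖ = 1) {N c : ℝ} (h_approx : HessOscillationApprox (supportFn K.1) e t N c)
    {K₁ K₂ : ConstantWidthOne V} {u : V} (hu : u ∈ annulus V)
    (hK₁ : hess (supportFn K₁.1) u =
      hess (supportFn K.1) u + (hess (oscillation (supportFn K.1) e t N 0) u
        + -hess (oscillation (supportFn K.1) e t N 0) (-u)))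
    (hK₂ : hess (supportFn K₂.1) u =
      hess (supportFn K.1) u + (hess (oscillation (supportFn K.1) e t N (Real.pi / 2)) u
        + -hess (oscillation (supportFn K.1) e t N (Real.pi / 2)) (-u))) :
    amplitude (supportFn K.1) e u * hess (supportFn K.1) (-u) t t ^ 2
      ≤ |hess (supportFn K₁.1) u t t - hess (supportFn K.1) u t t|
        + |hess (supportFn K₂.1) u t t - hess (supportFn K.1) u t t| + 4 * c := by
  have h_cos := amplitude_mul_sq_mul_abs_cos_le hK ht h_approx hu hK₁
  have h_sin := amplitude_mul_sq_mul_abs_cos_le hK ht h_approx hu hK₂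
  rw [add_zero] at h_cos
  rw [Real.cos_add_pi_div_two, abs_neg] at h_sin
  have h_nonneg : 0 ≤ amplitude (supportFn K.1) e u * hess (supportFn K.1) (-u) t t ^ 2 :=
    mul_nonneg (amplitude_supportFn_nonneg K hK e u) (sq_nonneg _)
  have := mul_le_mul_of_nonneg_left
    (one_le_abs_cos_add_abs_sin (N * phase (supportFn K.1) t u)) h_nonneg
  linarith

variable [MeasurableSpace V] [BorelSpace V]

theorem integrable_amplitude_mul_sq (hK : ContDiffOn ℝ ∞ (supportFn K.1) {0}ᶜ) (e t : V) :
    Integrable (fun u => amplitude (supportFn K.1) e u * hess (supportFn K.1) (-u) t t ^ 2)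
      (volume.restrict (annulus V)) := by
  have h_fderiv_phase : ContDiffOn ℝ ∞ (fderiv ℝ (phase (supportFn K.1) t)) {0}ᶜ :=
    (contDiffOn_phase hK t).fderiv_of_isOpen isOpen_compl_singleton (by simp)
  have h_hess : ContinuousOn (fun u => hess (supportFn K.1) (-u) t t) {0}ᶜ :=
    (h_fderiv_phase.clm_apply contDiffOn_const).continuousOn.congr
      fun u hu => (fderiv_phase hK t hu t).symm
  exact ContinuousOn.integrableOn_compact isCompact_annulus
    (((contDiffOn_amplitude hK e).continuousOn.mul (h_hess.pow 2)).mono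
      fun u hu => ne_zero_of_mem_annulus hu)

theorem exists_oscillating_perturbations (hK : ContDiffOn ℝ ∞ (supportFn K.1) {0}ᶜ) {δ : ℝ}
    (hδ : 0 < δ) (hK_convex : TangentiallyStronglyConvex (supportFn K.1) δ) (e : V) {t : V}
    (ht : ‖t‖ = 1) {η : ℝ} (hη : 0 < η) :
    ∃ K₁ K₂ : ConstantWidthOne V, dist K₁ K < η ∧ dist K₂ K < η ∧
      ∫ u in annulus V, amplitude (supportFn K.1) e u * hess (supportFn K.1) (-u) t t ^ 2
        ≤ (∫ u in annulus V, |hess (supportFn K₁.1) u t t - hess (supportFn K.1) u t t|)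
          + (∫ u in annulus V, |hess (supportFn K₂.1) u t t - hess (supportFn K.1) u t t|) + η := by
  set m := volume.real (annulus V)
  obtain ⟨c, hc, hcδ, hcη⟩ : ∃ c > 0, 4 * c ≤ δ ∧ m * (4 * c) ≤ η := by
    refine ⟨min (δ / 4) (η / (4 * (m + 1))), by positivity, ?_, ?_⟩
    · linarith [min_le_left (δ / 4) (η / (4 * (m + 1)))]
    · have := (le_div_iff₀ (by positivity)).1 (min_le_right (δ / 4) (η / (4 * (m + 1))))
      have : 0 < min (δ / 4) (η / (4 * (m + 1))) := by positivity
      linarith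
  obtain ⟨N, h_approx, hN, hNη⟩ := ((eventually_hessOscillationApprox hK e t hc).and
    ((eventually_ge_atTop 1).and (tendsto_inv_atTop_zero.eventually_lt_const hη))).exists
  obtain ⟨K₁, hK₁_dist, hK₁⟩ := exists_perturbed_body hK ht hK_convex hcδ hN h_approx 0
  obtain ⟨K₂, hK₂_dist, hK₂⟩ :=
    exists_perturbed_body hK ht hK_convex hcδ hN h_approx (Real.pi / 2)
  refine ⟨K₁, K₂, hK₁_dist.trans_lt hNη, hK₂_dist.trans_lt hNη, ?_⟩
  have h_integrable : ∀ L : ConstantWidthOne V,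
      Integrable (fun u => |hess (supportFn L.1) u t t - hess (supportFn K.1) u t t|)
        (volume.restrict (annulus V)) := fun L =>
    ((integrable_hess L t).sub (integrable_hess K t)).abs
  have h_sum : Integrable (fun u => |hess (supportFn K₁.1) u t t - hess (supportFn K.1) u t t|
      + |hess (supportFn K₂.1) u t t - hess (supportFn K.1) u t t|)
      (volume.restrict (annulus V)) := (h_integrable K₁).add (h_integrable K₂)
  have h_integral := setIntegral_mono_on (integrable_amplitude_mul_sq hK e t)
    (h_sum.add (integrable_const (4 * c))) isClosed_annulus.measurableSet fun u hu =>
      amplitude_mul_sq_le_abs_hess_sub_add hK ht h_approx hu (hK₁ u (ne_zero_of_mem_annulus hu))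
        (hK₂ u (ne_zero_of_mem_annulus hu))
  rw [integral_add' h_sum (integrable_const _),
    integral_add (h_integrable K₁) (h_integrable K₂), setIntegral_const, smul_eq_mul]
    at h_integral
  exact h_integral.trans (add_le_add_right hcη _)

end PerturbedBody

/-! ### The typical behaviour of the second derivatives -/

section Typical

open scoped ContDiff

theorem ae_tendsto_zero_of_integral_abs_le_geometric {α : Type*} [MeasurableSpace α]
    {μ : Measure α} {F : ℕ → α → ℝ} (hF : ∀ k, Integrable (F k) μ)
    (hF_le : ∀ k, ∫ x, |F k x| ∂μ ≤ (1 / 2) ^ k) :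
    ∀ᵐ x ∂μ, Tendsto (fun k => F k x) atTop (𝓝 0) := by
  have h_meas : ∀ k, AEMeasurable (fun x => ‖F k x‖ₑ) μ := fun k =>
    (hF k).aestronglyMeasurable.enorm
  have h_ne_top : ∫⁻ x, ∑' k, ‖F k x‖ₑ ∂μ ≠ ⊤ := by
    rw [lintegral_tsum h_meas]
    refine ne_top_of_le_ne_top summable_geometric_two.tsum_ofReal_ne_top
      (ENNReal.tsum_le_tsum fun k => ?_)
    rw [← ofReal_integral_norm_eq_lintegral_enorm (hF k)]
    exact ENNReal.ofReal_le_ofReal (hF_le k)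
  filter_upwards [ae_lt_top' (AEMeasurable.tsum h_meas) h_ne_top] with x hx
  exact tendsto_zero_iff_enorm_tendsto_zero.2
    (ENNReal.tendsto_atTop_zero_of_tsum_ne_top hx.ne)

theorem tendsto_of_polarization {ι : Type*} {l : Filter ι} {B : ι → V →L[ℝ] V →L[ℝ] ℝ}
    {A : V →L[ℝ] V →L[ℝ] ℝ} {v w : V} (hB : ∀ k, B k v w = B k w v) (hA : A v w = A w v)
    (hv : Tendsto (fun k => B k v v) l (𝓝 (A v v)))
    (hw : Tendsto (fun k => B k w w) l (𝓝 (A w w)))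
    (h_add : Tendsto (fun k => B k (v + w) (v + w)) l (𝓝 (A (v + w) (v + w)))) :
    Tendsto (fun k => B k v w) l (𝓝 (A v w)) := by
  have h_polarization : ∀ C : V →L[ℝ] V →L[ℝ] ℝ, C v w = C w v →
      C v w = 1 / 2 * (C (v + w) (v + w) - C v v - C w w) := fun C hC => by
    simp only [map_add, add_apply, ← hC]
    ring
  rw [h_polarization A hA]
  simp only [fun k => h_polarization (B k) (hB k)]
  exact ((h_add.sub hv).sub hw).const_mul _

theorem HasConstantWidth.isStationary_of_hess_self_eq_zero {ι : Type*} [Fintype ι]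
    (b : OrthonormalBasis ι ℝ V) {K : ConvexBody V} {d : ℝ} (hK : HasConstantWidth K d) {u : V}
    (hu : u ≠ 0) (h_diff : DifferentiableAt ℝ (supportPt K) (-u))
    (h_hess : ∀ i, hess (supportFn K) (-u) (b i) (b i) = 0) : IsStationary K u := by
  have hu_neg : -u ≠ 0 := neg_ne_zero.2 hu
  have h_zero : fderiv ℝ (supportPt K) (-u) = 0 := by
    refine ContinuousLinearMap.coe_injective (b.toBasis.ext fun i => ext_inner_right ℝ fun w => ?_)
    have h_sq := hK.hess_supportFn_sq_le hu_neg
      (hK.hasFDerivAt_fderiv_supportFn hu_neg h_diff.hasFDerivAt).differentiableAt (b i) w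
    rw [h_hess i, zero_mul, hK.hess_supportFn hu_neg h_diff.hasFDerivAt] at h_sq
    rw [b.coe_toBasis, ContinuousLinearMap.coe_coe, sq_eq_zero_iff.1 (h_sq.antisymm (sq_nonneg _))]
    simp
  have h_comp := h_diff.hasFDerivAt.comp u (hasFDerivAt_id u).neg
  rwa [h_zero, ContinuousLinearMap.zero_comp] at h_comp

theorem exists_inner_pos {ι : Type*} [Fintype ι] (b : OrthonormalBasis ι ℝ V) {u : V}
    (hu : u ≠ 0) : ∃ i, 0 < inner ℝ u (b i) ∨ 0 < inner ℝ u (-b i) := by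
  by_contra! h
  refine hu (InnerProductSpace.ext_inner_right_basis b.toBasis fun i => ?_)
  have h_neg := (h i).2
  rw [inner_neg_right] at h_neg
  rw [inner_zero_left, b.coe_toBasis]
  linarith [(h i).1]

variable {K : ConstantWidthOne V} [FiniteDimensional ℝ V]

theorem amplitude_ne_zero {e u : V} (hu : u ≠ 0) (he : 0 < inner ℝ u e)
    {f : V → ℝ} (h_det : curvatureDet f u ≠ 0) : amplitude f e u ≠ 0 :=
  mul_ne_zero (by norm_num) (mul_ne_zero
    (Real.smoothTransition.pos_of_pos (div_pos he (norm_pos_iff.2 hu))).ne'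
    (mul_ne_zero (norm_ne_zero_iff.2 hu) h_det))

theorem tendsto_amplitude {ι : Type*} {l : Filter ι} {f : ι → V → ℝ} {g : V → ℝ} {u : V}
    (h : Tendsto (fun k => curvatureDet (f k) u) l (𝓝 (curvatureDet g u))) (e : V) :
    Tendsto (fun k => amplitude (f k) e u) l (𝓝 (amplitude g e u)) :=
  ((h.const_mul _).const_mul _).const_mul _

section Measure

variable [MeasurableSpace V] [BorelSpace V]

theorem measurePreserving_neg_annulus : MeasurePreserving (fun u : V => -u)
    (volume.restrict (annulus V)) (volume.restrict (annulus V)) := by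
  have h_preimage : Neg.neg ⁻¹' annulus V = annulus V := Set.ext fun _ => neg_mem_annulus
  have h := (Measure.measurePreserving_neg (volume : Measure V)).restrict_preimage
    (isClosed_annulus (E := V)).measurableSet
  rwa [h_preimage] at h

theorem exists_good_approximation [Nontrivial V] {T : Set V} (hT : T.Finite)
    (hK : ∀ t ∈ T, ∀ ε > 0, ∀ᶠ L in 𝓝 K,
      ∫ u in annulus V, |hess (supportFn L.1) u t t - hess (supportFn K.1) u t t| ≤ ε)
    {ε : ℝ} (hε : 0 < ε) :
    ∃ L : ConstantWidthOne V, ContDiffOn ℝ ∞ (supportFn L.1) {0}ᶜ ∧ ∀ t ∈ T,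
      ∫ u in annulus V, |hess (supportFn L.1) u t t - hess (supportFn K.1) u t t| ≤ ε ∧
      (‖t‖ = 1 → ∀ e, ∫ u in annulus V,
        amplitude (supportFn L.1) e u * hess (supportFn L.1) (-u) t t ^ 2 ≤ ε) := by
  obtain ⟨η, hη, hη_le⟩ := Metric.eventually_nhds_iff.1
    ((eventually_all_finite hT).2 fun t ht => hK t ht (ε / 5) (by positivity))
  obtain ⟨L, hL_dist, hL_smooth, δ, hδ, hL_convex⟩ :=
    exists_stronglyConvex_dist_lt K (half_pos hη)
  refine ⟨L, hL_smooth, fun t ht => ?_⟩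
  have hL := hη_le (hL_dist.trans (half_lt_self hη)) t ht
  refine ⟨by linarith, fun ht_norm e => ?_⟩
  have h_near : ∀ L' : ConstantWidthOne V, dist L' L < η / 2 →
      ∫ u in annulus V, |hess (supportFn L'.1) u t t - hess (supportFn L.1) u t t|
        ≤ 2 * (ε / 5) := fun L' hL' => by
    have h_add := integral_abs_sub_le_add (integrable_hess L' t) (integrable_hess K t)
      (integrable_hess L t)
    simp only [abs_sub_comm (hess (supportFn K.1) _ _ _)] at h_add
    have := hη_le (y := L') (by linarith [dist_triangle L' L K]) t ht
    linarith
  obtain ⟨K₁, K₂, hK₁, hK₂, h_le⟩ := exists_oscillating_perturbations hL_smooth hδ hL_convex e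
    ht_norm (lt_min (half_pos hη) (by positivity : 0 < ε / 5))
  have h₁ := h_near K₁ (hK₁.trans_le (min_le_left _ _))
  have h₂ := h_near K₂ (hK₂.trans_le (min_le_left _ _))
  linarith [min_le_right (η / 2) (ε / 5)]

theorem exists_seq_ae_tendsto_hess [Nontrivial V] {T : Set V} (hT : T.Finite)
    (hK : ∀ t ∈ T, ∀ ε > 0, ∀ᶠ L in 𝓝 K,
      ∫ u in annulus V, |hess (supportFn L.1) u t t - hess (supportFn K.1) u t t| ≤ ε) :
    ∃ L : ℕ → ConstantWidthOne V, (∀ k, ContDiffOn ℝ ∞ (supportFn (L k).1) {0}ᶜ) ∧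
      ∀ t ∈ T, (∀ᵐ u ∂volume.restrict (annulus V), Tendsto
          (fun k => hess (supportFn (L k).1) u t t) atTop (𝓝 (hess (supportFn K.1) u t t))) ∧
        (‖t‖ = 1 → ∀ e, ∀ᵐ u ∂volume.restrict (annulus V), Tendsto
          (fun k => amplitude (supportFn (L k).1) e u * hess (supportFn (L k).1) (-u) t t ^ 2)
          atTop (𝓝 0)) := by
  choose L hL_smooth hL using fun k : ℕ =>
    exists_good_approximation hT hK (ε := (1 / 2) ^ k) (by positivity)
  refine ⟨L, hL_smooth, fun t ht => ⟨?_, fun ht_norm e => ?_⟩⟩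
  · filter_upwards [ae_tendsto_zero_of_integral_abs_le_geometric
      (fun k => (integrable_hess (L k) t).sub (integrable_hess K t)) fun k => (hL k t ht).1]
      with u hu
    exact tendsto_sub_nhds_zero_iff.1 hu
  · refine ae_tendsto_zero_of_integral_abs_le_geometric
      (fun k => integrable_amplitude_mul_sq (hL_smooth k) e t) fun k => ?_
    refine le_of_eq_of_le (integral_congr_ae (.of_forall fun u => ?_)) ((hL k t ht).2 ht_norm e)
    exact abs_of_nonneg (mul_nonneg (amplitude_supportFn_nonneg _ (hL_smooth k) e u) (sq_nonneg _))

end Measure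

theorem curvatureDet_eq_zero_or_isStationary_of_tendsto {ι : Type*} [Fintype ι]
    (b : OrthonormalBasis ι ℝ V) {L : ℕ → ConstantWidthOne V}
    (hL : ∀ k, ContDiffOn ℝ ∞ (supportFn (L k).1) {0}ᶜ) {u : V} (hu : u ≠ 0)
    (h_diff : DifferentiableAt ℝ (fderiv ℝ (supportFn K.1)) u)
    (h_diff_neg : DifferentiableAt ℝ (supportPt K.1) (-u))
    (h_basis : ∀ i, Tendsto (fun k => hess (supportFn (L k).1) u (b i) (b i)) atTop
      (𝓝 (hess (supportFn K.1) u (b i) (b i))))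
    (h_add : ∀ i j, Tendsto (fun k => hess (supportFn (L k).1) u (b i + b j) (b i + b j)) atTop
      (𝓝 (hess (supportFn K.1) u (b i + b j) (b i + b j))))
    (h_neg : ∀ i, Tendsto (fun k => hess (supportFn (L k).1) (-u) (b i) (b i)) atTop
      (𝓝 (hess (supportFn K.1) (-u) (b i) (b i))))
    (h_zero : ∀ e, ∀ i, (∃ j, e = b j ∨ e = -b j) → Tendsto (fun k =>
      amplitude (supportFn (L k).1) e u * hess (supportFn (L k).1) (-u) (b i) (b i) ^ 2)
      atTop (𝓝 0)) :
    curvatureDet (supportFn K.1) u = 0 ∨ IsStationary K.1 u := by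
  refine or_iff_not_imp_left.2 fun h_det =>
    K.2.isStationary_of_hess_self_eq_zero b hu h_diff_neg fun i => ?_
  have h_tendsto_det : Tendsto (fun k => curvatureDet (supportFn (L k).1) u) atTop
      (𝓝 (curvatureDet (supportFn K.1) u)) :=
    tendsto_curvatureDet b fun i j => tendsto_of_polarization
      (fun k => (L k).2.hess_supportFn_symm hu
        (differentiableAt_fderiv_of_contDiffOn (hL k) hu) _ _)
      (K.2.hess_supportFn_symm hu h_diff _ _) (h_basis i) (h_basis j) (h_add i j)
  obtain ⟨e, he, he_pos⟩ : ∃ e, (∃ j, e = b j ∨ e = -b j) ∧ 0 < inner ℝ u e := by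
    obtain ⟨j, hj | hj⟩ := exists_inner_pos b hu
    exacts [⟨_, ⟨j, .inl rfl⟩, hj⟩, ⟨_, ⟨j, .inr rfl⟩, hj⟩]
  have h_mul := tendsto_nhds_unique (h_zero e i he)
    ((tendsto_amplitude h_tendsto_det e).mul ((h_neg i).pow 2))
  exact sq_eq_zero_iff.1 ((mul_eq_zero.1 h_mul.symm).resolve_left
    (amplitude_ne_zero hu he_pos h_det))

/-- By continuity of the second derivatives at a typical body `K`, the oscillating perturbations of
smooth bodies near `K` cannot change the second derivatives much in the mean. Hence their amplitude,
which is a multiple of `curvatureDet` times the second derivatives in the opposite direction, tends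
to zero. -/
theorem eventually_residual_ae_curvatureDet_eq_zero_or_isStationary [MeasurableSpace V]
    [BorelSpace V] [Nontrivial V] :
    ∀ᶠ K in residual (ConstantWidthOne V), ∀ᵐ u ∂volume.restrict (annulus V),
      curvatureDet (supportFn K.1) u = 0 ∨ IsStationary K.1 u := by
  let b := stdOrthonormalBasis ℝ V
  let T : Set V := Set.range b ∪ Set.range fun p : _ × _ => b p.1 + b p.2
  have hT : T.Finite := (Set.finite_range _).union (Set.finite_range _)
  have hb : ∀ i, b i ∈ T := fun i => .inl ⟨i, rfl⟩
  filter_upwards [(eventually_all_finite hT).2 fun t _ => eventually_residual_continuousAt_hess t]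
    with K hK
  obtain ⟨L, hL_smooth, hL⟩ := exists_seq_ae_tendsto_hess hT hK
  have h_neg {p : V → Prop} (hp : ∀ᵐ u ∂volume.restrict (annulus V), p u) :
      ∀ᵐ u ∂volume.restrict (annulus V), p (-u) :=
    measurePreserving_neg_annulus.quasiMeasurePreserving.ae hp
  filter_upwards [ae_restrict_annulus_mem volume, ae_differentiableAt_fderiv_supportFn K,
    h_neg (ae_differentiableAt_supportPt K), ae_all_iff.2 fun i => (hL _ (hb i)).1,
    ae_all_iff.2 fun p : _ × _ => (hL (b p.1 + b p.2) (.inr ⟨p, rfl⟩)).1,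
    ae_all_iff.2 fun i => h_neg (hL _ (hb i)).1,
    ae_all_iff.2 fun p : _ × _ => (hL _ (hb p.1)).2 (b.norm_eq_one p.1) (b p.2),
    ae_all_iff.2 fun p : _ × _ => (hL _ (hb p.1)).2 (b.norm_eq_one p.1) (-b p.2)]
    with u hu h_diff h_diff_neg h_basis h_add h_basis_neg h_pos h_refl
  refine curvatureDet_eq_zero_or_isStationary_of_tendsto b hL_smooth (ne_zero_of_mem_annulus hu)
    h_diff h_diff_neg h_basis (fun i j => h_add (i, j)) h_basis_neg ?_
  rintro e i ⟨j, rfl | rfl⟩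
  exacts [h_pos (i, j), h_refl (i, j)]

end Typical

/-! ### Projections of boundary sets along a direction -/

section Projection

variable {e : V}

theorem coe_orthogonalProjectionOnto_orthogonal_singleton (he : ‖e‖ = 1) (x : V) :
    ((ℝ ∙ e)ᗮ.orthogonalProjectionOnto x : V) = x - inner ℝ e x • e := by
  rw [← Submodule.starProjection_apply, Submodule.starProjection_orthogonal_val,
    Submodule.starProjection_unit_singleton ℝ he]

theorem norm_le_mul_norm_orthogonalProjectionOnto (he : ‖e‖ = 1) {u v : V} (hu : ‖u‖ = 1)
    (hv : ‖v‖ = 1) {c : ℝ} (hc : 0 < c) (hcu : c ≤ inner ℝ u e) (hcv : c ≤ inner ℝ v e) {x : V}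
    (hxu : 0 ≤ inner ℝ x u) (hxv : inner ℝ x v ≤ 0) :
    ‖x‖ ≤ (1 + c⁻¹) * ‖(ℝ ∙ e)ᗮ.orthogonalProjectionOnto x‖ := by
  rw [Submodule.coe_norm, coe_orthogonalProjectionOnto_orthogonal_singleton he]
  set s := inner ℝ e x
  set p := x - s • e with hp
  have hx : x = p + s • e := by rw [hp, sub_add_cancel]
  have h_inner (w : V) : inner ℝ x w = inner ℝ p w + s * inner ℝ w e := by
    rw [hx, inner_add_left, real_inner_smul_left, real_inner_comm w e]
  have hpu : inner ℝ p u ≤ ‖p‖ := by simpa [hu] using real_inner_le_norm p u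
  have hpv : -‖p‖ ≤ inner ℝ p v := by
    simpa [hv] using neg_le_of_abs_le (abs_real_inner_le_norm p v)
  have h_abs : |s| ≤ c⁻¹ * ‖p‖ := by
    rw [inv_mul_eq_div, le_div_iff₀' hc]
    rw [h_inner] at hxu hxv
    rcases le_total 0 s with hs | hs
    · rw [abs_of_nonneg hs]
      linarith [mul_le_mul_of_nonneg_left hcv hs]
    · rw [abs_of_nonpos hs]
      linarith [mul_le_mul_of_nonpos_left hcu hs]
  calc ‖x‖ ≤ ‖p‖ + ‖s • e‖ := by
        rw [hx]
        exact norm_add_le _ _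
    _ = ‖p‖ + |s| := by rw [norm_smul, he, mul_one, Real.norm_eq_abs]
    _ ≤ (1 + c⁻¹) * ‖p‖ := by linarith

theorem antilipschitzWith_orthogonalProjectionOnto_supportPt (K : ConvexBody V) (he : ‖e‖ = 1)
    {c : ℝ} (hc : 0 < c) :
    AntilipschitzWith (1 + c⁻¹).toNNReal
      ((supportPt K '' {u | ‖u‖ = 1 ∧ c ≤ inner ℝ u e}).domRestrict
        (ℝ ∙ e)ᗮ.orthogonalProjectionOnto) := by
  refine AntilipschitzWith.of_le_mul_dist ?_
  rintro ⟨_, u, ⟨hu, hcu⟩, rfl⟩ ⟨_, v, ⟨hv, hcv⟩, rfl⟩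
  rw [Real.coe_toNNReal _ (by positivity), Subtype.dist_eq, dist_eq_norm, dist_eq_norm,
    Set.domRestrict_apply, Set.domRestrict_apply, ← map_sub]
  refine norm_le_mul_norm_orthogonalProjectionOnto he hu hv hc hcu hcv
    (inner_supportPt_sub_nonneg K u (supportPt_mem _ _)) ?_
  rw [← neg_sub, inner_neg_left, neg_nonpos]
  exact inner_supportPt_sub_nonneg K v (supportPt_mem _ _)

end Projection

section Hausdorff

theorem hausdorffMeasure_eq_zero_of_image {X Y : Type*} [EMetricSpace X] [MeasurableSpace X]
    [BorelSpace X] [EMetricSpace Y] [MeasurableSpace Y] [BorelSpace Y] {s : Set X} {f : X → Y}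
    {C : ℝ≥0} (hf : AntilipschitzWith C (s.domRestrict f)) {d : ℝ} (hd : 0 ≤ d)
    (h : Measure.hausdorffMeasure d (f '' s) = 0) : Measure.hausdorffMeasure d s = 0 := by
  have h_le := hf.le_hausdorffMeasure_image hd Set.univ
  rw [Set.image_univ, Set.range_domRestrict, h, mul_zero, nonpos_iff_eq_zero] at h_le
  have h_isom := (isometry_subtype_coe (s := s)).hausdorffMeasure_image (Or.inl hd) Set.univ
  rwa [Set.image_univ, Subtype.range_coe, h_le] at h_isom

variable [FiniteDimensional ℝ V]

theorem cast_finrank_orthogonal_singleton {e : V} (he : e ≠ 0) :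
    (Module.finrank ℝ (ℝ ∙ e)ᗮ : ℝ) = Module.finrank ℝ V - 1 := by
  rw [← Submodule.finrank_add_finrank_orthogonal (ℝ ∙ e), finrank_span_singleton he]
  push_cast
  ring

variable [MeasurableSpace V] [BorelSpace V]

theorem hausdorffMeasure_finrank_eq_zero_iff {s : Set V} :
    Measure.hausdorffMeasure (Module.finrank ℝ V) s = 0 ↔ volume s = 0 :=
  ⟨fun h => Measure.absolutelyContinuous_isAddHaarMeasure _ _ h,
    fun h => Measure.absolutelyContinuous_isAddHaarMeasure _ _ h⟩

theorem volume_image_eq_zero_of_lipschitzOnWith {s : Set V} {f : V → V} {C : ℝ≥0}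
    (hf : LipschitzOnWith C f s) (hs : volume s = 0) : volume (f '' s) = 0 := by
  rw [← hausdorffMeasure_finrank_eq_zero_iff] at hs ⊢
  have h_le := hf.hausdorffMeasure_image_le (d := Module.finrank ℝ V) (Nat.cast_nonneg _)
  rwa [hs, mul_zero, nonpos_iff_eq_zero] at h_le

theorem volume_image_orthogonalProjectionOnto_eq_zero {e : V} (he : ‖e‖ = 1) {X Y : Set V}
    (hY : volume Y = 0) (hXY : ∀ x ∈ X, ∀ r ∈ Set.Icc (1 : ℝ) 2, x + r • e ∈ Y) :
    volume ((ℝ ∙ e)ᗮ.orthogonalProjectionOnto '' X) = 0 := by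
  let L : (ℝ ∙ e)ᗮ × ℝ →ₗ[ℝ] V :=
    (ℝ ∙ e)ᗮ.subtype.coprod (LinearMap.toSpanSingleton ℝ V e)
  have hL (x : V) (s : ℝ) : L ((ℝ ∙ e)ᗮ.orthogonalProjectionOnto x, s)
      = x + (s - inner ℝ e x) • e := by
    simp only [L, LinearMap.coprod_apply, Submodule.subtype_apply,
      coe_orthogonalProjectionOnto_orthogonal_singleton he, LinearMap.toSpanSingleton_apply]
    module
  have hL_surj : Function.Surjective L := fun x => ⟨(_, inner ℝ e x), by
    rw [hL, sub_self, zero_smul, add_zero]⟩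
  have h_null : (volume.prod volume) (L ⁻¹' Y) = 0 := by
    have h_ae := (ae_comp_linearMap_mem_iff L (volume.prod volume) volume hL_surj
      (measurableSet_toMeasurable volume Y).compl).2
      (measure_eq_zero_iff_ae_notMem.1 (by rwa [measure_toMeasurable]))
    exact measure_mono_null (Set.preimage_mono (subset_toMeasurable volume Y))
      (measure_eq_zero_iff_ae_notMem.2 h_ae)
  refine measure_mono_null ?_ (Measure.measure_ae_null_of_prod_null h_null)
  rintro _ ⟨x, hx, rfl⟩ h_slice
  have h_Icc : volume (Set.Icc (inner ℝ e x + 1) (inner ℝ e x + 2)) = 0 := by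
    refine measure_mono_null (fun s hs => ?_) h_slice
    change L (_, s) ∈ Y
    rw [hL]
    exact hXY x hx _ ⟨by linarith [hs.1], by linarith [hs.2]⟩
  rw [Real.volume_Icc] at h_Icc
  norm_num at h_Icc

end Hausdorff

/-! ### Support points in non-stationary directions -/

section Stationary

variable {K : ConvexBody V} {d : ℝ} {u : V}

theorem IsStationary.smul (hu_stat : IsStationary K u) (hK : HasConstantWidth K d) (hu : u ≠ 0)
    {c : ℝ} (hc : 0 < c) : IsStationary K (c • u) := by
  have h_outer : HasFDerivAt (fun w => supportPt K (-w)) (0 : V →L[ℝ] V) (c⁻¹ • c • u) := by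
    rwa [inv_smul_smul₀ hc.ne']
  have h_comp := h_outer.comp (c • u) ((hasFDerivAt_id (𝕜 := ℝ) (c • u)).const_smul c⁻¹)
  rw [ContinuousLinearMap.zero_comp] at h_comp
  refine h_comp.congr_of_eventuallyEq ?_
  filter_upwards [isOpen_ne.mem_nhds (smul_ne_zero hc.ne' hu)] with w hw
  change supportPt K (-w) = supportPt K (-(c⁻¹ • w))
  rw [← smul_neg, hK.supportPt_smul (neg_ne_zero.2 hw) (inv_pos.2 hc)]

theorem HasConstantWidth.isStationary_smul_iff (hK : HasConstantWidth K d) (hu : u ≠ 0) {c : ℝ}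
    (hc : 0 < c) : IsStationary K (c • u) ↔ IsStationary K u := by
  refine ⟨fun h => ?_, fun h => h.smul hK hu hc⟩
  simpa only [inv_smul_smul₀ hc.ne'] using h.smul hK (smul_ne_zero hc.ne' hu) (inv_pos.2 hc)

theorem hasFDerivAt_norm_of_ne_zero (hu : u ≠ 0) :
    HasFDerivAt (fun v : V => ‖v‖) (‖u‖⁻¹ • innerSL ℝ u) u := by
  have hu_norm : ‖u‖ ≠ 0 := norm_ne_zero_iff.2 hu
  have h_sqrt := (hasStrictFDerivAt_norm_sq u).hasFDerivAt.sqrt (pow_ne_zero 2 hu_norm)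
  simp only [Real.sqrt_sq (norm_nonneg _)] at h_sqrt
  convert h_sqrt using 1
  ext w
  simp only [smul_apply, smul_eq_mul, nsmul_eq_mul]
  field_simp
  norm_num

variable [FiniteDimensional ℝ V]

theorem HasConstantWidth.det_fderiv_supportPt_add_eq_zero (hK : HasConstantWidth K d) (hu : u ≠ 0)
    {A : V →L[ℝ] V} (hA : HasFDerivAt (supportPt K) A u)
    (h_det : curvatureDet (supportFn K) u = 0) (e : V) :
    (A + (‖u‖⁻¹ • innerSL ℝ u).smulRight e).det = 0 := by
  have h_diff : DifferentiableAt ℝ (fderiv ℝ (supportFn K)) u :=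
    (hK.hasFDerivAt_fderiv_supportFn hu hA).differentiableAt
  have hu_norm : ‖u‖ ≠ 0 := norm_ne_zero_iff.2 hu
  rw [curvatureDet, LinearMap.det_eq_zero_iff_ker_ne_bot] at h_det
  obtain ⟨w, hw, hw_ne⟩ := (Submodule.ne_bot_iff _).1 h_det
  have h_ker (z : V) :
      ‖u‖ * inner ℝ (A w) z + (‖u‖ ^ 2)⁻¹ * inner ℝ u w * inner ℝ u z = 0 := by
    rw [← hK.hess_supportFn hu hA, ← inner_curvatureOp, LinearMap.mem_ker.1 hw, inner_zero_left]
  have h_radial : inner ℝ (A w) u = 0 := by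
    rw [← hK.hess_supportFn hu hA, hK.hess_supportFn_symm hu h_diff,
      (supportFn_smul K).hess_apply_self h_diff, zero_apply]
  have hw_orth : inner ℝ u w = 0 := by
    have h_ker_u := h_ker u
    rw [h_radial, real_inner_self_eq_norm_sq] at h_ker_u
    field_simp at h_ker_u
    linarith
  have hAw : A w = 0 := by
    refine ext_inner_right ℝ fun z => ?_
    simpa [hw_orth, hu_norm] using h_ker z
  change LinearMap.det _ = 0
  rw [LinearMap.det_eq_zero_iff_ker_ne_bot, Submodule.ne_bot_iff]
  exact ⟨w, by simp [hw_orth, hAw], hw_ne⟩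

end Stationary

theorem lipschitzOnWith_supportPt_add_norm_smul (K : ConstantWidthOne V) (e : V) :
    ∃ C, LipschitzOnWith C (fun u => supportPt K.1 u + ‖u‖ • e) (annulus V) := by
  refine ⟨_, ((K.2.lipschitzOnWith_supportPt one_half_pos).mono fun u hu =>
    one_half_lt_one.trans_le hu.1).add (LipschitzOnWith.of_dist_le_mul (K := ‖e‖₊)
      fun u _ v _ => ?_)⟩
  rw [dist_eq_norm, dist_eq_norm, ← sub_smul, norm_smul, mul_comm]
  exact mul_le_mul_of_nonneg_left (abs_norm_sub_norm_le u v) (norm_nonneg _)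

section Negligible

variable [FiniteDimensional ℝ V] [MeasurableSpace V] [BorelSpace V] {K : ConstantWidthOne V}

/-- The derivative of the map is singular where `curvatureDet` vanishes (Sard), and the map is
Lipschitz on the remaining null set. -/
theorem volume_image_supportPt_add_norm_smul_eq_zero
    (h : ∀ᵐ u ∂volume.restrict (annulus V),
      curvatureDet (supportFn K.1) u = 0 ∨ IsStationary K.1 u) (e : V) :
    volume ((fun u => supportPt K.1 u + ‖u‖ • e) '' {u ∈ annulus V | ¬ IsStationary K.1 u})
      = 0 := by
  set F : V → V := fun u => supportPt K.1 u + ‖u‖ • e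
  set S : Set V := {u ∈ annulus V | DifferentiableAt ℝ (supportPt K.1) u ∧
    curvatureDet (supportFn K.1) u = 0}
  set N : Set V := {u ∈ annulus V | ¬ (DifferentiableAt ℝ (supportPt K.1) u ∧
    (curvatureDet (supportFn K.1) u = 0 ∨ IsStationary K.1 u))}
  have hS : volume (F '' S) = 0 :=
    addHaar_image_eq_zero_of_det_fderivWithin_eq_zero volume
      (fun u hu => (hu.2.1.hasFDerivAt.add ((hasFDerivAt_norm_of_ne_zero
        (ne_zero_of_mem_annulus hu.1)).smul_const e)).hasFDerivWithinAt)
      fun u hu => K.2.det_fderiv_supportPt_add_eq_zero (ne_zero_of_mem_annulus hu.1)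
        hu.2.1.hasFDerivAt hu.2.2 e
  have hN : volume (F '' N) = 0 := by
    obtain ⟨C, hC⟩ := lipschitzOnWith_supportPt_add_norm_smul K e
    refine volume_image_eq_zero_of_lipschitzOnWith (hC.mono fun u hu => hu.1) ?_
    have h_ae := (ae_restrict_iff' isClosed_annulus.measurableSet).1
      ((ae_differentiableAt_supportPt K).and h)
    refine measure_mono_null ?_ h_ae
    exact fun u hu h_imp => hu.2 (h_imp hu.1)
  refine measure_mono_null ?_ (measure_union_null hS hN)
  rw [← Set.image_union]
  refine Set.image_mono fun u hu => ?_
  by_cases hu_good : DifferentiableAt ℝ (supportPt K.1) u ∧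
    (curvatureDet (supportFn K.1) u = 0 ∨ IsStationary K.1 u)
  · exact Or.inl ⟨hu.1, hu_good.1, hu_good.2.resolve_right hu.2⟩
  · exact Or.inr ⟨hu.1, hu_good⟩

theorem hausdorffMeasure_image_supportPt_of_le_inner_eq_zero
    (h : ∀ᵐ u ∂volume.restrict (annulus V),
      curvatureDet (supportFn K.1) u = 0 ∨ IsStationary K.1 u)
    {e : V} (he : ‖e‖ = 1) {c : ℝ} (hc : 0 < c) :
    Measure.hausdorffMeasure (Module.finrank ℝ V - 1 : ℝ)
      (supportPt K.1 '' {u | ‖u‖ = 1 ∧ c ≤ inner ℝ u e ∧ ¬ IsStationary K.1 u}) = 0 := by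
  rw [← cast_finrank_orthogonal_singleton (ne_zero_of_norm_eq_one he)]
  have h_sub : {u | ‖u‖ = 1 ∧ c ≤ inner ℝ u e ∧ ¬ IsStationary K.1 u} ⊆
      {u | ‖u‖ = 1 ∧ c ≤ inner ℝ u e} := fun u hu => ⟨hu.1, hu.2.1⟩
  refine hausdorffMeasure_eq_zero_of_image (f := (ℝ ∙ e)ᗮ.orthogonalProjectionOnto)
    (fun x y => antilipschitzWith_orthogonalProjectionOnto_supportPt K.1 he hc
      ⟨x, Set.image_mono h_sub x.2⟩ ⟨y, Set.image_mono h_sub y.2⟩) (Nat.cast_nonneg _) ?_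
  rw [hausdorffMeasure_finrank_eq_zero_iff]
  refine volume_image_orthogonalProjectionOnto_eq_zero he
    (volume_image_supportPt_add_norm_smul_eq_zero h e) ?_
  rintro _ ⟨u, ⟨hu, -, hu_stat⟩, rfl⟩ r ⟨hr_ge, hr_le⟩
  have hr : 0 < r := one_pos.trans_le hr_ge
  have hu_ne := ne_zero_of_norm_eq_one hu
  have h_norm : ‖r • u‖ = r := by rw [norm_smul, hu, mul_one, Real.norm_of_nonneg hr.le]
  refine ⟨r • u, ⟨⟨hr_ge.trans_eq h_norm.symm, h_norm.trans_le hr_le⟩, ?_⟩, ?_⟩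
  · rwa [K.2.isStationary_smul_iff hu_ne hr]
  · simp only [h_norm, K.2.supportPt_smul hu_ne hr]

theorem hausdorffMeasure_image_supportPt_not_isStationary_eq_zero
    (h : ∀ᵐ u ∂volume.restrict (annulus V),
      curvatureDet (supportFn K.1) u = 0 ∨ IsStationary K.1 u) :
    Measure.hausdorffMeasure (Module.finrank ℝ V - 1 : ℝ)
      (supportPt K.1 '' {u | ‖u‖ = 1 ∧ ¬ IsStationary K.1 u}) = 0 := by
  let b := stdOrthonormalBasis ℝ V
  let N (e : V) (m : ℕ) : Set V :=
    supportPt K.1 '' {u | ‖u‖ = 1 ∧ 1 / ((m : ℝ) + 1) ≤ inner ℝ u e ∧ ¬ IsStationary K.1 u}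
  have hN {e : V} (he : ‖e‖ = 1) (m : ℕ) :
      Measure.hausdorffMeasure (Module.finrank ℝ V - 1 : ℝ) (N e m) = 0 :=
    hausdorffMeasure_image_supportPt_of_le_inner_eq_zero h he (by positivity)
  refine measure_mono_null (t := ⋃ (i) (m : ℕ), N (b i) m ∪ N (-b i) m) ?_
    (measure_iUnion_null fun i => measure_iUnion_null fun m => measure_union_null
      (hN (b.norm_eq_one i) m) (hN ((norm_neg _).trans (b.norm_eq_one i)) m))
  rintro _ ⟨u, ⟨hu, hu_stat⟩, rfl⟩
  obtain ⟨i, hi | hi⟩ := exists_inner_pos b (ne_zero_of_norm_eq_one hu)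
  all_goals obtain ⟨m, hm⟩ := exists_nat_one_div_lt hi
  · exact Set.mem_iUnion₂.2 ⟨i, m, Or.inl ⟨u, ⟨hu, hm.le, hu_stat⟩, rfl⟩⟩
  · exact Set.mem_iUnion₂.2 ⟨i, m, Or.inr ⟨u, ⟨hu, hm.le, hu_stat⟩, rfl⟩⟩

end Negligible

/-! ### Typical bodies of constant width -/

section Smooth

variable {K : ConvexBody V} {d : ℝ} {u : V}

theorem mem_frontier_of_isGreatest {S : Set V} {x : V} {l : ℝ}
    (hl : IsGreatest {l : ℝ | x + l • u ∈ S} l) : x + l • u ∈ frontier S := by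
  have h_line : Continuous fun l : ℝ => x + l • u := by fun_prop
  refine h_line.frontier_preimage_subset S ⟨subset_closure hl.1, fun h_int => ?_⟩
  have h_Iio := interior_mono (show _ ⊆ Set.Iic l from hl.2) h_int
  rw [interior_Iic] at h_Iio
  exact lt_irrefl l h_Iio

variable [FiniteDimensional ℝ V]

theorem IsSmooth.image_orthogonalProjectionOnto_mem_nhds (hK_smooth : IsSmooth K)
    (hK : HasConstantWidth K d) (hd : 0 < d) (hu : ‖u‖ = 1) {N : Set V} (hN : N ∈ 𝓝 u) :
    (ℝ ∙ u)ᗮ.orthogonalProjectionOnto '' (supportPt K '' {w | ‖w‖ = 1 ∧ w ∈ N}) ∈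
      𝓝 ((ℝ ∙ u)ᗮ.orthogonalProjectionOnto (supportPt K u)) := by
  set P := (ℝ ∙ u)ᗮ.orthogonalProjectionOnto
  set x := supportPt K u
  obtain ⟨ε, hε, h_normal⟩ :=
    Metric.eventually_nhds_iff.1 (hK_smooth.eventually_normal_mem hK hu hN)
  have h_top : ∀ᶠ v in 𝓝 (0 : V), inner ℝ v u = 0 →
      ∃ l, IsGreatest {l : ℝ | x + v + l • u ∈ (K : Set V)} l ∧ ‖v + l • u‖ < ε :=
    eventually_exists_isGreatest_normal_line K.convex K.isClosed
      (isOuterUnitNormal_supportPt K hu) (half_pos hd)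
      (hK.supportPt_sub_half_mem_interior hd.ne' hu) hε
  have h_shift : Tendsto (fun p => ((p - P x : (ℝ ∙ u)ᗮ) : V)) (𝓝 (P x)) (𝓝 0) :=
    Continuous.tendsto' (by fun_prop) _ _ (by rw [sub_self, Submodule.coe_zero])
  filter_upwards [h_shift.eventually h_top] with p hp
  obtain ⟨l, hl, h_norm⟩ :=
    hp (Submodule.mem_orthogonal_singleton_iff_inner_left.1 (p - P x).2)
  obtain ⟨w, hw, h_eq⟩ := hK.exists_eq_supportPt_of_mem_frontier (mem_frontier_of_isGreatest hl)
  refine ⟨_, ⟨w, ⟨hw, h_normal ?_ w hw h_eq⟩, h_eq.symm⟩, ?_⟩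
  · rwa [dist_eq_norm, add_assoc, add_sub_cancel_left]
  · have hPu : P u = 0 := Submodule.orthogonalProjectionOnto_orthogonal_apply_eq_zero
      (Submodule.mem_span_singleton_self u)
    rw [map_add, map_add, map_smul, hPu, smul_zero, add_zero,
      Submodule.orthogonalProjectionOnto_mem_subspace_eq_self, add_sub_cancel]

variable [MeasurableSpace V] [BorelSpace V]

theorem IsSmooth.hausdorffMeasure_image_supportPt_ne_zero (hK_smooth : IsSmooth K)
    (hK : HasConstantWidth K d) (hd : 0 < d) (hu : ‖u‖ = 1) {N : Set V} (hN : N ∈ 𝓝 u) :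
    Measure.hausdorffMeasure (Module.finrank ℝ V - 1 : ℝ)
      (supportPt K '' {w | ‖w‖ = 1 ∧ w ∈ N}) ≠ 0 := by
  intro h_zero
  rw [← cast_finrank_orthogonal_singleton (ne_zero_of_norm_eq_one hu)] at h_zero
  have h_le := (ℝ ∙ u)ᗮ.lipschitzWith_orthogonalProjectionOnto.hausdorffMeasure_image_le
    (d := Module.finrank ℝ (ℝ ∙ u)ᗮ) (Nat.cast_nonneg _)
    (supportPt K '' {w | ‖w‖ = 1 ∧ w ∈ N})
  rw [h_zero, mul_zero, nonpos_iff_eq_zero, hausdorffMeasure_finrank_eq_zero_iff] at h_le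
  exact (Measure.measure_pos_of_mem_nhds volume
    (hK_smooth.image_orthogonalProjectionOnto_mem_nhds hK hd hu hN)).ne' h_le

theorem IsSmooth.not_countable_isStationary (hK_smooth : IsSmooth K) (hK : HasConstantWidth K d)
    (hd : 0 < d) (hn : 2 ≤ Module.finrank ℝ V)
    (h_null : Measure.hausdorffMeasure (Module.finrank ℝ V - 1 : ℝ)
      (supportPt K '' {u | ‖u‖ = 1 ∧ ¬ IsStationary K u}) = 0)
    (hu : ‖u‖ = 1) {N : Set V} (hN : N ∈ 𝓝 u) :
    ¬ {w | ‖w‖ = 1 ∧ w ∈ N ∧ IsStationary K w}.Countable := by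
  intro h_countable
  have h_dim : (0 : ℝ) < Module.finrank ℝ V - 1 := by
    have : (2 : ℝ) ≤ Module.finrank ℝ V := by exact_mod_cast hn
    linarith
  have := Measure.nullSingletonClass_hausdorff V h_dim
  refine hK_smooth.hausdorffMeasure_image_supportPt_ne_zero hK hd hu hN
    (measure_mono_null ?_ (measure_union_null ((h_countable.image (supportPt K)).measure_zero _)
      h_null))
  rintro _ ⟨w, ⟨hw, hwN⟩, rfl⟩
  by_cases hw_stat : IsStationary K w
  · exact Or.inl ⟨w, ⟨hw, hwN, hw_stat⟩, rfl⟩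
  · exact Or.inr ⟨w, ⟨hw, hw_stat⟩, rfl⟩

theorem IsSmooth.ae_allRadiiOfCurvatureEq_width (hK_smooth : IsSmooth K)
    (hK : HasConstantWidth K d) (hd : 0 < d)
    (h_null : Measure.hausdorffMeasure (Module.finrank ℝ V - 1 : ℝ)
      (supportPt K '' {u | ‖u‖ = 1 ∧ ¬ IsStationary K u}) = 0) :
    ∀ᵐ x ∂(Measure.hausdorffMeasure (Module.finrank ℝ V - 1 : ℝ) : Measure V),
      x ∈ frontier (K : Set V) → AllRadiiOfCurvatureEq (K : Set V) x (ENNReal.ofReal d) := by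
  filter_upwards [measure_eq_zero_iff_ae_notMem.1 h_null] with x hx hx_frontier
  obtain ⟨u, hu, rfl⟩ := hK.exists_eq_supportPt_of_mem_frontier hx_frontier
  refine IsStationary.allRadiiOfCurvatureEq_width ?_ hK hd hK_smooth hu
  by_contra hu_stat
  exact hx ⟨u, ⟨hu, hu_stat⟩, rfl⟩

theorem IsSmooth.not_countable_allRadiiOfCurvatureEq_zero (hK_smooth : IsSmooth K)
    (hK : HasConstantWidth K d) (hd : 0 < d) (hn : 2 ≤ Module.finrank ℝ V)
    (h_null : Measure.hausdorffMeasure (Module.finrank ℝ V - 1 : ℝ)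
      (supportPt K '' {u | ‖u‖ = 1 ∧ ¬ IsStationary K u}) = 0)
    {N : Set V} (hN : N ∈ 𝓝 (supportPt K u)) (hu : ‖u‖ = 1) :
    ¬ {x ∈ N | AllRadiiOfCurvatureEq (K : Set V) x 0}.Countable := by
  have h_cont : ContinuousAt (fun w => supportPt K (-w)) (-u) := by
    refine ContinuousAt.comp (g := supportPt K) ?_ continuous_neg.continuousAt
    rw [neg_neg]
    exact hK.continuousAt_supportPt (ne_zero_of_norm_eq_one hu)
  have h_nhds : (fun w => supportPt K (-w)) ⁻¹' N ∈ 𝓝 (-u) :=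
    h_cont (by simpa only [neg_neg] using hN)
  have h_mapsTo : Set.MapsTo (fun w => supportPt K (-w))
      {w | ‖w‖ = 1 ∧ w ∈ (fun w => supportPt K (-w)) ⁻¹' N ∧ IsStationary K w}
      {x ∈ N | AllRadiiOfCurvatureEq (K : Set V) x 0} := fun w hw =>
    ⟨hw.2.1, hw.2.2.allRadiiOfCurvatureEq_zero hK hd hK_smooth hw.1⟩
  refine fun h_countable => hK_smooth.not_countable_isStationary hK hd hn h_null
    (by rwa [norm_neg]) h_nhds (h_mapsTo.countable_of_injOn ?_ h_countable)
  intro w hw w' hw' h_eq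
  have hw_normal := isOuterUnitNormal_supportPt K ((norm_neg w).trans hw.1)
  have hw'_normal := isOuterUnitNormal_supportPt K ((norm_neg w').trans hw'.1)
  rw [← show supportPt K (-w) = supportPt K (-w') from h_eq] at hw'_normal
  exact neg_injective (hK_smooth hw_normal hw'_normal)

end Smooth

theorem _root_.mainTheorem1_general [FiniteDimensional ℝ V] [MeasurableSpace V] [BorelSpace V]
    (hn : 2 ≤ Module.finrank ℝ V) :
    ∀ᶠ K in residual (ConstantWidthOne V),
      (∀ᵐ x ∂(Measure.hausdorffMeasure (Module.finrank ℝ V - 1 : ℝ) : Measure V),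
        x ∈ frontier (K.1 : Set V) → AllRadiiOfCurvatureEq (K.1 : Set V) x 1) ∧
      ¬ {x | AllRadiiOfCurvatureEq (K.1 : Set V) x 0}.Countable ∧
      frontier (K.1 : Set V) ⊆ closure {x | AllRadiiOfCurvatureEq (K.1 : Set V) x 0} := by
  have : Nontrivial V := Module.nontrivial_of_finrank_pos (R := ℝ) (by lia)
  filter_upwards [eventually_residual_isSmooth,
    eventually_residual_ae_curvatureDet_eq_zero_or_isStationary] with K hK_smooth h_ae
  have h_null := hausdorffMeasure_image_supportPt_not_isStationary_eq_zero h_ae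
  have h_zero {u : V} (hu : ‖u‖ = 1) {N : Set V} (hN : N ∈ 𝓝 (supportPt K.1 u)) :=
    hK_smooth.not_countable_allRadiiOfCurvatureEq_zero K.2 one_pos hn h_null hN hu
  refine ⟨?_, fun h_countable => ?_, fun x hx => mem_closure_iff_nhds.2 fun N hN => ?_⟩
  · simpa only [ENNReal.ofReal_one] using
      hK_smooth.ae_allRadiiOfCurvatureEq_width K.2 one_pos h_null
  · obtain ⟨u, hu⟩ := exists_norm_eq V zero_le_one
    exact h_zero hu univ_mem (h_countable.mono fun x hx => hx.2)
  · obtain ⟨u, hu, rfl⟩ := K.2.exists_eq_supportPt_of_mem_frontier hx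
    by_contra h_empty
    exact h_zero hu hN (Set.countable_empty.mono fun x hx => h_empty ⟨x, hx⟩)

end ConstantWidth

end

/-- For a typical convex body `K` of constant width `1` in `ℝⁿ`, `n ≥ 2`, all radii of curvature
are `1` at almost all boundary points, and the set of boundary points at which all radii of
curvature are `0` is uncountable and dense in the boundary. -/
theorem mainTheorem1 (n : ℕ) (hn : 2 ≤ n) :
    ∀ᶠ K : ConstantWidth.ConstantWidthOne (EuclideanSpace ℝ (Fin n)) in residual _,
      (∀ᵐ x ∂(Measure.hausdorffMeasure ((n : ℝ) - 1) : Measure (EuclideanSpace ℝ (Fin n))),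
        x ∈ frontier (K.1 : Set (EuclideanSpace ℝ (Fin n))) →
          ConstantWidth.AllRadiiOfCurvatureEq (K.1 : Set (EuclideanSpace ℝ (Fin n))) x 1) ∧
      ¬ {x | ConstantWidth.AllRadiiOfCurvatureEq
          (K.1 : Set (EuclideanSpace ℝ (Fin n))) x 0}.Countable ∧
      frontier (K.1 : Set (EuclideanSpace ℝ (Fin n))) ⊆
        closure {x | ConstantWidth.AllRadiiOfCurvatureEq
          (K.1 : Set (EuclideanSpace ℝ (Fin n))) x 0} := by
  have h := mainTheorem1_general (V := EuclideanSpace ℝ (Fin n))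
    (by rwa [finrank_euclideanSpace_fin])
  rwa [finrank_euclideanSpace_fin] at h
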